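/- Let $d<0$ be a square-free integer with $d\neq -1,-3$, let $F=\mathbb{Q}(\sqrt d)$ with ring of integers $R$ and ideal class group $\mathrm{Cl}_F$, and let $x\mapsto\overline{x}$ be the nontrivial automorphism of $F$. Regard $F$ as a quadratic space over $\mathbb{Q}$ with the norm form $N=N_{F/\mathbb{Q}}$, that is, with the bilinear form $B$ given by $2B(x,y)=N(x+y)-N(x)-N(y)$; let $O(F)$ be its orthogonal group, $O^+(F)$ the subgroup of elements of determinant $1$, and $O^-(F)=O(F)\setminus O^+(F)$ the set of reflections. For a nonzero fractional ideal $I$ of $F$ put \[ \mathrm{Refl}_I(s)=\sum_{\rho\in O^-(F)} Z_{I,\rho}(s),\qquad Z_{I,\rho}(s)=\sum_{\substack{K\subseteq I\\ \rho(K)=K}}\frac{|I:K|^{-s}}{\#\{\sigma\in O(F):\sigma(K)\subseteq I\}}, \] where $K$ runs over the $\mathbb{Z}$-submodules of finite index in $I$. Let $\prod_r$ denote the product over the primes $r$ ramified in $F$ (the primes dividing the discriminant of $F$); the prime ideal $\gamma$ with $(r)=\gamma^2$ is called the ramified factor above $r$. Let $[\mathscr{I}_{\mathrm{ram}}]\le\mathrm{Cl}_F$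 be the subgroup generated by the classes of all ramified factors and $[\mathscr{I}_{\mathrm{ortho}}]\le\mathrm{Cl}_F$ the subgroup generated by the classes of all ramified factors except the one above $2$. Below, $J$ runs over the nonzero fractional ideals contained in $I$, and $[J]$ is the class of $J$ in $\mathrm{Cl}_F$. Then for every $s\in\mathbb{C}$ with $\Re(s)>1$ the double series defining $\mathrm{Refl}_I(s)$ and all the Dirichlet series below converge absolutely, and the following hold. (1) If $d\equiv 1\pmod 4$, then \[ \mathrm{Refl}_I(s)=\frac{(1-2^{-s}+2\cdot 2^{-2s})\,\zeta(s)^2}{2\zeta(2s)\prod_r(1+r^{-s})}\sum_{n=1}^\infty\frac{\#\{[J]:|I:J|=n,\ [J]=[\overline J]\}}{n^s}. \] (2) If $d\equiv 2\pmod 4$, then \[ \begin{aligned} \mathrm{Refl}_I(s)&=\frac{(1-2^{-s}+2\cdot 2^{-2s})\,\zeta(s)^2}{2\zeta(2s)\prod_r(1+r^{-s})}\sum_{n=1}^\infty\frac{\#\{[J]:|I:J|=n,\ [J]=[\overline J]\}}{n^s}\\ &\quad+\frac{(2^{-s}-2^{-2s})\,\zeta(s)^2}{\zeta(2s)\prod_r(1+r^{-s})}\sum_{n=1}^\infty\frac{\#\{[J]\in[\mathscr{I}_{\mathrm{ram}}]:|I:J|=n\}}{n^s}.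 \end{aligned} \] (3) If $d\equiv 3\pmod 4$, then \[ \begin{aligned} \mathrm{Refl}_I(s)&=\frac{(1-2^{-s}+2\cdot 2^{-2s})\,\zeta(s)^2}{2\zeta(2s)\prod_r(1+r^{-s})}\sum_{n=1}^\infty\frac{\#\{[J]:|I:J|=n,\ [J]=[\overline J]\}}{n^s}\\ &\quad+\frac{2^{-s}\,\zeta(s)^2}{\zeta(2s)\prod_r(1+r^{-s})}\sum_{n=1}^\infty\frac{\#\{[J]\in[\mathscr{I}_{\mathrm{ortho}}]:|I:J|=n\}}{n^s}\\ &\quad-\frac{2^{-2s}\,\zeta(s)^2}{\zeta(2s)\prod_r(1+r^{-s})}\sum_{n=1}^\infty\frac{\#\{[J]\in[\mathscr{I}_{\mathrm{ram}}]\setminus[\mathscr{I}_{\mathrm{ortho}}]:|I:J|=n\}}{n^s}. \end{aligned} \] -/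

import Mathlib

open scoped nonZeroDivisors NumberField

noncomputable section

namespace LatticeZeta

section Field

variable (F : Type*) [Field F] [NumberField F]

/-! ### The quadratic space `(F, N)` over `ℚ` and the reflection sum of a lattice -/

/-- The symmetric bilinear form `B` with `2 B(x, y) = N(x + y) - N(x) - N(y)`, where `N` is the
norm from `F` to `ℚ`. -/
def bilin (x y : F) : ℚ :=
  (Algebra.norm ℚ (x + y) - Algebra.norm ℚ x - Algebra.norm ℚ y) / 2

/-- The orthogonal group `O(F)`, as a set of `ℚ`-linear automorphisms of `F`. -/
def orthogonalSet : Set (F ≃ₗ[ℚ] F) :=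
  {σ | ∀ x y : F, bilin F (σ x) (σ y) = bilin F x y}

/-- The special orthogonal group `O⁺(F) = O(F) ∩ SL(F)`. -/
def rotations : Set (F ≃ₗ[ℚ] F) :=
  {σ | σ ∈ orthogonalSet F ∧ LinearMap.det (σ : F →ₗ[ℚ] F) = 1}

/-- The set of reflections `O⁻(F) = O(F) \ O⁺(F)`. -/
def reflections : Set (F ≃ₗ[ℚ] F) :=
  orthogonalSet F \ rotations F

variable {F}

/-- The image `σ(K)` of an additive subgroup `K` of `F`. -/
def image (σ : F ≃ₗ[ℚ] F) (K : AddSubgroup F) : AddSubgroup F :=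
  K.map (σ : F →ₗ[ℚ] F).toAddMonoidHom

/-- The sublattices `K ⊆ L` of finite index (`relIndex` is `0` if the index is infinite) with
`ρ(K) = K`. -/
def InvariantSublattice (L : AddSubgroup F) (ρ : F ≃ₗ[ℚ] F) : Type _ :=
  {K : AddSubgroup F // K ≤ L ∧ K.relIndex L ≠ 0 ∧ image ρ K = K}

/-- The summand `|L : K|^{-s} / #{σ ∈ O(F) : σ(K) ⊆ L}`. -/
def zTerm (L : AddSubgroup F) (s : ℂ) (K : AddSubgroup F) : ℂ :=
  (K.relIndex L : ℂ) ^ (-s) /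
    (Nat.card {σ : F ≃ₗ[ℚ] F // σ ∈ orthogonalSet F ∧ image σ K ≤ L} : ℂ)

/-- `Z_{L,ρ}(s)`: the sum of `|L : K|^{-s} / #{σ ∈ O(F) : σ(K) ⊆ L}` over all sublattices
`K ⊆ L` of finite index with `ρ(K) = K`. -/
def zSeries (L : AddSubgroup F) (ρ : F ≃ₗ[ℚ] F) (s : ℂ) : ℂ :=
  ∑' K : InvariantSublattice L ρ, zTerm L s K.1

/-- `Refl_L(s)`: the sum of `Z_{L,ρ}(s)` over all reflections `ρ` of `F`. -/
def reflSum (L : AddSubgroup F) (s : ℂ) : ℂ :=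
  ∑' ρ : reflections F, zSeries L ρ.1 s

/-- Absolute convergence of the double series that defines `Refl_L(s)`. -/
def ReflSummable (L : AddSubgroup F) (s : ℂ) : Prop :=
  Summable fun p : Σ ρ : reflections F, InvariantSublattice L ρ.1 => zTerm L s p.2.1

/-! ### Fractional ideals and classes -/

/-- A nonzero fractional ideal of `F`, regarded as a lattice in `F`. -/
def lattice (I : (FractionalIdeal (𝓞 F)⁰ F)ˣ) : AddSubgroup F :=
  ((I : FractionalIdeal (𝓞 F)⁰ F) : Submodule (𝓞 F) F).toAddSubgroup

/-- The class `[J]` of a nonzero fractional ideal in the ideal class group `Cl_F`. -/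
def idealClass (J : (FractionalIdeal (𝓞 F)⁰ F)ˣ) : ClassGroup (𝓞 F) :=
  ClassGroup.mk F J

/-- The number of ideal classes `[J]` of fractional ideals `J ≤ I` with `|I : J| = n` that
satisfy the condition `P J`. -/
def classCount (I : (FractionalIdeal (𝓞 F)⁰ F)ˣ)
    (P : (FractionalIdeal (𝓞 F)⁰ F)ˣ → Prop) (n : ℕ) : ℕ :=
  Set.ncard {g : ClassGroup (𝓞 F) | ∃ J : (FractionalIdeal (𝓞 F)⁰ F)ˣ,
    lattice J ≤ lattice I ∧ (lattice J).relIndex (lattice I) = n ∧ P J ∧ idealClass J = g}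

/-- The Dirichlet series `∑_{n ≥ 1} #{[J] : J ≤ I, |I : J| = n, P J} n^{-s}`. -/
def classSeries (I : (FractionalIdeal (𝓞 F)⁰ F)ˣ)
    (P : (FractionalIdeal (𝓞 F)⁰ F)ˣ → Prop) (s : ℂ) : ℂ :=
  LSeries (fun n => (classCount I P n : ℂ)) s

variable (F)

/-! ### Ramification -/

/-- The rational primes that ramify in `F`: the prime divisors of the discriminant of `F`. -/
def ramifiedPrimes : Finset ℕ :=
  (NumberField.discr F).natAbs.primeFactors

/-- `γ` is the ramified factor above `r`: a prime ideal with `(r) = γ²`, `r` a ramified prime. -/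
def IsRamifiedFactor (r : ℕ) (γ : (Ideal (𝓞 F))⁰) : Prop :=
  r ∈ ramifiedPrimes F ∧ (γ : Ideal (𝓞 F)).IsPrime ∧
    (γ : Ideal (𝓞 F)) ^ 2 = Ideal.span {(r : 𝓞 F)}

/-- The subgroup of the class group generated by the classes of all ramified factors. -/
def ramSubgroup : Subgroup (ClassGroup (𝓞 F)) :=
  Subgroup.closure {g | ∃ r γ, IsRamifiedFactor F r γ ∧ ClassGroup.mk0 γ = g}

/-- The subgroup of the class group generated by the classes of all ramified factors except the
one above `2`. -/
def orthoSubgroup : Subgroup (ClassGroup (𝓞 F)) :=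
  Subgroup.closure {g | ∃ r γ, r ≠ 2 ∧ IsRamifiedFactor F r γ ∧ ClassGroup.mk0 γ = g}

/-- The finite product of `1 + r^{-s}` over the primes `r` ramified in `F`. -/
def ramProd (s : ℂ) : ℂ :=
  ∏ r ∈ ramifiedPrimes F, (1 + (r : ℂ) ^ (-s))

end Field

/-! ### Conjugation in a quadratic field -/

section Quadratic

variable (F : Type*) [Field F] [NumberField F] [Algebra.IsQuadraticExtension ℚ F]

theorem existsUnique_ne_one : ∃! τ : F ≃ₐ[ℚ] F, τ ≠ 1 := by
  have h : Nat.card (F ≃ₐ[ℚ] F) = 2 := by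
    rw [IsGalois.card_aut_eq_finrank, Algebra.IsQuadraticExtension.finrank_eq_two]
  obtain ⟨τ, hτ, hτ'⟩ := (Nat.card_eq_two_iff' (1 : F ≃ₐ[ℚ] F)).1 h
  exact ⟨τ, hτ, hτ'⟩

/-- Conjugation: the nontrivial automorphism of the quadratic field `F`. -/
def conj : F ≃ₐ[ℚ] F :=
  (existsUnique_ne_one F).choose

variable {F}

/-- The conjugate of a nonzero fractional ideal. -/
def conjIdeal (J : (FractionalIdeal (𝓞 F)⁰ F)ˣ) : (FractionalIdeal (𝓞 F)⁰ F)ˣ :=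
  Units.map (FractionalIdeal.ringEquivOfRingEquiv F F
    (NumberField.RingOfIntegers.mapRingEquiv (conj F).toRingEquiv)).toMonoidHom J

theorem mem_conjIdeal (J : (FractionalIdeal (𝓞 F)⁰ F)ˣ) (x : F) :
    x ∈ (conjIdeal J : FractionalIdeal (𝓞 F)⁰ F) ↔
      ∃ y ∈ (J : FractionalIdeal (𝓞 F)⁰ F), conj F y = x := by
  have key (y : F) : IsFractionRing.ringEquivOfRingEquiv (K := F) (L := F)
      (NumberField.RingOfIntegers.mapRingEquiv (conj F).toRingEquiv) y = conj F y := by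
    obtain ⟨a, b, rfl⟩ := IsLocalization.exists_mk'_eq (𝓞 F)⁰ y
    have hb : algebraMap (𝓞 F) F b ≠ 0 := by simp
    simp only [IsFractionRing.mk'_eq_div, map_div₀,
      IsFractionRing.ringEquivOfRingEquiv_algebraMap]
    rfl
  constructor
  · rintro ⟨y, hy, rfl⟩
    exact ⟨y, hy, (key y).symm⟩
  · rintro ⟨y, hy, rfl⟩
    exact ⟨y, hy, key y⟩

/-- `[J] = [J̄]`. -/
def ConjInvariantClass (J : (FractionalIdeal (𝓞 F)⁰ F)ˣ) : Prop :=
  idealClass J = idealClass (conjIdeal J)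

end Quadratic

end LatticeZeta

end

set_option linter.unusedSectionVars false

noncomputable section

namespace LatticeZeta

section

/-! A reflection of `F` is z ↦ (α/ᾱ) z̄, with α determined up to a nonzero rational factor
(`exists_reflOf`, `reflOf_eq_iff`). It preserves K exactly when α⁻¹K is stable under conjugation. A
conjugation-stable lattice is a rational multiple of ℤx + ℤyδ (rectangular) or ℤx + ℤ(x + yδ)/2
(rhombic) with x, y coprime, in one way up to sign (`exists_shape`, `shapeLat_eq_scale`). So the
pairs (ρ, K) correspond to pairs (α, w) of a multiplier and a shape, modulo α ↦ -α.

Let Λ be the lattice of shape w and J the fractional ideal it generates. Since I is an ideal, αΛ ⊆ I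
iff αJ ⊆ I, and then |I : αΛ| = |J : Λ| |I : αJ|. The denominator of the summand counts two
isometries for each β with N(β) = N(α) and βΛ ⊆ I (`card_orthogonal`), and these β are exactly the
ones with |I : βJ| = |I : αJ|. The denominators therefore cancel once the terms are grouped by w and
n = |I : αJ|: Refl_I(s) is a quarter of the sum over w of |J : Λ|^{-s} ∑ n^{-s}, where n runs over
the indices in I of the ideals of class [J] (`refl_summable_iff_and_tsum_eq`).

Put t = gcd(x, d). The index |J : Λ| is xy/t times 1, 2 or 4 (`relIndex_shape`), and [J] is the
class of γ_t = (t, δ), multiplied by the class of (1, (1 + δ)/2) for rhombic shapes with x, y odd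
when d ≡ 3 (mod 4) (`idealClass_shapeIdeal`). For fixed t the sum of (xy/t)^{-s} is ζ(s)²/ζ(2s)
divided by the product of 1 + p^{-s} over the primes p dividing d, whatever t is
(`coprimeSum_mul_prod`). For odd d, the restriction to odd x and y costs a factor (1 - 2^{-s})/(1 +
2^{-s}) (`coprimeSum_odd`).

Because the units are ±1, γ_t and γ_t' have the same class only for t' = t or tt' = |d|
(`idealClass_γ_eq_iff`). Hence the sum over t meets each class generated by the ramified factors
above primes dividing d exactly twice. A class fixed by conjugation contains a conjugation-stable
ideal, so it is the class of a shape; the fixed classes are thus the group just described, together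
with its coset by (1, (1 + δ)/2) when d ≡ 3 (mod 4) (`conjInvariantClass_iff`). The three formulas
follow by comparing coefficients on the two cosets. -/

/-- A square root `δ` of a negative squarefree integer `d ≠ -1, -3` in `F`. -/
structure ImagQuad (F : Type*) [Field F] where
  d : ℤ
  δ : F
  neg : d < 0
  sqf : Squarefree d
  ne_neg_one : d ≠ -1
  ne_neg_three : d ≠ -3
  sq : δ ^ 2 = (d : F)

namespace ImagQuad

/-! ### Coordinates with respect to 1, δ; conjugation, norm and trace. -/

section Coordinates

variable {F : Type*} [Field F] [NumberField F] (q : ImagQuad F)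

theorem δ_mul_δ : q.δ * q.δ = (q.d : F) := by rw [← q.sq, pow_two]

theorem d_neg_rat : (q.d : ℚ) < 0 := by exact_mod_cast q.neg

theorem δ_ne_zero : q.δ ≠ 0 := by
  intro h
  have := q.sq
  rw [h, zero_pow two_ne_zero] at this
  have h2 : q.d = 0 := by exact_mod_cast this.symm
  exact q.neg.ne h2

/-- Since d < 0 the form is positive definite. -/
theorem sq_sub_eq_zero {a b : ℚ} (h : a ^ 2 - q.d * b ^ 2 = 0) : a = 0 ∧ b = 0 := by
  have hd := q.d_neg_rat
  have hb : b = 0 := by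
    by_contra hb
    have : 0 < b ^ 2 := by positivity
    nlinarith [sq_nonneg a]
  subst hb
  exact ⟨by simpa using h, rfl⟩

theorem coords_eq_zero {a b : ℚ} (h : (a : F) + b * q.δ = 0) : a = 0 ∧ b = 0 := by
  apply q.sq_sub_eq_zero
  have h2 : ((a : F) + b * q.δ) * (a - b * q.δ) = 0 := by rw [h, zero_mul]
  have h3 : (a : F) ^ 2 - q.d * b ^ 2 = 0 := by
    rw [← h2]; linear_combination (b : F) ^ 2 * q.sq
  exact_mod_cast h3

theorem coords_inj {a b a' b' : ℚ} (h : (a : F) + b * q.δ = a' + b' * q.δ) : a = a' ∧ b = b' := by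
  have := q.coords_eq_zero (a := a - a') (b := b - b') (by push_cast; linear_combination h)
  exact ⟨sub_eq_zero.1 this.1, sub_eq_zero.1 this.2⟩

theorem linearIndependent : LinearIndependent ℚ ![(1 : F), q.δ] := by
  rw [LinearIndependent.pair_iff]
  intro a b h
  apply q.coords_eq_zero
  simpa [Algebra.smul_def] using h

variable [Algebra.IsQuadraticExtension ℚ F]

/-- The basis `1, δ` of `F`. -/
def basis : Module.Basis (Fin 2) ℚ F :=
  basisOfLinearIndependentOfCardEqFinrank q.linearIndependent
    (by simp [Algebra.IsQuadraticExtension.finrank_eq_two])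

@[simp] theorem basis_zero : q.basis 0 = 1 := by simp [basis]
@[simp] theorem basis_one : q.basis 1 = q.δ := by simp [basis]

theorem exists_coords (z : F) : ∃ a b : ℚ, z = a + b * q.δ := by
  refine ⟨q.basis.repr z 0, q.basis.repr z 1, ?_⟩
  conv_lhs => rw [← q.basis.sum_repr z]
  simp [Fin.sum_univ_two, Algebra.smul_def]

theorem conj_ne_one : conj F ≠ 1 := (existsUnique_ne_one F).choose_spec.1

theorem conj_δ : conj F q.δ = -q.δ := by
  have h : conj F q.δ ^ 2 = q.δ ^ 2 := by rw [← map_pow, q.sq, map_intCast]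
  rcases sq_eq_sq_iff_eq_or_eq_neg.1 h with h | h
  · exfalso
    apply conj_ne_one (F := F)
    ext z
    obtain ⟨a, b, rfl⟩ := q.exists_coords z
    simp [h]
  · exact h

theorem conj_coords (a b : ℚ) : conj F (a + b * q.δ) = a - b * q.δ := by
  simp [q.conj_δ, sub_eq_add_neg]

theorem conj_conj (q : ImagQuad F) (z : F) : conj F (conj F z) = z := by
  obtain ⟨a, b, rfl⟩ := q.exists_coords z
  simp [q.conj_δ]

theorem univ_aut [DecidableEq (F ≃ₐ[ℚ] F)] :
    (Finset.univ : Finset (F ≃ₐ[ℚ] F)) = {1, conj F} := by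
  ext τ
  simp only [Finset.mem_univ, Finset.mem_insert, Finset.mem_singleton, true_iff]
  by_cases h : τ = 1
  · exact Or.inl h
  · exact Or.inr ((existsUnique_ne_one F).choose_spec.2 τ h)

theorem norm_eq (z : F) : (Algebra.norm ℚ z : F) = z * conj F z := by
  classical
  have := Algebra.norm_eq_prod_automorphisms ℚ z
  rw [univ_aut, Finset.prod_pair (Ne.symm conj_ne_one)] at this
  simpa using this

theorem trace_eq (z : F) : (Algebra.trace ℚ F z : F) = z + conj F z := by
  classical
  have := trace_eq_sum_automorphisms (K := ℚ) z
  rw [univ_aut, Finset.sum_pair (Ne.symm conj_ne_one)] at this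
  simpa using this

theorem norm_coords (a b : ℚ) : Algebra.norm ℚ ((a : F) + b * q.δ) = a ^ 2 - q.d * b ^ 2 := by
  have h : ((Algebra.norm ℚ ((a : F) + b * q.δ) : ℚ) : F) = ((a ^ 2 - q.d * b ^ 2 : ℚ) : F) := by
    rw [norm_eq, q.conj_coords]; push_cast; linear_combination -(b : F) ^ 2 * q.sq
  exact_mod_cast h

theorem trace_coords (a b : ℚ) : Algebra.trace ℚ F ((a : F) + b * q.δ) = 2 * a := by
  have h : ((Algebra.trace ℚ F ((a : F) + b * q.δ) : ℚ) : F) = ((2 * a : ℚ) : F) := by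
    rw [trace_eq, q.conj_coords]; push_cast; ring
  exact_mod_cast h

theorem norm_nonneg (q : ImagQuad F) (z : F) : 0 ≤ Algebra.norm ℚ z := by
  obtain ⟨a, b, rfl⟩ := q.exists_coords z
  rw [q.norm_coords]
  nlinarith [sq_nonneg a, sq_nonneg b, q.d_neg_rat, mul_nonneg (neg_nonneg.2 q.d_neg_rat.le) (sq_nonneg b)]

theorem norm_pos (q : ImagQuad F) {z : F} (hz : z ≠ 0) : 0 < Algebra.norm ℚ z :=
  lt_of_le_of_ne (q.norm_nonneg z) (Ne.symm (Algebra.norm_ne_zero_iff.2 hz))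

theorem norm_conj (q : ImagQuad F) (z : F) : Algebra.norm ℚ (conj F z) = Algebra.norm ℚ z := by
  obtain ⟨a, b, rfl⟩ := q.exists_coords z
  have := q.norm_coords a (-b)
  rw [q.conj_coords, q.norm_coords]
  rw [show (a : F) - b * q.δ = (a : F) + ((-b : ℚ) : F) * q.δ by push_cast; ring, this]
  ring

/-! ### The orthogonal group -/

theorem bilin_coords (a b a' b' : ℚ) :
    bilin F (a + b * q.δ) (a' + b' * q.δ) = a * a' - q.d * (b * b') := by
  rw [bilin, show (a : F) + b * q.δ + (a' + b' * q.δ) = ((a + a' : ℚ) : F) + ((b + b' : ℚ) : F) * q.δ by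
    push_cast; ring, q.norm_coords, q.norm_coords, q.norm_coords]
  ring

theorem bilin_self (q : ImagQuad F) (z : F) : bilin F z z = Algebra.norm ℚ z := by
  obtain ⟨a, b, rfl⟩ := q.exists_coords z
  rw [q.bilin_coords, q.norm_coords]; ring

/-- Multiplication by a nonzero element. -/
def mulEquiv {F : Type*} [Field F] [NumberField F] (u : F) (hu : u ≠ 0) : F ≃ₗ[ℚ] F :=
  LinearEquiv.ofLinearMap (LinearMap.mulLeft ℚ u) (LinearMap.mulLeft ℚ u⁻¹)
    (by ext; simp [hu]) (by ext; simp [hu])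

@[simp] theorem mulEquiv_apply (u : F) (hu : u ≠ 0) (z : F) : mulEquiv u hu z = u * z := rfl

theorem ne_zero_of_norm_eq_one {u : F} (hu : Algebra.norm ℚ u = 1) : u ≠ 0 := by
  rintro rfl; simp at hu

/-- The rotation `z ↦ u z`. -/
def rot (u : F) (hu : u ≠ 0) : F ≃ₗ[ℚ] F := mulEquiv u hu

/-- The reflection `z ↦ u z̄`. -/
def refl (u : F) (hu : u ≠ 0) : F ≃ₗ[ℚ] F := (conj F).toLinearEquiv.trans (mulEquiv u hu)

@[simp] theorem rot_apply (u : F) (hu : u ≠ 0) (z : F) : rot u hu z = u * z := rfl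
@[simp] theorem refl_apply (u : F) (hu : u ≠ 0) (z : F) : refl u hu z = u * conj F z := rfl

theorem bilin_eq (x y : F) : (bilin F x y : F) = (x * conj F y + y * conj F x) / 2 := by
  rw [bilin]; push_cast; rw [norm_eq, norm_eq, norm_eq, map_add]; ring

theorem rot_mem {u : F} (hu : Algebra.norm ℚ u = 1) (h0 : u ≠ 0) : rot u h0 ∈ orthogonalSet F := by
  intro x y
  have h := norm_eq u
  rw [hu] at h
  have : ((bilin F (rot u h0 x) (rot u h0 y) : ℚ) : F) = (bilin F x y : ℚ) := by
    rw [bilin_eq, bilin_eq]; simp only [rot_apply, map_mul]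
    push_cast at h
    linear_combination -(x * conj F y + y * conj F x) / 2 * h
  exact_mod_cast this

theorem refl_mem (q : ImagQuad F) {u : F} (hu : Algebra.norm ℚ u = 1) (h0 : u ≠ 0) :
    refl u h0 ∈ orthogonalSet F := by
  intro x y
  have h := norm_eq u
  rw [hu] at h
  have : ((bilin F (refl u h0 x) (refl u h0 y) : ℚ) : F) = (bilin F x y : ℚ) := by
    rw [bilin_eq, bilin_eq]; simp only [refl_apply, map_mul, q.conj_conj]
    push_cast at h
    linear_combination -(x * conj F y + y * conj F x) / 2 * h
  exact_mod_cast this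

theorem norm_apply_of_mem (q : ImagQuad F) {σ : F ≃ₗ[ℚ] F} (hσ : σ ∈ orthogonalSet F) (z : F) :
    Algebra.norm ℚ (σ z) = Algebra.norm ℚ z := by
  rw [← q.bilin_self, ← q.bilin_self, hσ]

theorem ext_δ {σ τ : F ≃ₗ[ℚ] F} (h1 : σ 1 = τ 1) (h2 : σ q.δ = τ q.δ) : σ = τ := by
  apply LinearEquiv.toLinearMap_injective
  apply q.basis.ext
  intro i
  fin_cases i
  · simpa using h1
  · simpa using h2

/-- The image u of 1 has norm 1, and u⁻¹σ fixes 1. Orthogonality to 1 leaves only a multiple bδ for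
the image of δ, and preservation of the norm forces b = ±1. The two signs give the rotation and the
reflection. -/
theorem eq_rot_or_refl (q : ImagQuad F) {σ : F ≃ₗ[ℚ] F} (hσ : σ ∈ orthogonalSet F) :
    ∃ (u : F) (h0 : u ≠ 0), Algebra.norm ℚ u = 1 ∧ (σ = rot u h0 ∨ σ = refl u h0) := by
  have hN : Algebra.norm ℚ (σ 1) = 1 := by rw [q.norm_apply_of_mem hσ]; simp
  have h0 := ne_zero_of_norm_eq_one hN
  refine ⟨σ 1, h0, hN, ?_⟩
  obtain ⟨a, b, hab⟩ := q.exists_coords ((σ 1)⁻¹ * σ q.δ)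
  have hδ' : σ q.δ = σ 1 * (a + b * q.δ) := by rw [← hab]; field_simp
  have hn := norm_eq (σ 1)
  rw [hN] at hn
  push_cast at hn
  have hB : ((bilin F (σ 1) (σ q.δ) : ℚ) : F) = (a : ℚ) := by
    rw [bilin_eq, hδ', map_mul, q.conj_coords]
    linear_combination -(a : F) * hn
  have ha : a = 0 := by
    have h1 := q.bilin_coords 1 0 0 1
    simp only [Rat.cast_one, Rat.cast_zero, zero_mul, add_zero, zero_add, one_mul] at h1
    rw [hσ, h1] at hB
    simpa using hB.symm
  subst ha
  have hNδ : Algebra.norm ℚ (σ q.δ) = b ^ 2 * Algebra.norm ℚ q.δ := by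
    have h1 := q.norm_coords 0 b
    have h2 := q.norm_coords 0 1
    simp only [Rat.cast_one, Rat.cast_zero, zero_add, one_mul] at h1 h2
    rw [hδ', map_mul, hN, Rat.cast_zero, zero_add, h1, h2]; ring
  rw [q.norm_apply_of_mem hσ] at hNδ
  have hb : b ^ 2 = 1 := by
    have := Algebra.norm_ne_zero_iff (R := ℚ).2 q.δ_ne_zero
    field_simp at hNδ
    exact hNδ.symm
  rcases sq_eq_sq_iff_eq_or_eq_neg.1 (hb.trans (one_pow 2).symm) with rfl | rfl
  · left; apply q.ext_δ <;> simp [hδ']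
  · right; apply q.ext_δ <;> simp [hδ', q.conj_δ]

theorem det_rot (u : F) (h0 : u ≠ 0) :
    LinearMap.det (rot u h0 : F →ₗ[ℚ] F) = Algebra.norm ℚ u := by
  rw [Algebra.norm_apply]; rfl

theorem det_conj (q : ImagQuad F) : LinearMap.det ((conj F).toLinearEquiv : F →ₗ[ℚ] F) = -1 := by
  rw [← LinearMap.det_toMatrix q.basis, Matrix.det_fin_two]
  have h1 : q.basis.repr 1 = Finsupp.single 0 1 := by rw [← q.basis_zero, q.basis.repr_self]
  have h2 : q.basis.repr q.δ = Finsupp.single 1 1 := by rw [← q.basis_one, q.basis.repr_self]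
  simp [LinearMap.toMatrix_apply, q.conj_δ, h1, h2]

theorem det_refl (q : ImagQuad F) (u : F) (h0 : u ≠ 0) :
    LinearMap.det (refl u h0 : F →ₗ[ℚ] F) = -Algebra.norm ℚ u := by
  have : (refl u h0 : F →ₗ[ℚ] F) = (rot u h0 : F →ₗ[ℚ] F) ∘ₗ ((conj F).toLinearEquiv : F →ₗ[ℚ] F) := rfl
  rw [this, LinearMap.det_comp, det_rot, q.det_conj]; ring

theorem mem_reflections_iff (q : ImagQuad F) {σ : F ≃ₗ[ℚ] F} :
    σ ∈ reflections F ↔ ∃ (u : F) (h0 : u ≠ 0), Algebra.norm ℚ u = 1 ∧ σ = refl u h0 := by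
  constructor
  · rintro ⟨hσ, hσ'⟩
    obtain ⟨u, h0, hu, rfl | rfl⟩ := q.eq_rot_or_refl hσ
    · exact absurd ⟨hσ, by rw [det_rot, hu]⟩ hσ'
    · exact ⟨u, h0, hu, rfl⟩
  · rintro ⟨u, h0, hu, rfl⟩
    refine ⟨q.refl_mem hu h0, fun h => ?_⟩
    have := h.2
    rw [q.det_refl, hu] at this
    norm_num at this

end Coordinates

end ImagQuad

end

section

/-! ### Integers of `F` -/

/-- The square of the denominator of r is prime to the square of its numerator, so it divides the
squarefree d; the denominator is therefore 1. -/
theorem Int.exists_of_squarefree_mul_sq {d : ℤ} (hd : Squarefree d) {r : ℚ} {m : ℤ}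
    (h : d * r ^ 2 = m) : ∃ n : ℤ, r = n := by
  have hq : (r.den : ℤ) * r.den ∣ d := by
    have h1 : d * r.num ^ 2 = m * (r.den : ℤ) ^ 2 := by
      have hr : (r.den : ℚ) ≠ 0 := by exact_mod_cast r.den_ne_zero
      have : (d : ℚ) * (r.num : ℚ) ^ 2 = m * (r.den : ℚ) ^ 2 := by
        rw [← h]; nth_rewrite 2 [← Rat.num_div_den r]; field_simp
      exact_mod_cast this
    have hc : IsCoprime ((r.den : ℤ) ^ 2) (r.num ^ 2) := by
      apply IsCoprime.pow
      rw [Int.isCoprime_iff_gcd_eq_one, Int.gcd_comm]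
      exact r.reduced
    rw [← pow_two]
    exact hc.dvd_of_dvd_mul_right (Dvd.intro_left m h1.symm)
  have hu := hd _ hq
  have : r.den = 1 := by
    rcases Int.isUnit_iff.1 hu with h | h <;> omega
  exact ⟨r.num, ((Rat.den_eq_one_iff r).1 this).symm⟩

namespace ImagQuad

variable {F : Type*} [Field F] (q : ImagQuad F)

theorem d_mod_four : q.d % 4 = 1 ∨ q.d % 4 = 2 ∨ q.d % 4 = 3 := by
  have h0 : ¬ q.d % 4 = 0 := by
    intro h
    have h2 : (2 : ℤ) * 2 ∣ q.d := by omega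
    have := q.sqf 2 h2
    rw [Int.isUnit_iff] at this; omega
  omega

/-- The generator of the ring of integers. -/
def ω : F := if q.d % 4 = 1 then (1 + q.δ) / 2 else q.δ

theorem isIntegral_δ : IsIntegral ℤ q.δ := by
  refine ⟨Polynomial.X ^ 2 - Polynomial.C q.d, Polynomial.monic_X_pow_sub_C _ two_ne_zero, ?_⟩
  simp only [Polynomial.eval₂_sub, Polynomial.eval₂_pow, Polynomial.eval₂_X, Polynomial.eval₂_C]
  simp [q.sq]

variable [NumberField F]

theorem isIntegral_ω : IsIntegral ℤ q.ω := by
  rw [ω]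
  split_ifs with h
  · have h4 : q.d = 1 + 4 * (q.d / 4) := by omega
    have hx : IsIntegral ℤ ((1 + q.δ) / 2) := by
      -- The integer quotient `q.d / 4` equals (d - 1)/4 here, so this is the minimal polynomial X²
      -- - X - (d - 1)/4.
      refine ⟨Polynomial.X ^ 2 - (Polynomial.X + Polynomial.C (q.d / 4)), ?_, ?_⟩
      · apply Polynomial.monic_X_pow_sub (n := 2)
        exact Polynomial.degree_X_add_C _ |>.trans_lt (by norm_num)
      · simp only [Polynomial.eval₂_sub, Polynomial.eval₂_pow, Polynomial.eval₂_X,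
          Polynomial.eval₂_add, Polynomial.eval₂_C]
        have h5 : (q.d : F) = 1 + 4 * ((q.d / 4 : ℤ) : F) := by exact_mod_cast congrArg (Int.cast (R := F)) h4
        simp only [algebraMap_int_eq, eq_intCast]
        linear_combination (1 / 4 : F) * q.sq + (1 / 4 : F) * h5
    exact hx
  · exact q.isIntegral_δ

variable [Algebra.IsQuadraticExtension ℚ F]

/-- Integrality of trace and norm makes 2a and then 2b integers m and n; the congruence m² ≡ dn²
(mod 4) decides which parities are possible. -/
theorem isIntegral_iff (z : F) : IsIntegral ℤ z ↔ ∃ i j : ℤ, z = i + j * q.ω := by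
  constructor
  · intro hz
    obtain ⟨a, b, rfl⟩ := q.exists_coords z
    obtain ⟨m, hm⟩ := IsIntegrallyClosed.isIntegral_iff.1 (Algebra.isIntegral_trace (L := ℚ) (F := F) hz)
    obtain ⟨k, hk⟩ := IsIntegrallyClosed.isIntegral_iff.1 (Algebra.isIntegral_norm ℚ hz)
    rw [q.trace_coords] at hm
    rw [q.norm_coords] at hk
    simp only [algebraMap_int_eq, eq_intCast] at hm hk
    obtain ⟨n, hn⟩ := Int.exists_of_squarefree_mul_sq q.sqf (r := 2 * b) (m := m ^ 2 - 4 * k)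
      (by push_cast; rw [hm, hk]; ring)
    have hmn : m ^ 2 - q.d * n ^ 2 = 4 * k := by
      have : (m : ℚ) ^ 2 - q.d * n ^ 2 = 4 * k := by rw [hm, hk, ← hn]; ring
      exact_mod_cast this
    have ha : a = m / 2 := by rw [hm]; ring
    have hb : b = n / 2 := by rw [← hn]; ring
    subst ha hb
    have hpar : m % 2 = 0 ∧ n % 2 = 0 ∨ (q.d % 4 = 1 ∧ m % 2 = 1 ∧ n % 2 = 1) := by
      have h4 : (m ^ 2 - q.d * n ^ 2) % 4 = 0 := by rw [hmn]; omega
      have hm4 : m % 4 = 0 ∨ m % 4 = 1 ∨ m % 4 = 2 ∨ m % 4 = 3 := by omega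
      have hn4 : n % 4 = 0 ∨ n % 4 = 1 ∨ n % 4 = 2 ∨ n % 4 = 3 := by omega
      rcases hm4 with h1 | h1 | h1 | h1 <;> rcases hn4 with h2 | h2 | h2 | h2 <;>
        rcases q.d_mod_four with h3 | h3 | h3 <;>
        simp [Int.sub_emod, Int.mul_emod, pow_two, h1, h2, h3] at h4 <;> omega
    rw [ω]
    split_ifs with h
    · refine ⟨(m - n) / 2, n, ?_⟩
      have : m = n + 2 * ((m - n) / 2) := by omega
      have : (m : F) = n + 2 * (((m - n) / 2 : ℤ) : F) := by exact_mod_cast congrArg (Int.cast (R := F)) this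
      push_cast
      linear_combination (1 / 2 : F) * this
    · refine ⟨m / 2, n / 2, ?_⟩
      have h1 : m = 2 * (m / 2) := by omega
      have h2 : n = 2 * (n / 2) := by omega
      have h1 : (m : F) = 2 * ((m / 2 : ℤ) : F) := by exact_mod_cast congrArg (Int.cast (R := F)) h1
      have h2 : (n : F) = 2 * ((n / 2 : ℤ) : F) := by exact_mod_cast congrArg (Int.cast (R := F)) h2
      push_cast
      linear_combination (1 / 2 : F) * h1 + (1 / 2 : F) * q.δ * h2
  · rintro ⟨i, j, rfl⟩
    have h (i : ℤ) : IsIntegral ℤ (i : F) := by simpa using isIntegral_algebraMap (R := ℤ) (A := F) (x := i)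
    exact (h i).add ((h j).mul q.isIntegral_ω)

theorem ω_coords : ∃ a b : ℚ, q.ω = a + b * q.δ ∧ b ≠ 0 := by
  rw [ω]
  split_ifs
  · exact ⟨1 / 2, 1 / 2, by push_cast; ring, by norm_num⟩
  · exact ⟨0, 1, by push_cast; ring, by norm_num⟩

theorem linearIndependent_ω : LinearIndependent ℚ ![(1 : F), q.ω] := by
  rw [LinearIndependent.pair_iff]
  intro s t h
  obtain ⟨a, b, hω, hb⟩ := q.ω_coords
  have := q.coords_eq_zero (a := s + t * a) (b := t * b) (by
    simp only [Algebra.smul_def, eq_ratCast] at h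
    push_cast; rw [hω] at h; linear_combination h)
  have ht : t = 0 := by simpa [hb] using this.2
  subst ht
  exact ⟨by simpa using this.1, rfl⟩

/-- The integral basis `1, ω` of `F`. -/
def basisω : Module.Basis (Fin 2) ℚ F :=
  basisOfLinearIndependentOfCardEqFinrank q.linearIndependent_ω
    (by simp [Algebra.IsQuadraticExtension.finrank_eq_two])

@[simp] theorem basisω_zero : q.basisω 0 = 1 := by simp [basisω]
@[simp] theorem basisω_one : q.basisω 1 = q.ω := by simp [basisω]

/-- Each of the two bases has integral coordinates in the other, so the discriminants agree. -/
theorem discr_eq_algebra_discr : (NumberField.discr F : ℚ) = Algebra.discr ℚ q.basisω := by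
  rw [NumberField.coe_discr]
  apply Algebra.discr_eq_discr_of_toMatrix_coeff_isIntegral
  · intro i j
    rw [Module.Basis.toMatrix_apply]
    have hint : IsIntegral ℤ (q.basisω j) := by
      fin_cases j
      · simpa using isIntegral_one
      · simpa using q.isIntegral_ω
    have h := NumberField.mem_span_integralBasis F (x := q.basisω j) |>.2 ⟨⟨_, hint⟩, rfl⟩
    rw [Module.Basis.mem_span_iff_repr_mem] at h
    obtain ⟨n, hn⟩ := h i
    rw [← hn]
    simpa using isIntegral_algebraMap (R := ℤ) (A := ℚ) (x := n)
  · intro i j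
    rw [Module.Basis.toMatrix_apply]
    have hint : IsIntegral ℤ (NumberField.integralBasis F j) := by
      rw [NumberField.integralBasis_apply]
      exact NumberField.RingOfIntegers.isIntegral_coe _
    obtain ⟨m, n, hmn⟩ := (q.isIntegral_iff _).1 hint
    have : NumberField.integralBasis F j = (m : ℚ) • q.basisω 0 + (n : ℚ) • q.basisω 1 := by
      rw [hmn]; simp [Algebra.smul_def]
    rw [this, map_add, map_smul, map_smul, q.basisω.repr_self, q.basisω.repr_self]
    have h (i : ℤ) : IsIntegral ℤ (i : ℚ) := by simpa using isIntegral_algebraMap (R := ℤ) (A := ℚ) (x := i)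
    fin_cases i
    · simpa using h m
    · simpa using h n

theorem discr_eq : NumberField.discr F = if q.d % 4 = 1 then q.d else 4 * q.d := by
  have key : ∀ a b : ℚ, q.ω = a + b * q.δ →
      Algebra.discr ℚ q.basisω = 4 * q.d * b ^ 2 := by
    intro a b h
    rw [Algebra.discr_def, Matrix.det_fin_two]
    simp only [Algebra.traceMatrix_apply, Algebra.traceForm_apply, basisω_zero, basisω_one,
      mul_one, one_mul]
    have h1 : Algebra.trace ℚ F (1 : F) = 2 := by simpa using q.trace_coords 1 0
    have h2 : Algebra.trace ℚ F q.ω = 2 * a := by rw [h, q.trace_coords]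
    have h3 : Algebra.trace ℚ F (q.ω * q.ω) = 2 * (a ^ 2 + q.d * b ^ 2) := by
      have : q.ω * q.ω = ((a ^ 2 + q.d * b ^ 2 : ℚ) : F) + ((2 * a * b : ℚ) : F) * q.δ := by
        rw [h]; push_cast; linear_combination (b : F) ^ 2 * q.sq
      rw [this, q.trace_coords]
    rw [h1, h2, h3]; ring
  have : (NumberField.discr F : ℚ) = ((if q.d % 4 = 1 then q.d else 4 * q.d : ℤ) : ℚ) := by
    rw [q.discr_eq_algebra_discr]
    split_ifs with h
    · rw [key (1 / 2) (1 / 2) (by rw [ω, if_pos h]; push_cast; ring)]; ring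
    · rw [key 0 1 (by rw [ω, if_neg h]; push_cast; ring)]; push_cast; ring
  exact_mod_cast this

theorem mem_ramifiedPrimes_iff (r : ℕ) : r ∈ ramifiedPrimes F ↔
    r.Prime ∧ (r ∣ q.d.natAbs ∨ (r = 2 ∧ q.d % 4 = 3)) := by
  have hd0 : q.d ≠ 0 := q.neg.ne
  rw [ramifiedPrimes, Nat.mem_primeFactors, q.discr_eq]
  refine ⟨fun ⟨hr, h, _⟩ => ⟨hr, ?_⟩, fun ⟨hr, h⟩ => ⟨hr, ?_, ?_⟩⟩
  · split_ifs at h with h1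
    · exact Or.inl h
    · rw [Int.natAbs_mul, hr.dvd_mul] at h
      rcases h with h | h
      · have : r ∣ 2 ^ 2 := by simpa using h
        have h2 := (Nat.prime_dvd_prime_iff_eq hr Nat.prime_two).1 (hr.dvd_of_dvd_pow this)
        subst h2
        rcases q.d_mod_four with h3 | h3 | h3
        · omega
        · left; omega
        · right; exact ⟨rfl, h3⟩
      · exact Or.inl h
  · split_ifs with h1
    · rcases h with h | h
      · exact h
      · omega
    · rw [Int.natAbs_mul]
      rcases h with h | ⟨rfl, _⟩
      · exact dvd_mul_of_dvd_right h _
      · exact dvd_mul_of_dvd_left (by norm_num) _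
  · split_ifs <;> simp [hd0]

/-- The units of the ring of integers are `±1`. -/
theorem eq_one_or_neg_one (q : ImagQuad F) {u : F} (hu : IsIntegral ℤ u) (hN : Algebra.norm ℚ u = 1) :
    u = 1 ∨ u = -1 := by
  obtain ⟨i, j, rfl⟩ := (q.isIntegral_iff u).1 hu
  have hneg := q.neg
  have h1 := q.ne_neg_one
  have h3 := q.ne_neg_three
  -- In half-integral coordinates a unit of norm 1 solves m² - dn² = 4, which has no solution with n
  -- ≠ 0 under the stated conditions.
  obtain ⟨m, n, hz, hmn⟩ : ∃ m n : ℤ, (i : F) + j * q.ω = ((m / 2 : ℚ) : F) + ((n / 2 : ℚ) : F) * q.δ ∧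
      (q.d % 4 = 1 ∨ n % 2 = 0) := by
    rw [ω]
    split_ifs with h
    · exact ⟨2 * i + j, j, by push_cast; ring, Or.inl h⟩
    · exact ⟨2 * i, 2 * j, by push_cast; ring, by right; omega⟩
  rw [hz] at hN ⊢
  rw [q.norm_coords] at hN
  have hN' : m ^ 2 - q.d * n ^ 2 = 4 := by
    have : (m : ℚ) ^ 2 - q.d * n ^ 2 = 4 := by linear_combination 4 * hN
    exact_mod_cast this
  have hd : q.d ≤ -2 := by omega
  have hn : n = 0 := by
    by_contra hn0
    rcases hmn with h | h
    -- The exclusion of d = -3 enters here: the next negative integer congruent to 1 modulo 4 is -7,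
    -- and 7n² > 4. In the other case n is even and d ≤ -2, so -dn² ≥ 8.
    · have : q.d ≤ -7 := by omega
      have : 0 < n ^ 2 := by positivity
      nlinarith [sq_nonneg m]
    · have : 4 ≤ n ^ 2 := by
        obtain ⟨k, rfl⟩ : (2 : ℤ) ∣ n := by omega
        have : k ≠ 0 := by rintro rfl; simp at hn0
        have : 0 < k ^ 2 := by positivity
        nlinarith
      nlinarith [sq_nonneg m]
  subst hn
  have : (m - 2) * (m + 2) = 0 := by linear_combination hN'
  rcases mul_eq_zero.1 this with h | h
  · left
    have : m = 2 := by omega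
    subst this; norm_num
  · right
    have : m = -2 := by omega
    subst this; norm_num

end ImagQuad

end

section

section Lattices

variable {F : Type*} [Field F] [NumberField F]

/-! ### Lattices spanned by two elements and ideals generated by two elements -/

/-- The subgroup `ℤ u + ℤ v`. -/
def lat (u v : F) : AddSubgroup F := AddSubgroup.closure {u, v}

theorem mem_lat {u v z : F} : z ∈ lat u v ↔ ∃ i j : ℤ, z = i * u + j * v := by
  rw [lat, AddSubgroup.mem_closure_pair]
  simp only [zsmul_eq_mul, eq_comm]

theorem lat_le_iff {u v : F} {K : AddSubgroup F} : lat u v ≤ K ↔ u ∈ K ∧ v ∈ K := by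
  rw [lat, AddSubgroup.closure_le, Set.pair_subset_iff]; rfl

theorem left_mem_lat (u v : F) : u ∈ lat u v := (lat_le_iff.1 le_rfl).1
theorem right_mem_lat (u v : F) : v ∈ lat u v := (lat_le_iff.1 le_rfl).2

/-- The index of a full sublattice is the absolute value of the determinant of the change of basis;
the nonzero determinant also makes the new pair independent. -/
theorem relIndex_lat {u v u' v' : F} (h : LinearIndependent ℚ ![u, v])
    (h2 : Module.finrank ℚ F = 2) {a b c e : ℤ}
    (hu : u' = a * u + b * v) (hv : v' = c * u + e * v) (hdet : a * e - b * c ≠ 0) :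
    (lat u' v').relIndex (lat u v) = (a * e - b * c).natAbs := by
  have hcard : Fintype.card (Fin 2) = Module.finrank ℚ F := by simp [h2]
  have h' : LinearIndependent ℚ ![u', v'] := by
    rw [LinearIndependent.pair_iff] at h ⊢
    intro s t hst
    obtain ⟨h3, h4⟩ := h (s * a + t * c) (s * b + t * e) (by
      rw [← hst, hu, hv]; simp only [Algebra.smul_def, map_add, map_mul, map_intCast]; ring)
    have hdet' : (a * e - b * c : ℚ) ≠ 0 := by exact_mod_cast hdet
    constructor
    · apply (mul_eq_zero.1 (?_ : s * (a * e - b * c : ℚ) = 0)).resolve_right hdet'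
      linear_combination e * h3 - c * h4
    · apply (mul_eq_zero.1 (?_ : t * (a * e - b * c : ℚ) = 0)).resolve_right hdet'
      linear_combination a * h4 - b * h3
  let b₂ := basisOfLinearIndependentOfCardEqFinrank h hcard
  let b₁ := basisOfLinearIndependentOfCardEqFinrank h' hcard
  have e₂ : ⇑b₂ = ![u, v] := by simp [b₂]
  have e₁ : ⇑b₁ = ![u', v'] := by simp [b₁]
  have hr (x y : F) : Set.range ![x, y] = {x, y} := by
    simp [Matrix.range_cons, Set.pair_comm]
  have := AddSubgroup.relIndex_eq_abs_det (lat u' v') (lat u v) (lat_le_iff.2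
    ⟨mem_lat.2 ⟨a, b, hu⟩, mem_lat.2 ⟨c, e, hv⟩⟩) b₁ b₂ (by rw [e₁, hr]; rfl) (by rw [e₂, hr]; rfl)
  have hu₂ : u = b₂ 0 := by simp [e₂]
  have hv₂ : v = b₂ 1 := by simp [e₂]
  have r0 : b₂.repr u' = (a : ℚ) • Finsupp.single 0 1 + (b : ℚ) • Finsupp.single 1 1 := by
    have : u' = (a : ℚ) • b₂ 0 + (b : ℚ) • b₂ 1 := by rw [hu, ← hu₂, ← hv₂]; simp [Algebra.smul_def]
    rw [this, map_add, map_smul, map_smul, b₂.repr_self, b₂.repr_self]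
  have r1 : b₂.repr v' = (c : ℚ) • Finsupp.single 0 1 + (e : ℚ) • Finsupp.single 1 1 := by
    have : v' = (c : ℚ) • b₂ 0 + (e : ℚ) • b₂ 1 := by rw [hv, ← hu₂, ← hv₂]; simp [Algebra.smul_def]
    rw [this, map_add, map_smul, map_smul, b₂.repr_self, b₂.repr_self]
  rw [Module.Basis.det_apply, Matrix.det_fin_two] at this
  simp only [Module.Basis.toMatrix_apply, e₁] at this
  simp [r0, r1] at this
  have h3 : (((a * e - b * c).natAbs : ℕ) : ℚ) = |(a * e - b * c : ℚ)| := by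
    rw [Nat.cast_natAbs]; push_cast; rfl
  have h4 : (((lat u' v').relIndex (lat u v) : ℕ) : ℚ) = ((a * e - b * c).natAbs : ℕ) := by
    rw [this, h3]; congr 1; ring
  exact_mod_cast h4

theorem mem_lattice {J : (FractionalIdeal (𝓞 F)⁰ F)ˣ} {z : F} :
    z ∈ lattice J ↔ z ∈ (J : FractionalIdeal (𝓞 F)⁰ F) := Iff.rfl

theorem lattice_le_iff {I J : (FractionalIdeal (𝓞 F)⁰ F)ˣ} :
    lattice J ≤ lattice I ↔ (J : FractionalIdeal (𝓞 F)⁰ F) ≤ I := Iff.rfl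

theorem lattice_injective : Function.Injective (lattice (F := F)) := by
  intro I J h
  exact Units.ext (le_antisymm (lattice_le_iff.1 h.le) (lattice_le_iff.1 h.ge))

theorem isIntegral_mul_mem {J : FractionalIdeal (𝓞 F)⁰ F} {r z : F} (hr : IsIntegral ℤ r)
    (hz : z ∈ J) : r * z ∈ J :=
  Submodule.smul_mem (J : Submodule (𝓞 F) F) (⟨r, hr⟩ : 𝓞 F) hz

theorem isIntegral_intCast (i : ℤ) : IsIntegral ℤ (i : F) := by
  simpa using isIntegral_algebraMap (R := ℤ) (A := F) (x := i)

theorem int_mul_mem {J : FractionalIdeal (𝓞 F)⁰ F} (i : ℤ) {z : F} (hz : z ∈ J) :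
    (i : F) * z ∈ J := isIntegral_mul_mem (isIntegral_intCast i) hz

theorem fi_add_mem {J : FractionalIdeal (𝓞 F)⁰ F} {y z : F} (hy : y ∈ J) (hz : z ∈ J) :
    y + z ∈ J := Submodule.add_mem (J : Submodule (𝓞 F) F) hy hz

/-- The fractional ideal generated by `u` and `v`. -/
def pair (u v : F) : FractionalIdeal (𝓞 F)⁰ F :=
  FractionalIdeal.spanSingleton _ u + FractionalIdeal.spanSingleton _ v

theorem pair_le_iff {u v : F} {J : FractionalIdeal (𝓞 F)⁰ F} :
    pair u v ≤ J ↔ u ∈ J ∧ v ∈ J := by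
  rw [pair, ← FractionalIdeal.sup_eq_add, sup_le_iff, FractionalIdeal.spanSingleton_le_iff_mem,
    FractionalIdeal.spanSingleton_le_iff_mem]

theorem left_mem_pair (u v : F) : u ∈ pair u v := (pair_le_iff.1 le_rfl).1
theorem right_mem_pair (u v : F) : v ∈ pair u v := (pair_le_iff.1 le_rfl).2

/-- The form in which nearly all memberships in ideals are verified: an explicit integral
combination of two known elements, checked by `ring` or `linear_combination`. -/
theorem int_comb_mem {J : FractionalIdeal (𝓞 F)⁰ F} {u v z : F} (hu : u ∈ J) (hv : v ∈ J)
    (i j : ℤ) (hz : z = i * u + j * v) : z ∈ J :=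
  hz ▸ fi_add_mem (int_mul_mem i hu) (int_mul_mem j hv)

theorem pair_ne_zero {u : F} (v : F) (hu : u ≠ 0) : pair u v ≠ 0 := by
  intro h
  have := left_mem_pair u v
  rw [h, FractionalIdeal.mem_zero_iff] at this
  exact hu this

theorem spanSingleton_mul_pair (c u v : F) :
    FractionalIdeal.spanSingleton _ c * pair u v = pair (c * u) (c * v) := by
  rw [pair, mul_add, FractionalIdeal.spanSingleton_mul_spanSingleton,
    FractionalIdeal.spanSingleton_mul_spanSingleton, pair]

theorem pair_mul_pair_le {u v u' v' : F} {J : FractionalIdeal (𝓞 F)⁰ F} :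
    pair u v * pair u' v' ≤ J ↔ u * u' ∈ J ∧ u * v' ∈ J ∧ v * u' ∈ J ∧ v * v' ∈ J := by
  have : pair u v * pair u' v' = pair (u * u') (u * v') + pair (v * u') (v * v') := by
    conv_lhs => rw [pair, add_mul]
    rw [spanSingleton_mul_pair, spanSingleton_mul_pair]
  rw [this, ← FractionalIdeal.sup_eq_add, sup_le_iff, pair_le_iff, pair_le_iff, and_assoc]

/-- The lattice `α K`. -/
def scale (α : Fˣ) (K : AddSubgroup F) : AddSubgroup F :=
  image (ImagQuad.mulEquiv (α : F) α.ne_zero) K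

theorem mem_scale {α : Fˣ} {K : AddSubgroup F} {z : F} :
    z ∈ scale α K ↔ ∃ k ∈ K, α * k = z := Iff.rfl

theorem mem_scale_iff {α : Fˣ} {K : AddSubgroup F} {z : F} :
    z ∈ scale α K ↔ (α : F)⁻¹ * z ∈ K := by
  rw [mem_scale]
  constructor
  · rintro ⟨k, hk, rfl⟩
    simpa using hk
  · intro h
    exact ⟨_, h, by simp⟩

theorem scale_scale (α β : Fˣ) (K : AddSubgroup F) : scale α (scale β K) = scale (α * β) K := by
  ext z; simp only [mem_scale_iff]; rw [Units.val_mul, mul_inv_rev, mul_assoc]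

theorem scale_le_iff {α : Fˣ} {K L : AddSubgroup F} : scale α K ≤ L ↔ ∀ k ∈ K, (α : F) * k ∈ L :=
  ⟨fun h k hk => h ⟨k, hk, rfl⟩, fun h _ ⟨k, hk, hz⟩ => hz ▸ h k hk⟩

theorem scale_lat (α : Fˣ) (u v : F) : scale α (lat u v) = lat (α * u) (α * v) := by
  ext z
  simp only [mem_scale, mem_lat]
  constructor
  · rintro ⟨_, ⟨i, j, rfl⟩, rfl⟩
    exact ⟨i, j, by ring⟩
  · rintro ⟨i, j, rfl⟩
    exact ⟨_, ⟨i, j, rfl⟩, by ring⟩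

theorem relIndex_scale (α : Fˣ) (K L : AddSubgroup F) :
    (scale α K).relIndex (scale α L) = K.relIndex L :=
  AddSubgroup.relIndex_map_map_of_injective _ _
    (ImagQuad.mulEquiv (α : F) α.ne_zero).injective

/-- The ideal `α J`. -/
def scaleIdeal (α : Fˣ) (J : (FractionalIdeal (𝓞 F)⁰ F)ˣ) : (FractionalIdeal (𝓞 F)⁰ F)ˣ :=
  toPrincipalIdeal (𝓞 F) F α * J

theorem val_scaleIdeal (α : Fˣ) (J : (FractionalIdeal (𝓞 F)⁰ F)ˣ) :
    (scaleIdeal α J : FractionalIdeal (𝓞 F)⁰ F) = FractionalIdeal.spanSingleton _ (α : F) * (J : FractionalIdeal (𝓞 F)⁰ F) := by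
  rw [scaleIdeal, Units.val_mul, coe_toPrincipalIdeal]

theorem lattice_scaleIdeal (α : Fˣ) (J : (FractionalIdeal (𝓞 F)⁰ F)ˣ) :
    lattice (scaleIdeal α J) = scale α (lattice J) := by
  ext z
  rw [mem_lattice, val_scaleIdeal, FractionalIdeal.mem_singleton_mul, mem_scale]
  simp only [mem_lattice, eq_comm]

theorem idealClass_eq_iff {I J : (FractionalIdeal (𝓞 F)⁰ F)ˣ} :
    idealClass I = idealClass J ↔ ∃ α : Fˣ, I = scaleIdeal α J := by
  have h1 : idealClass I = idealClass J ↔ ClassGroup.mk F (I * J⁻¹) = 1 := by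
    rw [map_mul, map_inv, mul_inv_eq_one]; rfl
  rw [h1, ClassGroup.mk_eq_one_iff]
  constructor
  · rintro ⟨x, hx⟩
    have hx' : ((I * J⁻¹ : (FractionalIdeal (𝓞 F)⁰ F)ˣ) : FractionalIdeal (𝓞 F)⁰ F) =
        FractionalIdeal.spanSingleton _ x := by
      apply Subtype.coe_injective
      simp only [FractionalIdeal.val_eq_coe, hx, FractionalIdeal.coe_spanSingleton]
    have hx0 : x ≠ 0 := by
      rintro rfl
      rw [FractionalIdeal.spanSingleton_zero] at hx'
      exact Units.ne_zero _ hx'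
    refine ⟨Units.mk0 x hx0, ?_⟩
    rw [scaleIdeal, ← mul_inv_eq_iff_eq_mul]
    ext1
    rw [hx', coe_toPrincipalIdeal]; rfl
  · rintro ⟨α, rfl⟩
    rw [scaleIdeal, mul_inv_cancel_right, coe_toPrincipalIdeal, FractionalIdeal.coe_spanSingleton]
    exact ⟨_, rfl⟩

theorem idealClass_scaleIdeal (α : Fˣ) (J : (FractionalIdeal (𝓞 F)⁰ F)ˣ) :
    idealClass (scaleIdeal α J) = idealClass J := idealClass_eq_iff.2 ⟨α, rfl⟩

/-- The index of one fractional ideal in another is the quotient of the norms. -/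
theorem relIndex_lattice {I J : (FractionalIdeal (𝓞 F)⁰ F)ˣ} (h : lattice J ≤ lattice I) :
    ((lattice J).relIndex (lattice I) : ℚ) * FractionalIdeal.absNorm (I : FractionalIdeal (𝓞 F)⁰ F) =
      FractionalIdeal.absNorm (J : FractionalIdeal (𝓞 F)⁰ F) := by
  have he (I : (FractionalIdeal (𝓞 F)⁰ F)ˣ) :
      Nonempty (Module.Free.ChooseBasisIndex ℤ (𝓞 F) ≃ Module.Free.ChooseBasisIndex ℤ I) := by
    rw [← Fintype.card_eq, ← Module.finrank_eq_card_chooseBasisIndex,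
      ← Module.finrank_eq_card_chooseBasisIndex]
    exact (NumberField.fractionalIdeal_rank F I).symm
  obtain ⟨eI⟩ := he I
  obtain ⟨eJ⟩ := he J
  let bI := (NumberField.basisOfFractionalIdeal F I).reindex eI.symm
  let bJ := (NumberField.basisOfFractionalIdeal F J).reindex eJ.symm
  have hl (I : (FractionalIdeal (𝓞 F)⁰ F)ˣ) (e : Module.Free.ChooseBasisIndex ℤ (𝓞 F) ≃
      Module.Free.ChooseBasisIndex ℤ I) : lattice I = AddSubgroup.closure
        (Set.range ((NumberField.basisOfFractionalIdeal F I).reindex e.symm)) := by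
    apply AddSubgroup.toIntSubmodule.injective
    rw [AddSubgroup.toIntSubmodule_closure]
    ext z
    rw [Module.Basis.range_reindex, NumberField.mem_span_basisOfFractionalIdeal]
    rfl
  rw [AddSubgroup.relIndex_eq_abs_det _ _ h bJ bI (hl J eJ) (hl I eI),
    ← NumberField.det_basisOfFractionalIdeal_eq_absNorm F I eI,
    ← NumberField.det_basisOfFractionalIdeal_eq_absNorm F J eJ, ← abs_mul]
  congr 1
  rw [Module.Basis.det_apply, Module.Basis.det_apply, Module.Basis.det_apply, mul_comm,
    ← Matrix.det_mul, Module.Basis.toMatrix_mul_toMatrix]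

theorem absNorm_pos (J : (FractionalIdeal (𝓞 F)⁰ F)ˣ) :
    0 < FractionalIdeal.absNorm (J : FractionalIdeal (𝓞 F)⁰ F) :=
  lt_of_le_of_ne (FractionalIdeal.absNorm_nonneg _)
    (Ne.symm fun h => J.ne_zero (FractionalIdeal.absNorm_eq_zero_iff.1 h))

theorem relIndex_lattice_ne_zero {I J : (FractionalIdeal (𝓞 F)⁰ F)ˣ} (h : lattice J ≤ lattice I) :
    (lattice J).relIndex (lattice I) ≠ 0 := by
  intro h0
  have := relIndex_lattice h
  rw [h0, Nat.cast_zero, zero_mul] at this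
  exact (absNorm_pos J).ne this

end Lattices

namespace ImagQuad

variable {F : Type*} [Field F] [NumberField F] (q : ImagQuad F) [Algebra.IsQuadraticExtension ℚ F]

theorem absNorm_scaleIdeal (q : ImagQuad F) (α : Fˣ) (J : (FractionalIdeal (𝓞 F)⁰ F)ˣ) :
    FractionalIdeal.absNorm (scaleIdeal α J : FractionalIdeal (𝓞 F)⁰ F) =
      Algebra.norm ℚ (α : F) * FractionalIdeal.absNorm (J : FractionalIdeal (𝓞 F)⁰ F) := by
  rw [val_scaleIdeal, map_mul, FractionalIdeal.absNorm_span_singleton, abs_of_nonneg (q.norm_nonneg _)]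

/-- The index is N(α) times a factor depending only on I and J. This is what lets the grouping of
multipliers by norm become a grouping by index. -/
theorem relIndex_scaleIdeal_eq_iff (q : ImagQuad F) {α β : Fˣ} {I J : (FractionalIdeal (𝓞 F)⁰ F)ˣ}
    (hα : lattice (scaleIdeal α J) ≤ lattice I) (hβ : lattice (scaleIdeal β J) ≤ lattice I) :
    (lattice (scaleIdeal α J)).relIndex (lattice I) = (lattice (scaleIdeal β J)).relIndex (lattice I) ↔
      Algebra.norm ℚ (α : F) = Algebra.norm ℚ (β : F) := by
  have h1 := relIndex_lattice hα
  have h2 := relIndex_lattice hβ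
  rw [q.absNorm_scaleIdeal] at h1 h2
  have hI := (absNorm_pos I).ne'
  have hJ := (absNorm_pos J).ne'
  constructor
  · intro h
    rw [h, h2] at h1
    exact (mul_right_cancel₀ hJ h1).symm
  · intro h
    rw [h, ← h2] at h1
    exact_mod_cast mul_right_cancel₀ hI h1

/-- A lattice stable under multiplication by ω is stable under the whole ring of integers ℤ + ℤω,
hence is already the ideal generated by its basis. -/
theorem mem_pair_iff_mem_lat {u v : F} (hu : q.ω * u ∈ lat u v) (hv : q.ω * v ∈ lat u v) {z : F} :
    z ∈ pair u v ↔ z ∈ lat u v := by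
  constructor
  · have key : ∀ z ∈ lat u v, q.ω * z ∈ lat u v := by
      intro z hz
      obtain ⟨i, j, rfl⟩ := mem_lat.1 hz
      have := (lat u v).add_mem ((lat u v).zsmul_mem hu i) ((lat u v).zsmul_mem hv j)
      simp only [zsmul_eq_mul] at this
      convert this using 1; ring
    have key2 : ∀ r : F, IsIntegral ℤ r → ∀ z ∈ lat u v, r * z ∈ lat u v := by
      intro r hr z hz
      obtain ⟨i, j, rfl⟩ := (q.isIntegral_iff r).1 hr
      have := (lat u v).add_mem ((lat u v).zsmul_mem hz i) ((lat u v).zsmul_mem (key z hz) j)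
      simp only [zsmul_eq_mul] at this
      convert this using 1; ring
    intro hz
    rw [pair, ← FractionalIdeal.mem_coe, FractionalIdeal.coe_add, Submodule.add_eq_sup,
      Submodule.mem_sup] at hz
    obtain ⟨y, hy, w, hw, rfl⟩ := hz
    obtain ⟨r, rfl⟩ := (FractionalIdeal.mem_spanSingleton _).1 hy
    obtain ⟨r', rfl⟩ := (FractionalIdeal.mem_spanSingleton _).1 hw
    exact (lat u v).add_mem (key2 _ r.isIntegral_coe _ (left_mem_lat u v))
      (key2 _ r'.isIntegral_coe _ (right_mem_lat u v))
  · intro hz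
    obtain ⟨i, j, h⟩ := mem_lat.1 hz
    exact int_comb_mem (left_mem_pair u v) (right_mem_pair u v) i j h

end ImagQuad

end

section

/-! ### Lattices stable under conjugation -/

/-- Pairs of coprime positive integers. -/
abbrev CoprimePair : Type := {p : ℕ × ℕ // 0 < p.1 ∧ 0 < p.2 ∧ p.1.Coprime p.2}

/-- The shapes of conjugation-stable lattices: `(x, y, false)` stands for the rectangular lattice
`ℤ x + ℤ y δ`, and `(x, y, true)` for the rhombic lattice `ℤ x + ℤ (x + y δ) / 2`. -/
abbrev Shape : Type := CoprimePair × Bool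

/-- A subgroup `H` meets the line `ℚ v` in a cyclic group if denominators are bounded. -/
theorem exists_generator_on_line {F : Type*} [Field F] [NumberField F] {H : AddSubgroup F} {v : F}
    {c m : ℤ} (hc : c ≠ 0) (hm : m ≠ 0) (hb : ∀ r : ℚ, (r : F) * v ∈ H → ∃ i : ℤ, c * r = i)
    (hmem : (m : F) * v ∈ H) :
    ∃ g : ℚ, 0 < g ∧ ∀ r : ℚ, (r : F) * v ∈ H ↔ ∃ i : ℤ, r = i * g := by
  -- The map i ↦ (i/c)v reaches every point of H on the line, so H is described there by a subgroup
  -- of ℤ, which is cyclic.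
  let f : ℤ →+ F := (AddMonoidHom.mulRight ((c : F)⁻¹ * v)).comp (Int.castAddHom F)
  have hf (i : ℤ) : f i = (((i / c : ℚ)) : F) * v := by
    simp [f]; ring
  have hcF : (c : F) ≠ 0 := by exact_mod_cast hc
  have hcQ : (c : ℚ) ≠ 0 := by exact_mod_cast hc
  obtain ⟨a, ha⟩ := Int.subgroup_cyclic (H.comap f)
  have hia (i : ℤ) : ((i / c : ℚ) : F) * v ∈ H ↔ ∃ k : ℤ, i = k * a := by
    rw [← hf, ← AddSubgroup.mem_comap, ha, AddSubgroup.mem_closure_singleton]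
    simp [eq_comm]
  have ha0 : a ≠ 0 := by
    rintro rfl
    have h1 : (((m * c : ℤ) / c : ℚ) : F) * v ∈ H := by
      convert hmem using 2
      push_cast; field_simp
    obtain ⟨k, hk⟩ := (hia _).1 h1
    simp [hm, hc] at hk
  have hiff (r : ℚ) : (r : F) * v ∈ H ↔ ∃ i : ℤ, r = i * (a / c : ℚ) := by
    constructor
    · intro h
      obtain ⟨i, hi⟩ := hb r h
      have hr : r = i / c := by rw [← hi]; field_simp
      rw [hr] at h
      obtain ⟨k, hk⟩ := (hia i).1 h
      exact ⟨k, by rw [hr, hk]; push_cast; ring⟩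
    · rintro ⟨i, rfl⟩
      have := (hia (i * a)).2 ⟨i, rfl⟩
      convert this using 2
      push_cast; ring
  refine ⟨|(a / c : ℚ)|, by positivity, fun r => ?_⟩
  rw [hiff]
  rcases abs_choice (a / c : ℚ) with h | h <;> rw [h]
  constructor
  · rintro ⟨i, hi⟩; exact ⟨-i, by rw [hi]; push_cast; ring⟩
  · rintro ⟨i, hi⟩; exact ⟨-i, by rw [hi]; push_cast; ring⟩

namespace ImagQuad

variable {F : Type*} [Field F] [NumberField F] (q : ImagQuad F)

/-- The second generator of the lattice of shape `w`. -/
def gen (w : Shape) : F :=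
  if w.2 then ((w.1.1.1 : F) + w.1.1.2 * q.δ) / 2 else w.1.1.2 * q.δ

/-- The lattice of shape `w`. -/
def shapeLat (w : Shape) : AddSubgroup F := lat (w.1.1.1 : F) (q.gen w)

variable [Algebra.IsQuadraticExtension ℚ F]

theorem gen_eq (w : Shape) : q.gen w = ((if w.2 then (w.1.1.1 : ℚ) / 2 else 0 : ℚ) : F) +
    ((if w.2 then (w.1.1.2 : ℚ) / 2 else w.1.1.2 : ℚ) : F) * q.δ := by
  rw [gen]; split_ifs <;> push_cast <;> ring

theorem coords_mem_shapeLat_iff (w : Shape) (a b : ℚ) : (a : F) + b * q.δ ∈ q.shapeLat w ↔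
    ∃ i j : ℤ, a = i * w.1.1.1 + j * (if w.2 then (w.1.1.1 : ℚ) / 2 else 0) ∧
      b = j * (if w.2 then (w.1.1.2 : ℚ) / 2 else w.1.1.2) := by
  rw [shapeLat, mem_lat]
  refine exists₂_congr fun i j => ?_
  rw [q.gen_eq]
  constructor
  · intro h
    apply q.coords_inj
    rw [h]; push_cast; ring
  · rintro ⟨rfl, rfl⟩
    push_cast; ring

theorem rat_mem_shapeLat_iff (w : Shape) (a : ℚ) :
    (a : F) ∈ q.shapeLat w ↔ ∃ i : ℤ, a = i * w.1.1.1 := by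
  have h := q.coords_mem_shapeLat_iff w a 0
  have hy : (w.1.1.2 : ℚ) ≠ 0 := by exact_mod_cast w.1.2.2.1.ne'
  simp only [Rat.cast_zero, zero_mul, add_zero] at h
  rw [h]
  constructor
  · rintro ⟨i, j, h1, h2⟩
    have hj : j = 0 := by split_ifs at h2 <;> simpa [hy] using h2.symm
    subst hj
    exact ⟨i, by simpa using h1⟩
  · rintro ⟨i, rfl⟩
    exact ⟨i, 0, by simp, by simp⟩

/-- In the rhombic case the vanishing rational part forces an even coefficient of the half
generator, so x and y are read off from the two axes for both kinds of shape. -/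
theorem rat_mul_δ_mem_shapeLat_iff (w : Shape) (b : ℚ) :
    (b : F) * q.δ ∈ q.shapeLat w ↔ ∃ i : ℤ, b = i * w.1.1.2 := by
  have h := q.coords_mem_shapeLat_iff w 0 b
  have hx : (w.1.1.1 : ℚ) ≠ 0 := by exact_mod_cast w.1.2.1.ne'
  simp only [Rat.cast_zero, zero_add] at h
  rw [h]
  constructor
  · rintro ⟨i, j, h1, h2⟩
    split_ifs at h1 h2
    · have : j = -(2 * i) := by
        have : (j : ℚ) = -(2 * i) := by
          apply mul_right_cancel₀ hx; linear_combination -2 * h1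
        exact_mod_cast this
      exact ⟨-i, by rw [h2, this]; push_cast; ring⟩
    · exact ⟨j, h2⟩
  · rintro ⟨i, rfl⟩
    split_ifs
    · exact ⟨-i, 2 * i, by push_cast; ring, by push_cast; ring⟩
    · exact ⟨0, i, by simp, by simp⟩

/-- The intersections with the axes do not see the kind of the shape; this point does. -/
theorem half_mem_shapeLat_iff (w : Shape) :
    ((w.1.1.1 : F) + w.1.1.2 * q.δ) / 2 ∈ q.shapeLat w ↔ w.2 = true := by
  constructor
  · intro h
    by_contra hw
    have h' := q.coords_mem_shapeLat_iff w (w.1.1.1 / 2) (w.1.1.2 / 2)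
    rw [show (((w.1.1.1 / 2 : ℚ) : F) + ((w.1.1.2 / 2 : ℚ) : F) * q.δ) =
      ((w.1.1.1 : F) + w.1.1.2 * q.δ) / 2 by push_cast; ring] at h'
    obtain ⟨i, j, h1, _⟩ := h'.1 h
    have hx : (w.1.1.1 : ℚ) ≠ 0 := by exact_mod_cast w.1.2.1.ne'
    rw [if_neg hw, mul_zero, add_zero] at h1
    have : 2 * i = 1 := by
      have : (2 * i : ℚ) = 1 := by apply mul_right_cancel₀ hx; linear_combination -2 * h1
      exact_mod_cast this
    omega
  · intro hw
    have : q.gen w = ((w.1.1.1 : F) + w.1.1.2 * q.δ) / 2 := by rw [gen, if_pos hw]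
    rw [← this]
    exact right_mem_lat _ _

theorem conj_mem_shapeLat (w : Shape) {z : F} (hz : z ∈ q.shapeLat w) :
    conj F z ∈ q.shapeLat w := by
  obtain ⟨a, b, rfl⟩ := q.exists_coords z
  obtain ⟨i, j, ha, hb⟩ := (q.coords_mem_shapeLat_iff w a b).1 hz
  have := q.coords_mem_shapeLat_iff w a (-b)
  rw [q.conj_coords, show (a : F) - b * q.δ = a + ((-b : ℚ) : F) * q.δ by push_cast; ring, this]
  by_cases hw : w.2
  · refine ⟨i + j, -j, ?_, ?_⟩ <;> simp only [hw, if_true] at ha hb ⊢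
    · rw [ha]; push_cast; ring
    · rw [hb]; push_cast; ring
  · refine ⟨i, -j, ?_, ?_⟩ <;> simp only [hw] at ha hb ⊢
    · rw [ha]; simp
    · rw [hb]; push_cast; ring

/-- A nonzero rational number as a unit of `F`. -/
def ratUnit (F : Type*) [Field F] [NumberField F] (e : ℚ) (he : e ≠ 0) : Fˣ :=
  Units.mk0 (e : F) (by exact_mod_cast he)

@[simp] theorem val_ratUnit (e : ℚ) (he : e ≠ 0) : (ratUnit F e he : F) = e := rfl

theorem exists_ratUnit (q : ImagQuad F) {u : Fˣ} (h : conj F u = u) :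
    ∃ (e : ℚ) (he : e ≠ 0), u = ratUnit F e he := by
  obtain ⟨a, b, hab⟩ := q.exists_coords u
  rw [hab, q.conj_coords] at h
  have hb : b = 0 := by
    have := (q.coords_inj (a := a) (b := -b) (a' := a) (b' := b) (by push_cast; linear_combination h)).2
    linarith
  subst hb
  have ha : a ≠ 0 := by
    rintro rfl
    exact u.ne_zero (by simp [hab])
  exact ⟨a, ha, Units.ext (by simp [hab])⟩

/-- The multiples of shape lattices are distinct. -/
theorem shapeLat_eq_scale {e : ℚ} (he : e ≠ 0) {w w' : Shape}
    (h : q.shapeLat w' = scale (ratUnit F e he) (q.shapeLat w)) : (e = 1 ∨ e = -1) ∧ w = w' := by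
  have hrat (a : ℚ) : (∃ i : ℤ, e * a = i * w'.1.1.1) ↔ ∃ i : ℤ, a = i * w.1.1.1 := by
    rw [← q.rat_mem_shapeLat_iff, ← q.rat_mem_shapeLat_iff, h, mem_scale_iff]
    push_cast
    rw [val_ratUnit, inv_mul_cancel_left₀ (by exact_mod_cast he)]
  have hδ (a : ℚ) : (∃ i : ℤ, e * a = i * w'.1.1.2) ↔ ∃ i : ℤ, a = i * w.1.1.2 := by
    rw [← q.rat_mul_δ_mem_shapeLat_iff, ← q.rat_mul_δ_mem_shapeLat_iff, h, mem_scale_iff]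
    push_cast
    rw [val_ratUnit, mul_assoc, inv_mul_cancel_left₀ (by exact_mod_cast he)]
  -- The numbers e·x and x' generate the same cyclic subgroup of ℚ, so they agree up to sign.
  have aux (x x' : ℕ) (hx : 0 < x) (hx' : 0 < x')
      (H : ∀ a : ℚ, (∃ i : ℤ, e * a = i * x') ↔ ∃ i : ℤ, a = i * x) : |e| * x = x' := by
    obtain ⟨i, hi⟩ := (H x).2 ⟨1, by simp⟩
    obtain ⟨j, hj⟩ := (H (x' / e)).1 ⟨1, by field_simp; simp⟩
    have hxQ : (0 : ℚ) < x := by exact_mod_cast hx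
    have hxQ' : (0 : ℚ) < x' := by exact_mod_cast hx'
    have hij : i * j = 1 := by
      have : (i * j : ℚ) = 1 := by
        apply mul_right_cancel₀ hxQ'.ne'
        calc (i * j : ℚ) * x' = j * (i * x') := by ring
          _ = e * (j * x) := by rw [← hi]; ring
          _ = 1 * x' := by rw [← hj]; field_simp
      exact_mod_cast this
    have hi1 : |i| = 1 := Int.isUnit_iff_abs_eq.1 (IsUnit.of_mul_eq_one _ hij)
    have := congrArg abs hi
    rw [abs_mul, abs_mul, abs_of_pos hxQ, abs_of_pos hxQ', ← Int.cast_abs, hi1] at this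
    simpa using this
  have h1 := aux _ _ w.1.2.1 w'.1.2.1 hrat
  have h2 := aux _ _ w.1.2.2.1 w'.1.2.2.1 hδ
  have hcross : w.1.1.1 * w'.1.1.2 = w'.1.1.1 * w.1.1.2 := by
    have : (w.1.1.1 * w'.1.1.2 : ℚ) = w'.1.1.1 * w.1.1.2 := by rw [← h1, ← h2]; ring
    exact_mod_cast this
  -- Both pairs are coprime and have the same ratio, so they are the same fraction in lowest terms.
  have hx : w.1.1.1 = w'.1.1.1 := Nat.dvd_antisymm
    (w.1.2.2.2.dvd_of_dvd_mul_right (Dvd.intro _ hcross))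
    (w'.1.2.2.2.dvd_of_dvd_mul_right (Dvd.intro _ hcross.symm))
  have hy : w.1.1.2 = w'.1.1.2 := by
    rw [← hx] at hcross
    exact (Nat.eq_of_mul_eq_mul_left w.1.2.1 hcross).symm
  have he1 : e = 1 ∨ e = -1 := by
    have hxQ : (w.1.1.1 : ℚ) ≠ 0 := by exact_mod_cast w.1.2.1.ne'
    rw [← hx] at h1
    have : |e| = 1 := mul_right_cancel₀ hxQ (by rw [h1, one_mul])
    exact eq_or_eq_neg_of_abs_eq this
  refine ⟨he1, ?_⟩
  have hL : q.shapeLat w' = q.shapeLat w := by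
    rw [h]; ext z; rw [mem_scale_iff, val_ratUnit]
    rcases he1 with rfl | rfl <;> simp
  have ht : w'.2 = true ↔ w.2 = true := by
    rw [← q.half_mem_shapeLat_iff, ← q.half_mem_shapeLat_iff, hL, hx, hy]
  refine Prod.ext (Subtype.ext (Prod.ext hx hy)) ?_
  rw [Bool.eq_iff_iff]; exact ht.symm

/-- A conjugation-stable lattice is a multiple of a shape lattice. -/
theorem exists_shape {K : AddSubgroup F} (hK : ∀ z ∈ K, conj F z ∈ K)
    {c m : ℤ} (hc : c ≠ 0) (hm : m ≠ 0)
    (hb : ∀ a b : ℚ, (a : F) + b * q.δ ∈ K → (∃ i : ℤ, c * a = i) ∧ ∃ i : ℤ, c * b = i)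
    (hm1 : (m : F) ∈ K) (hm2 : (m : F) * q.δ ∈ K) :
    ∃ (e : ℚ) (he : e ≠ 0) (w : Shape), K = scale (ratUnit F e he) (q.shapeLat w) := by
  obtain ⟨x₀, hx₀, hx⟩ := exists_generator_on_line (H := K) (v := 1) hc hm
    (fun r hr => (hb r 0 (by simpa using hr)).1) (by simpa using hm1)
  obtain ⟨y₀, hy₀, hy⟩ := exists_generator_on_line (H := K) (v := q.δ) hc hm
    (fun r hr => (hb 0 r (by simpa using hr)).2) hm2
  simp only [mul_one] at hx
  have hx₀K : (x₀ : F) ∈ K := (hx x₀).2 ⟨1, by simp⟩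
  have hy₀K : (y₀ : F) * q.δ ∈ K := (hy y₀).2 ⟨1, by simp⟩
  -- The sum z + z̄ lies on the rational axis and z - z̄ on the axis of δ, so twice z is an integral
  -- combination of the two axis generators.
  have hhalf (z : F) (hz : z ∈ K) : ∃ i j : ℤ, z = (i * x₀ + j * (y₀ * q.δ)) / 2 := by
    obtain ⟨a, b, rfl⟩ := q.exists_coords z
    have h1 := hK _ hz
    rw [q.conj_coords] at h1
    have h2 := K.add_mem hz h1
    have h3 := K.sub_mem hz h1
    rw [show (a : F) + b * q.δ + (a - b * q.δ) = ((2 * a : ℚ) : F) by push_cast; ring, hx] at h2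
    rw [show (a : F) + b * q.δ - (a - b * q.δ) = ((2 * b : ℚ) : F) * q.δ by push_cast; ring, hy] at h3
    obtain ⟨i, hi⟩ := h2
    obtain ⟨j, hj⟩ := h3
    refine ⟨i, j, ?_⟩
    have hi' : (2 * a : F) = i * x₀ := by exact_mod_cast congrArg (Rat.cast (K := F)) hi
    have hj' : (2 * b : F) = j * y₀ := by exact_mod_cast congrArg (Rat.cast (K := F)) hj
    linear_combination (1 / 2 : F) * hi' + (1 / 2 : F) * q.δ * hj'
  have hzm (n : ℤ) {z : F} (hz : z ∈ K) : (n : F) * z ∈ K := by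
    simpa using K.zsmul_mem hz n
  have hx_half : ¬ ((x₀ : F) / 2 ∈ K) := by
    intro h
    rw [show (x₀ : F) / 2 = ((x₀ / 2 : ℚ) : F) by push_cast; ring, hx] at h
    obtain ⟨i, hi⟩ := h
    have : 2 * i = 1 := by
      have : (2 * i : ℚ) = 1 := by apply mul_right_cancel₀ hx₀.ne'; linear_combination -2 * hi
      exact_mod_cast this
    omega
  have hy_half : ¬ ((y₀ : F) * q.δ / 2 ∈ K) := by
    intro h
    rw [show (y₀ : F) * q.δ / 2 = ((y₀ / 2 : ℚ) : F) * q.δ by push_cast; ring, hy] at h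
    obtain ⟨i, hi⟩ := h
    have : 2 * i = 1 := by
      have : (2 * i : ℚ) = 1 := by apply mul_right_cancel₀ hy₀.ne'; linear_combination -2 * hi
      exact_mod_cast this
    omega
  -- The ratio in lowest terms supplies the coprime pair, and e is the common scale factor.
  let r : ℚ := x₀ / y₀
  have hr : 0 < r := by positivity
  have hnum : (r.num.natAbs : ℤ) = r.num := Int.natAbs_of_nonneg (Rat.num_nonneg.2 hr.le)
  have hnumQ : (r.num.natAbs : ℚ) = r.num := by
    rw [← Int.cast_natCast, hnum]
  let p : CoprimePair := ⟨(r.num.natAbs, r.den),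
    Int.natAbs_pos.2 (Rat.num_pos.2 hr).ne', r.den_pos, r.reduced⟩
  let e : ℚ := y₀ / r.den
  have hden : (r.den : ℚ) ≠ 0 := by exact_mod_cast r.den_ne_zero
  have he : e ≠ 0 := div_ne_zero hy₀.ne' hden
  have hey : e * p.1.2 = y₀ := by simp only [e, p]; field_simp
  have hex : e * p.1.1 = x₀ := by
    have h1 : r * y₀ = x₀ := by simp only [r]; field_simp
    simp only [e, p, hnumQ]
    rw [← h1]; nth_rewrite 3 [← Rat.num_div_den r]; ring
  have heyF : (e : F) * p.1.2 = y₀ := by exact_mod_cast congrArg (Rat.cast (K := F)) hey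
  have hexF : (e : F) * p.1.1 = x₀ := by exact_mod_cast congrArg (Rat.cast (K := F)) hex
  by_cases htype : ((x₀ : F) + y₀ * q.δ) / 2 ∈ K
  · refine ⟨e, he, (p, true), ?_⟩
    rw [shapeLat, scale_lat, gen, if_pos rfl, val_ratUnit, hexF,
      show (e : F) * (((p.1.1 : F) + p.1.2 * q.δ) / 2) = (x₀ + y₀ * q.δ) / 2 by
        rw [← hexF, ← heyF]; ring]
    refine le_antisymm (fun z hz => ?_) (lat_le_iff.2 ⟨hx₀K, htype⟩)
    obtain ⟨i, j, rfl⟩ := hhalf z hz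
    rcases Int.even_or_odd' (i - j) with ⟨k, hk | hk⟩
    · rw [mem_lat]
      have hkF : (i : F) = j + 2 * k := by exact_mod_cast (sub_eq_iff_eq_add'.1 hk)
      exact ⟨k, j, by rw [hkF]; ring⟩
    -- If the half coordinates have different parity, subtracting multiples of the rhombic generator
    -- and of x₀ leaves x₀/2, contrary to the choice of x₀ as generator.
    · exfalso
      apply hx_half
      have hkF : (i : F) = j + (2 * k + 1) := by exact_mod_cast (sub_eq_iff_eq_add'.1 hk)
      have := K.sub_mem (K.sub_mem hz (hzm j htype)) (hzm k hx₀K)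
      convert this using 1
      rw [hkF]; ring
  · refine ⟨e, he, (p, false), ?_⟩
    rw [shapeLat, scale_lat, gen, if_neg (by simp), val_ratUnit, hexF,
      show (e : F) * ((p.1.2 : F) * q.δ) = y₀ * q.δ by rw [← heyF]; ring]
    refine le_antisymm (fun z hz => ?_) (lat_le_iff.2 ⟨hx₀K, hy₀K⟩)
    obtain ⟨i, j, rfl⟩ := hhalf z hz
    obtain ⟨k, hk⟩ := Int.even_or_odd' i
    obtain ⟨l, hl⟩ := Int.even_or_odd' j
    have hred := K.sub_mem (K.sub_mem hz (hzm k hx₀K)) (hzm l hy₀K)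
    rcases hk with rfl | rfl <;> rcases hl with rfl | rfl
    · exact mem_lat.2 ⟨k, l, by push_cast; ring⟩
    · exact absurd (by convert hred using 1; push_cast; ring) hy_half
    · exact absurd (by convert hred using 1; push_cast; ring) hx_half
    · exact absurd (by convert hred using 1; push_cast; ring) htype

/-! ### Reflections -/

/-- The reflection that fixes the line `ℚ α`. -/
def reflOf (α : Fˣ) : F ≃ₗ[ℚ] F :=
  refl ((α : F) / conj F α) (div_ne_zero α.ne_zero (by simp))

theorem reflOf_apply (α : Fˣ) (z : F) : reflOf α z = α / conj F α * conj F z := rfl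

theorem reflOf_mul (α : Fˣ) (z : F) : reflOf α (α * z) = α * conj F z := by
  have h : conj F (α : F) ≠ 0 := by simp
  rw [reflOf_apply, map_mul]; field_simp

theorem reflOf_mem (q : ImagQuad F) (α : Fˣ) : reflOf α ∈ reflections F :=
  q.mem_reflections_iff.2 ⟨_, _, by
    have h0 := Algebra.norm_ne_zero_iff (R := ℚ).2 α.ne_zero
    have h1 : conj F (α : F) ≠ 0 := by simp
    have h2 : Algebra.norm ℚ ((α : F) / conj F α) * Algebra.norm ℚ (conj F (α : F)) =
        Algebra.norm ℚ (α : F) := by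
      rw [← map_mul, div_mul_cancel₀ _ h1]
    rw [q.norm_conj] at h2
    exact mul_right_cancel₀ h0 (h2.trans (one_mul _).symm), rfl⟩

/-- This is Hilbert 90 for u of norm 1: the element 1 + u satisfies u·conj(1 + u) = 1 + u, and when
it vanishes, δ serves instead. -/
theorem exists_reflOf (q : ImagQuad F) {ρ : F ≃ₗ[ℚ] F} (hρ : ρ ∈ reflections F) :
    ∃ α : Fˣ, ρ = reflOf α := by
  obtain ⟨u, h0, hu, rfl⟩ := q.mem_reflections_iff.1 hρ
  have hn := norm_eq u
  rw [hu, Rat.cast_one] at hn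
  suffices ∃ α : F, α ≠ 0 ∧ u * conj F α = α by
    obtain ⟨α, hα, h⟩ := this
    refine ⟨Units.mk0 α hα, LinearEquiv.ext fun z => ?_⟩
    have h1 : conj F α ≠ 0 := by simpa using hα
    rw [reflOf_apply, refl_apply, Units.val_mk0, eq_div_of_mul_eq h1 h]
  by_cases h1 : u = -1
  · exact ⟨q.δ, q.δ_ne_zero, by rw [h1, q.conj_δ]; ring⟩
  · refine ⟨1 + u, fun h => h1 (by linear_combination h), ?_⟩
    rw [map_add, map_one]; linear_combination -hn

/-- Equality of α/ᾱ and β/β̄ says that β/α is fixed by conjugation, that is, rational. -/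
theorem reflOf_eq_iff (q : ImagQuad F) {α β : Fˣ} : reflOf α = reflOf β ↔
    ∃ (e : ℚ) (he : e ≠ 0), β = ratUnit F e he * α := by
  have hα : conj F (α : F) ≠ 0 := by simp
  have hβ : conj F (β : F) ≠ 0 := by simp
  constructor
  · intro h
    have h1 := LinearEquiv.congr_fun h 1
    rw [reflOf_apply, reflOf_apply, map_one, mul_one, mul_one, div_eq_div_iff hα hβ] at h1
    obtain ⟨e, he, h2⟩ := q.exists_ratUnit (u := β * α⁻¹) (by
      rw [Units.val_mul, Units.val_inv_eq_inv_val, map_mul, map_inv₀]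
      have := α.ne_zero
      field_simp
      linear_combination h1)
    exact ⟨e, he, by rw [← h2]; simp⟩
  · rintro ⟨e, he, rfl⟩
    ext z
    have he' : (e : F) ≠ 0 := by exact_mod_cast he
    rw [reflOf_apply, reflOf_apply, Units.val_mul, val_ratUnit, map_mul, map_ratCast,
      mul_div_mul_left _ _ he']

theorem image_reflOf_scale_eq_iff (q : ImagQuad F) (α : Fˣ) (K : AddSubgroup F) :
    image (reflOf α) (scale α K) = scale α K ↔ ∀ z ∈ K, conj F z ∈ K := by
  constructor
  · intro h z hz
    have : reflOf α (α * z) ∈ scale α K := by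
      rw [← h]; exact ⟨_, ⟨z, hz, rfl⟩, rfl⟩
    rw [reflOf_mul, mem_scale_iff] at this
    simpa using this
  · intro h
    ext z
    constructor
    · rintro ⟨_, ⟨k, hk, rfl⟩, rfl⟩
      exact ⟨_, h k hk, (reflOf_mul α k).symm⟩
    · rintro ⟨k, hk, rfl⟩
      exact ⟨_, ⟨_, h k hk, rfl⟩, (reflOf_mul α _).trans (by rw [q.conj_conj]; rfl)⟩

end ImagQuad

end

section

namespace ImagQuad

variable {F : Type*} [Field F] [NumberField F] (q : ImagQuad F)

/-! ### The ideals generated by the shape lattices -/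

/-- The absolute value of `d`. -/
def D : ℕ := q.d.natAbs

theorem D_pos : 0 < q.D := Int.natAbs_pos.2 q.neg.ne

theorem d_eq : q.d = -(q.D : ℤ) := by have := q.neg; rw [D]; omega

theorem d_eq_F : (q.d : F) = -(q.D : F) := by rw [q.d_eq]; push_cast; rfl

theorem δ_mul_mem {J : FractionalIdeal (𝓞 F)⁰ F} {z : F} (hz : z ∈ J) : q.δ * z ∈ J :=
  isIntegral_mul_mem q.isIntegral_δ hz

theorem mem_of_odd_half {J : FractionalIdeal (𝓞 F)⁰ F} {z : F} {n : ℤ} (hn : Odd n) (hz : z ∈ J)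
    (h : (n : F) * (z / 2) ∈ J) : z / 2 ∈ J := by
  obtain ⟨k, rfl⟩ := hn
  exact int_comb_mem h hz 1 (-k) (by push_cast; ring)

theorem pair_comm (u v : F) : pair u v = pair v u := add_comm _ _

/-- Multiplication by δ turns yδ into -y|d| and x into xδ. Bézout for x and y|d, whose gcd is t by
coprimality, yields t; Bézout for x and y yields δ. -/
theorem rect_pair_eq {x y t : ℕ} (hxy : x.Coprime y) (ht : t = x.gcd q.D) :
    pair (x : F) (y * q.δ) = pair (t : F) q.δ := by
  have htx : t ∣ x := ht ▸ Nat.gcd_dvd_left _ _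
  apply le_antisymm
  · obtain ⟨a, rfl⟩ := htx
    exact pair_le_iff.2 ⟨int_comb_mem (left_mem_pair _ _) (right_mem_pair _ _) a 0 (by push_cast; ring),
      int_comb_mem (left_mem_pair _ _) (right_mem_pair _ _) 0 y (by push_cast; ring)⟩
  · have hx := left_mem_pair (x : F) (y * q.δ)
    have hy := right_mem_pair (x : F) (y * q.δ)
    refine pair_le_iff.2 ⟨?_, ?_⟩
    · have hg : t = x.gcd (y * q.D) := by rw [ht, hxy.symm.gcd_mul_left_cancel_right]
      have := Nat.gcd_eq_gcd_ab x (y * q.D)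
      rw [← hg] at this
      refine int_comb_mem hx (q.δ_mul_mem hy) (x.gcdA (y * q.D)) (-x.gcdB (y * q.D)) ?_
      have h2 : (t : F) = x * (x.gcdA (y * q.D) : ℤ) + (y * q.D) * (x.gcdB (y * q.D) : ℤ) := by
        exact_mod_cast congrArg (Int.cast (R := F)) this
      rw [h2]; push_cast
      linear_combination (x.gcdB (y * q.D) : F) * y * (q.sq + q.d_eq_F)
    · have := Nat.gcd_eq_gcd_ab x y
      rw [hxy.gcd_eq_one] at this
      refine int_comb_mem (q.δ_mul_mem hx) hy (x.gcdA y) (x.gcdB y) ?_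
      have h2 : (1 : F) = x * (x.gcdA y : ℤ) + y * (x.gcdB y : ℤ) := by
        exact_mod_cast congrArg (Int.cast (R := F)) this
      linear_combination q.δ * h2

theorem mem_rhomb {x y t : ℕ} (hxy : x.Coprime y) (ht : t = x.gcd q.D) :
    (t : F) ∈ pair (x : F) ((x + y * q.δ) / 2) ∧ q.δ ∈ pair (x : F) ((x + y * q.δ) / 2) := by
  rw [← pair_le_iff, ← q.rect_pair_eq hxy ht, pair_le_iff]
  exact ⟨left_mem_pair _ _, int_comb_mem (left_mem_pair _ _) (right_mem_pair _ _) (-1) 2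
    (by push_cast; ring)⟩

/-- Both t and δ lie in the ideal, and for odd x, y the second generators (x + yδ)/2 and (t + δ)/2
differ by an integral combination of t and δ. -/
theorem rhomb_pair_eq_of_odd {x y t : ℕ} (hxy : x.Coprime y) (ht : t = x.gcd q.D)
    (hx : Odd x) (hy : Odd y) :
    pair (x : F) ((x + y * q.δ) / 2) = pair (t : F) ((t + q.δ) / 2) := by
  obtain ⟨h1, h2⟩ := q.mem_rhomb hxy ht
  have htx : t ∣ x := ht ▸ Nat.gcd_dvd_left _ _
  obtain ⟨a, rfl⟩ := htx
  obtain ⟨i, rfl⟩ := (Nat.odd_mul.1 hx).2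
  obtain ⟨j, rfl⟩ := hy
  apply le_antisymm <;> rw [pair_le_iff]
  · exact ⟨int_comb_mem (left_mem_pair _ _) (right_mem_pair _ _) (2 * i + 1) 0 (by push_cast; ring),
      int_comb_mem (left_mem_pair _ _) (right_mem_pair _ _) (i - j) (2 * j + 1) (by push_cast; ring)⟩
  · refine ⟨h1, int_comb_mem (right_mem_pair _ _) (int_comb_mem h1 h2 i j rfl) 1 (-1) ?_⟩
    push_cast; ring

/-- Modulo t and δ the half generator reduces to t/2, δ/2 or (t + δ)/2, according to the parities of
x/t and y. Multiplication by δ and the parities of t and k = |d|/t then produce both t/2 and δ/2. -/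
theorem rhomb_pair_eq_half {x y t : ℕ} (hxy : x.Coprime y) (ht : t = x.gcd q.D)
    (h : q.d % 4 = 2 ∨ Even x ∨ Even y) :
    pair (x : F) ((x + y * q.δ) / 2) = pair ((t : F) / 2) (q.δ / 2) := by
  obtain ⟨h1, h2⟩ := q.mem_rhomb hxy ht
  have hg := right_mem_pair (x : F) ((x + y * q.δ) / 2)
  have htx : t ∣ x := ht ▸ Nat.gcd_dvd_left _ _
  have htD : t ∣ q.D := ht ▸ Nat.gcd_dvd_right _ _
  obtain ⟨a, rfl⟩ := htx
  obtain ⟨k, hk⟩ := htD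
  have hdk : (q.d : F) = -(t * k) := by rw [q.d_eq_F, hk]; push_cast; ring
  apply le_antisymm
  · rw [pair_le_iff]
    exact ⟨int_comb_mem (left_mem_pair _ _) (right_mem_pair _ _) (2 * a) 0 (by push_cast; ring),
      int_comb_mem (left_mem_pair _ _) (right_mem_pair _ _) a y (by push_cast; ring)⟩
  set J := pair (((t * a : ℕ) : F)) (((t * a : ℕ) + y * q.δ) / 2)
  rw [pair_le_iff]
  have hmul : ∀ {z : F}, z ∈ J → q.δ * z ∈ J := q.δ_mul_mem
  -- Multiplying t/2 by δ gives t·(δ/2), from which an odd t can be removed because δ is in the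
  -- ideal.
  have from_t (hto : Odd t) (h : (t : F) / 2 ∈ J) : q.δ / 2 ∈ J := by
    apply mem_of_odd_half (n := t) (by exact_mod_cast hto) h2
    have := hmul h
    convert this using 1
    push_cast; ring
  have from_δ (hko : Odd k) (h : q.δ / 2 ∈ J) : (t : F) / 2 ∈ J := by
    apply mem_of_odd_half (n := k) (by exact_mod_cast hko) h1
    have := int_mul_mem (-1) (hmul h)
    convert this using 1
    push_cast; linear_combination (1 / 2 : F) * (q.sq + hdk)
  have red (i j : ℤ) : ((t * a : ℕ) + y * q.δ) / 2 - (i * t + j * q.δ) ∈ J :=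
    int_comb_mem hg (int_comb_mem h1 h2 i j rfl) 1 (-1) (by push_cast; ring)
  rcases Nat.even_or_odd y with hy | hy
  · have hxo : Odd (t * a) := by
      rw [← Nat.not_even_iff_odd]
      intro hx
      have := Nat.dvd_gcd hx.two_dvd hy.two_dvd
      rw [hxy.gcd_eq_one] at this; omega
    obtain ⟨hto, i, rfl⟩ := Nat.odd_mul.1 hxo
    obtain ⟨j, rfl⟩ := hy
    have h3 : (t : F) / 2 ∈ J := by
      have := red i j
      convert this using 1
      push_cast; ring
    exact ⟨h3, from_t hto h3⟩
  obtain ⟨j, rfl⟩ := hy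
  rcases Nat.even_or_odd a with ⟨i, rfl⟩ | ⟨i, rfl⟩
  · have h3 : q.δ / 2 ∈ J := by
      have := red i j
      convert this using 1
      push_cast; ring
    have hsum : Odd k ∨ Even k := (Nat.even_or_odd k).symm
    rcases hsum with hko | hke
    · exact ⟨from_δ hko h3, h3⟩
    · exfalso
      have hg' := Nat.dvd_gcd (Dvd.intro (i + i) rfl : t ∣ t * (i + i)) (Dvd.intro k hk.symm)
      -- With x/t and |d|/t both even, 2t would divide gcd(x, d) = t.
      have h2t : t * 2 ∣ (t * (i + i)).gcd q.D :=
        Nat.dvd_gcd (mul_dvd_mul_left t ⟨i, by ring⟩) (by rw [hk]; exact mul_dvd_mul_left t hke.two_dvd)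
      rw [← ht] at h2t
      have ht0 : 0 < t := Nat.pos_of_dvd_of_pos (Dvd.intro k hk.symm) q.D_pos
      have := Nat.le_of_dvd ht0 h2t
      omega
  · have h3 : ((t : F) + q.δ) / 2 ∈ J := by
      have := red i j
      convert this using 1
      push_cast; ring
    have h4 : (t * q.δ - t * k) / 2 ∈ J := by
      have := hmul h3
      convert this using 1
      linear_combination (-1 / 2 : F) * (q.sq + hdk)
    have hDodd : Even q.D ∨ Even t := by
      rcases h with h | h | h
      · left
        rw [D, Int.natAbs_even, Int.even_iff]; omega
      · rcases Nat.even_mul.1 h with h | h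
        · exact Or.inr h
        · exact absurd h (by simp)
      · exact absurd h (by simp)
    rcases Nat.even_or_odd t with hte | hto
    · have hko : Odd k := by
        rw [← Nat.not_even_iff_odd]
        intro hke
        have h4d : (2 : ℤ) * 2 ∣ q.d := by
          rw [q.d_eq, dvd_neg, hk]
          exact_mod_cast mul_dvd_mul hte.two_dvd hke.two_dvd
        have := q.sqf 2 h4d
        rw [Int.isUnit_iff] at this; omega
      obtain ⟨r, hr⟩ := hte
      have hrF : (t : F) = r + r := by exact_mod_cast congrArg (Nat.cast (R := F)) hr
      have h5 : (t : F) / 2 ∈ J := by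
        apply mem_of_odd_half (n := k) (by exact_mod_cast hko) h1
        refine int_comb_mem h4 h2 (-1) r ?_
        push_cast; rw [hrF]; ring
      refine ⟨h5, int_comb_mem h3 h5 1 (-1) ?_⟩
      push_cast; ring
    · have hke : Even k := by
        rcases hDodd with h | h
        · rw [hk] at h
          exact (Nat.even_mul.1 h).resolve_left (Nat.not_even_iff_odd.2 hto)
        · exact absurd h (Nat.not_even_iff_odd.2 hto)
      obtain ⟨r, hr⟩ := hke
      have hrF : (k : F) = r + r := by exact_mod_cast congrArg (Nat.cast (R := F)) hr
      have h5 : q.δ / 2 ∈ J := by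
        apply mem_of_odd_half (n := t) (by exact_mod_cast hto) h2
        refine int_comb_mem h4 h1 1 r ?_
        push_cast; rw [hrF]; ring
      refine ⟨int_comb_mem h3 h5 1 (-1) ?_, h5⟩
      push_cast; ring

/-! ### Lattice bases of these ideals -/

theorem exists_cofactor {t : ℕ} (ht : t ∣ q.D) : ∃ k : ℤ, q.d = t * k := by
  obtain ⟨k, hk⟩ := ht
  exact ⟨-k, by rw [q.d_eq, hk]; push_cast; ring⟩

variable [Algebra.IsQuadraticExtension ℚ F]

theorem mem_rect_pair_iff (h : q.d % 4 ≠ 1) {t : ℕ} (ht : t ∣ q.D) (c z : F) :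
    z ∈ pair (c * t) (c * q.δ) ↔ z ∈ lat (c * t) (c * q.δ) := by
  obtain ⟨k, hk⟩ := q.exists_cofactor ht
  have hkF : (q.d : F) = t * k := by rw [hk]; push_cast; ring
  apply q.mem_pair_iff_mem_lat <;> rw [ω, if_neg h, mem_lat]
  · exact ⟨0, t, by push_cast; ring⟩
  · exact ⟨k, 0, by push_cast; linear_combination c * q.sq + c * hkF⟩

/-- Stability under ω is an explicit computation with d = tk, where t and k are odd; it needs k ≡ t
modulo 4 if d ≡ 1 (mod 4) and only modulo 2 otherwise. -/
theorem mem_rhomb_pair_iff (h : q.d % 4 ≠ 2) {t : ℕ} (ht : t ∣ q.D) (c z : F) :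
    z ∈ pair (c * t) (c * ((t + q.δ) / 2)) ↔ z ∈ lat (c * t) (c * ((t + q.δ) / 2)) := by
  obtain ⟨k, hk⟩ := q.exists_cofactor ht
  have hkF : (q.d : F) = t * k := by rw [hk]; push_cast; ring
  have hodd : Odd ((t : ℤ) * k) := by rw [← hk, Int.odd_iff]; have := q.d_mod_four; omega
  obtain ⟨⟨t', ht'⟩, hko⟩ := Int.odd_mul.1 hodd
  have ht'F : (t : F) = 2 * t' + 1 := by exact_mod_cast congrArg (Int.cast (R := F)) ht'
  by_cases h1 : q.d % 4 = 1
  -- Two integers with product 1 modulo 4 are congruent modulo 4.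
  · obtain ⟨l, hl⟩ : (4 : ℤ) ∣ k - t := by
      rw [hk] at h1
      obtain ⟨k', hk'⟩ := hko
      have ht4 : (t : ℤ) % 4 = 1 ∨ (t : ℤ) % 4 = 3 := by omega
      have hk4 : k % 4 = 1 ∨ k % 4 = 3 := by omega
      rcases ht4 with h3 | h3 <;> rcases hk4 with h4 | h4 <;>
        simp [Int.mul_emod, h3, h4] at h1 <;> omega
    have hlF : (k : F) = t + 4 * l := by
      have : k = t + 4 * l := by omega
      rw [this]; push_cast; ring
    apply q.mem_pair_iff_mem_lat <;> rw [ω, if_pos h1, mem_lat]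
    · refine ⟨-t', t, ?_⟩
      push_cast; rw [ht'F]; ring
    · refine ⟨l, t' + 1, ?_⟩
      push_cast
      linear_combination (c / 4) * q.sq + (c / 4) * hkF + (c / 4) * t * hlF + (c / 4) * (t + q.δ) * ht'F
  · obtain ⟨l, hl⟩ : (2 : ℤ) ∣ k - t := by
      obtain ⟨k', hk'⟩ := hko
      exact ⟨k' - t', by rw [hk', ht']; ring⟩
    have hlF : (k : F) = t + 2 * l := by
      have : k = t + 2 * l := by omega
      rw [this]; push_cast; ring
    apply q.mem_pair_iff_mem_lat <;> rw [ω, if_neg h1, mem_lat]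
    · exact ⟨-t, 2 * t, by push_cast; ring⟩
    · refine ⟨l, t, ?_⟩
      push_cast
      linear_combination (c / 2) * q.sq + (c / 2) * hkF + (c / 2) * t * hlF

/-- If `d ≡ 1 (mod 4)` the two kinds of ideals coincide. -/
theorem rect_pair_eq_rhomb_pair (h : q.d % 4 = 1) {t : ℕ} (ht : t ∣ q.D) (c : F) :
    pair (c * t) (c * q.δ) = pair (c * t) (c * ((t + q.δ) / 2)) := by
  obtain ⟨k, hk⟩ := q.exists_cofactor ht
  have hodd : Odd ((t : ℤ) * k) := by rw [← hk, Int.odd_iff]; omega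
  obtain ⟨⟨t', ht'⟩, hko⟩ := Int.odd_mul.1 hodd
  have ht'F : (t : F) = 2 * t' + 1 := by exact_mod_cast congrArg (Int.cast (R := F)) ht'
  apply le_antisymm <;> rw [pair_le_iff]
  · exact ⟨left_mem_pair _ _, int_comb_mem (left_mem_pair _ _) (right_mem_pair _ _) (-1) 2
      (by push_cast; ring)⟩
  · refine ⟨left_mem_pair _ _, ?_⟩
    have h1 : q.ω * (c * t) ∈ pair (c * t) (c * q.δ) :=
      isIntegral_mul_mem q.isIntegral_ω (left_mem_pair _ _)
    have h2 := int_comb_mem h1 (right_mem_pair (c * t) (c * q.δ)) 1 (-t') rfl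
    refine int_comb_mem h2 (left_mem_pair _ _) 1 0 ?_
    rw [ω, if_pos h]; push_cast; rw [ht'F]; ring

theorem linearIndependent_pair {u v : F} {r a b : ℚ} (hu : u = r) (hv : v = a + b * q.δ)
    (hr : r ≠ 0) (hb : b ≠ 0) : LinearIndependent ℚ ![u, v] := by
  rw [LinearIndependent.pair_iff]
  intro s t h
  have := q.coords_eq_zero (a := s * r + t * a) (b := t * b) (by
    simp only [Algebra.smul_def, eq_ratCast] at h
    push_cast; rw [hu, hv] at h; linear_combination h)
  have ht : t = 0 := by simpa [hb] using this.2
  subst ht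
  exact ⟨by simpa [hr] using this.1, rfl⟩

theorem shape_gen_ne_zero (w : Shape) : (w.1.1.1 : F) ≠ 0 := by exact_mod_cast w.1.2.1.ne'

/-- The ideal generated by the lattice of shape `w`. -/
def shapeIdeal (w : Shape) : (FractionalIdeal (𝓞 F)⁰ F)ˣ :=
  Units.mk0 (pair (w.1.1.1 : F) (q.gen w)) (pair_ne_zero _ (shape_gen_ne_zero w))

/-- The ideal `(t, δ)`. -/
def γ (t : ℕ) : (FractionalIdeal (𝓞 F)⁰ F)ˣ :=
  Units.mk0 (pair q.δ (t : F)) (pair_ne_zero _ q.δ_ne_zero)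

/-- The ideal `(1, (1 + δ) / 2)`. -/
def half : (FractionalIdeal (𝓞 F)⁰ F)ˣ :=
  Units.mk0 (pair 1 ((1 + q.δ) / 2)) (pair_ne_zero _ one_ne_zero)

theorem val_γ (t : ℕ) : (q.γ t : FractionalIdeal (𝓞 F)⁰ F) = pair (t : F) q.δ := pair_comm _ _

end ImagQuad

end

/-! ### Indices and classes of the ideals generated by shape lattices. -/

section

namespace ImagQuad

variable {F : Type*} [Field F] [NumberField F] (q : ImagQuad F) [Algebra.IsQuadraticExtension ℚ F]

/-- The index in `shapeIdeal` of the lattice of shape `w`, divided by `x y / gcd(x, d)`. -/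
def indexFactor (w : Shape) : ℕ :=
  if w.2 then (if q.d % 4 ≠ 2 ∧ Odd w.1.1.1 ∧ Odd w.1.1.2 then 1
    else 2 * (if q.d % 4 = 1 then 2 else 1)) else (if q.d % 4 = 1 then 2 else 1)

theorem val_shapeIdeal (w : Shape) :
    (q.shapeIdeal w : FractionalIdeal (𝓞 F)⁰ F) = pair (w.1.1.1 : F) (q.gen w) := rfl

theorem shapeLat_le (w : Shape) : q.shapeLat w ≤ lattice (q.shapeIdeal w) :=
  lat_le_iff.2 ⟨left_mem_pair _ _, right_mem_pair _ _⟩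

theorem lattice_eq_lat {J : (FractionalIdeal (𝓞 F)⁰ F)ˣ} {u v : F}
    (hJ : (J : FractionalIdeal (𝓞 F)⁰ F) = pair u v) (h : ∀ z, z ∈ pair u v ↔ z ∈ lat u v) :
    lattice J = lat u v := by
  ext z; rw [mem_lattice, hJ, h]

theorem odd_of_dvd_D (h : q.d % 4 ≠ 2) {t : ℕ} (ht : t ∣ q.D) : Odd t := by
  have : Odd q.D := by
    rw [D, Int.natAbs_odd, Int.odd_iff]; have := q.d_mod_four; omega
  exact this.of_dvd_nat ht

theorem shapeIdeal_eq_of_odd {w : Shape} (hw : w.2 = true) (hx : Odd w.1.1.1) (hy : Odd w.1.1.2) :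
    (q.shapeIdeal w : FractionalIdeal (𝓞 F)⁰ F) =
      pair ((w.1.1.1.gcd q.D : ℕ) : F) (((w.1.1.1.gcd q.D : ℕ) + q.δ) / 2) := by
  rw [val_shapeIdeal, gen, if_pos hw]
  exact q.rhomb_pair_eq_of_odd w.1.2.2.2 rfl hx hy

theorem shapeIdeal_eq_half {w : Shape} (hw : w.2 = true)
    (h : ¬ (q.d % 4 ≠ 2 ∧ Odd w.1.1.1 ∧ Odd w.1.1.2)) :
    (q.shapeIdeal w : FractionalIdeal (𝓞 F)⁰ F) =
      pair (1 / 2 * ((w.1.1.1.gcd q.D : ℕ) : F)) (1 / 2 * q.δ) := by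
  rw [val_shapeIdeal, gen, if_pos hw, q.rhomb_pair_eq_half w.1.2.2.2 rfl, one_div_mul_eq_div,
    one_div_mul_eq_div]
  by_contra hc
  push Not at hc
  exact h ⟨hc.1, by simpa using hc.2.1, by simpa using hc.2.2⟩

theorem shapeIdeal_eq_rect {w : Shape} (hw : w.2 = false) :
    (q.shapeIdeal w : FractionalIdeal (𝓞 F)⁰ F) = pair ((w.1.1.1.gcd q.D : ℕ) : F) q.δ := by
  rw [val_shapeIdeal, gen, if_neg (by simp [hw])]
  exact q.rect_pair_eq w.1.2.2.2 rfl

/-- In each case a lattice basis of the ideal is at hand, and the index is the determinant of the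
shape basis expressed in it. For d ≡ 1 (mod 4) the ideals (t, δ) need (t + δ)/2 as second basis
vector, which is where the extra factor 2 comes from. -/
theorem relIndex_shape (w : Shape) : (q.shapeLat w).relIndex (lattice (q.shapeIdeal w)) =
    q.indexFactor w * (w.1.1.1 / w.1.1.1.gcd q.D * w.1.1.2) := by
  have h2 : Module.finrank ℚ F = 2 := Algebra.IsQuadraticExtension.finrank_eq_two ℚ F
  set t := w.1.1.1.gcd q.D with ht
  have htx : t ∣ w.1.1.1 := Nat.gcd_dvd_left _ _
  have htD : t ∣ q.D := Nat.gcd_dvd_right _ _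
  obtain ⟨a, ha⟩ := htx
  have ht0 : 0 < t := Nat.pos_of_dvd_of_pos htD q.D_pos
  have hy0 := w.1.2.2.1
  have ha0 : 0 < a := Nat.pos_of_ne_zero (by rintro rfl; have := w.1.2.1; omega)
  have hdiv : w.1.1.1 / t = a := by rw [ha, Nat.mul_div_cancel_left _ ht0]
  have haF : (w.1.1.1 : F) = t * a := by exact_mod_cast congrArg (Nat.cast (R := F)) ha
  set y := w.1.1.2 with hy
  have htQ : (t : ℚ) ≠ 0 := by exact_mod_cast ht0.ne'
  rw [hdiv, shapeLat, indexFactor]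
  rcases Bool.eq_false_or_eq_true w.2 with hw | hw
  · rw [gen, if_pos hw, if_pos hw]
    split_ifs with hodd h1
    · obtain ⟨hd2, hxo, hyo⟩ := hodd
      obtain ⟨j, hj⟩ := id hyo
      have hao : Odd a := by rw [ha] at hxo; exact (Nat.odd_mul.1 hxo).2
      obtain ⟨i, hi⟩ := hao
      have hmem := fun z => q.mem_rhomb_pair_iff hd2 htD 1 z
      simp only [one_mul] at hmem
      rw [lattice_eq_lat (q.shapeIdeal_eq_of_odd hw hxo hyo) hmem, relIndex_lat
        (q.linearIndependent_pair (r := t) (a := t / 2) (b := 1 / 2) (by push_cast; rfl) (by push_cast; ring) htQ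
          (by norm_num)) h2 (a := a) (b := 0) (c := (i - j)) (e := y)]
      · rw [one_mul, zero_mul, sub_zero]; exact_mod_cast rfl
      · rw [haF]; push_cast; ring
      · have hiF : (a : F) = 2 * i + 1 := by exact_mod_cast congrArg (Nat.cast (R := F)) hi
        have hjF : (y : F) = 2 * j + 1 := by exact_mod_cast congrArg (Nat.cast (R := F)) hj
        push_cast; rw [haF, ← hy, hiF, hjF]; ring
      · rw [zero_mul, sub_zero]; positivity
    · have hmem := fun z => q.mem_rhomb_pair_iff (by omega) htD (1 / 2) z
      rw [lattice_eq_lat ((q.shapeIdeal_eq_half hw hodd).trans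
        (q.rect_pair_eq_rhomb_pair h1 htD _)) hmem, relIndex_lat
        (q.linearIndependent_pair (r := t / 2) (a := t / 4) (b := 1 / 4) (by push_cast; ring)
          (by push_cast; ring) (by positivity)
          (by norm_num)) h2 (a := 2 * a) (b := 0) (c := a - y) (e := 2 * y)]
      · rw [zero_mul, sub_zero, show (2 * a * (2 * y) : ℤ) = ((2 * a * (2 * y) : ℕ) : ℤ) by push_cast; rfl,
          Int.natAbs_natCast]; ring
      · rw [haF]; push_cast; ring
      · push_cast; rw [haF, ← hy]; ring
      · rw [zero_mul, sub_zero]; positivity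
    · have hmem := fun z => q.mem_rect_pair_iff h1 htD (1 / 2) z
      rw [lattice_eq_lat (q.shapeIdeal_eq_half hw hodd) hmem, relIndex_lat
        (q.linearIndependent_pair (r := t / 2) (a := 0) (b := 1 / 2) (by push_cast; ring)
          (by push_cast; ring) (by positivity)
          (by norm_num)) h2 (a := 2 * a) (b := 0) (c := a) (e := y)]
      · rw [zero_mul, sub_zero, show (2 * a * y : ℤ) = ((2 * a * y : ℕ) : ℤ) by push_cast; rfl,
          Int.natAbs_natCast]; ring
      · rw [haF]; push_cast; ring
      · push_cast; rw [haF, ← hy]; ring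
      · rw [zero_mul, sub_zero]; positivity
  · rw [gen, if_neg (by simp [hw]), if_neg (by simp [hw])]
    split_ifs with h1
    · have hmem := fun z => q.mem_rhomb_pair_iff (by omega) htD 1 z
      have hJ := q.rect_pair_eq_rhomb_pair h1 htD 1
      simp only [one_mul] at hmem hJ
      rw [lattice_eq_lat ((q.shapeIdeal_eq_rect hw).trans hJ) hmem, relIndex_lat
        (q.linearIndependent_pair (r := t) (a := t / 2) (b := 1 / 2) (by push_cast; ring)
          (by push_cast; ring) htQ
          (by norm_num)) h2 (a := a) (b := 0) (c := -y) (e := 2 * y)]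
      · rw [zero_mul, sub_zero, show (a * (2 * y) : ℤ) = ((a * (2 * y) : ℕ) : ℤ) by push_cast; rfl,
          Int.natAbs_natCast]; ring
      · rw [haF]; push_cast; ring
      · push_cast; rw [← hy]; ring
      · rw [zero_mul, sub_zero]; positivity
    · have hmem := fun z => q.mem_rect_pair_iff h1 htD 1 z
      simp only [one_mul] at hmem
      rw [lattice_eq_lat (q.shapeIdeal_eq_rect hw) hmem, relIndex_lat
        (q.linearIndependent_pair (r := t) (a := 0) (b := 1) (by push_cast; ring)
          (by push_cast; ring) htQ
          (by norm_num)) h2 (a := a) (b := 0) (c := 0) (e := y)]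
      · rw [zero_mul, sub_zero, show (a * y : ℤ) = ((a * y : ℕ) : ℤ) by push_cast; rfl,
          Int.natAbs_natCast]; ring
      · rw [haF]; push_cast; ring
      · push_cast; rw [← hy]; ring
      · rw [zero_mul, sub_zero]; positivity

theorem relIndex_shape_ne_zero (w : Shape) :
    (q.shapeLat w).relIndex (lattice (q.shapeIdeal w)) ≠ 0 := by
  rw [q.relIndex_shape]
  have h1 := Nat.div_pos (Nat.le_of_dvd w.1.2.1 (Nat.gcd_dvd_left w.1.1.1 q.D))
    (Nat.gcd_pos_of_pos_left q.D w.1.2.1)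
  have h2 := w.1.2.2.1
  have h3 : q.indexFactor w ≠ 0 := by rw [indexFactor]; split_ifs <;> simp
  positivity

/-! ### The classes of these ideals -/

/-- The oddness of t and of its cofactor k allows (1 + δ)/2 times t and times δ to be reduced to (t
+ δ)/2 modulo δ and t. -/
theorem half_mul_γ (h : q.d % 4 ≠ 2) {t : ℕ} (ht : t ∣ q.D) :
    ((q.half * q.γ t : (FractionalIdeal (𝓞 F)⁰ F)ˣ) : FractionalIdeal (𝓞 F)⁰ F) =
      pair (t : F) ((t + q.δ) / 2) := by
  obtain ⟨k, hk⟩ := q.exists_cofactor ht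
  have hkF : (q.d : F) = t * k := by rw [hk]; push_cast; ring
  have hodd : Odd ((t : ℤ) * k) := by rw [← hk, Int.odd_iff]; have := q.d_mod_four; omega
  obtain ⟨⟨t', ht'⟩, ⟨k', hk'⟩⟩ := Int.odd_mul.1 hodd
  have ht'F : (t : F) = 2 * t' + 1 := by exact_mod_cast congrArg (Int.cast (R := F)) ht'
  have hk'F : (k : F) = 2 * k' + 1 := by exact_mod_cast congrArg (Int.cast (R := F)) hk'
  rw [Units.val_mul, val_γ]
  change pair 1 ((1 + q.δ) / 2) * _ = _
  have hδ : q.δ ∈ pair (t : F) ((t + q.δ) / 2) :=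
    int_comb_mem (left_mem_pair _ _) (right_mem_pair _ _) (-1) 2 (by push_cast; ring)
  apply le_antisymm
  · rw [pair_mul_pair_le, one_mul, one_mul]
    refine ⟨left_mem_pair _ _, hδ, int_comb_mem (right_mem_pair _ _) hδ 1 t' ?_,
      int_comb_mem (right_mem_pair _ _) (left_mem_pair _ _) 1 k' ?_⟩
    · push_cast; linear_combination (1 / 2 : F) * q.δ * ht'F
    · push_cast; linear_combination (1 / 2 : F) * q.sq + (1 / 2 : F) * hkF + (1 / 2 : F) * t * hk'F
  · obtain ⟨h1, h2, h3, -⟩ := pair_mul_pair_le.1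
      (le_refl (pair 1 ((1 + q.δ) / 2) * pair (t : F) q.δ))
    rw [one_mul] at h1 h2
    refine pair_le_iff.2 ⟨h1, int_comb_mem h3 h2 1 (-t') ?_⟩
    push_cast; linear_combination (-1 / 2 : F) * q.δ * ht'F

/-- The class of the ideal generated by the lattice of shape `w`. -/
theorem idealClass_shapeIdeal (w : Shape) : idealClass (q.shapeIdeal w) =
    if w.2 ∧ q.d % 4 = 3 ∧ Odd w.1.1.1 ∧ Odd w.1.1.2 then
      idealClass q.half * idealClass (q.γ (w.1.1.1.gcd q.D))
    else idealClass (q.γ (w.1.1.1.gcd q.D)) := by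
  have htD : w.1.1.1.gcd q.D ∣ q.D := Nat.gcd_dvd_right _ _
  rcases Bool.eq_false_or_eq_true w.2 with hw | hw
  · by_cases hodd : q.d % 4 ≠ 2 ∧ Odd w.1.1.1 ∧ Odd w.1.1.2
    · have h := q.shapeIdeal_eq_of_odd hw hodd.2.1 hodd.2.2
      split_ifs with h3
      · rw [← q.half_mul_γ hodd.1 htD] at h
        rw [Units.ext h, idealClass, map_mul]; rfl
      · have h1 : q.d % 4 = 1 := by
          have := q.d_mod_four
          have : ¬ q.d % 4 = 3 := fun h4 => h3 ⟨hw, h4, hodd.2⟩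
          omega
        have h4 := q.rect_pair_eq_rhomb_pair h1 htD 1
        simp only [one_mul] at h4
        rw [← h4, ← val_γ] at h
        rw [Units.ext h]
    · rw [if_neg (fun h => hodd ⟨by omega, h.2.2⟩), idealClass_eq_iff]
      refine ⟨Units.mk0 (1 / 2) (by norm_num), Units.ext ?_⟩
      rw [q.shapeIdeal_eq_half hw hodd, val_scaleIdeal, val_γ, spanSingleton_mul_pair]; rfl
  · rw [if_neg (by simp [hw])]
    congr 1
    apply Units.ext
    rw [q.shapeIdeal_eq_rect hw, val_γ]

end ImagQuad

end

/-! ### Averaging over fibres, bounded denominators and finiteness. -/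

section

/-- Distributing the value of each point of `Z` evenly over its fibre does not change sums. -/
theorem summable_iff_and_tsum_eq_of_fibers {Y Z : Type*} (π : Y → Z)
    (hπ : ∀ z, Nat.card {y // π y = z} ≠ 0) {f : Y → ℂ} {g : Z → ℂ}
    (hf : ∀ y, f y = g (π y) / Nat.card {y' // π y' = π y}) :
    (Summable f ↔ Summable g) ∧ ∑' y, f y = ∑' z, g z := by
  let e := Equiv.sigmaFiberEquiv π
  have hfin (z : Z) : Finite {y // π y = z} := Nat.finite_of_card_ne_zero (hπ z)
  have hfe (z : Z) (y : {y // π y = z}) : f (e ⟨z, y⟩) = g z / Nat.card {y' // π y' = z} := by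
    obtain ⟨y, rfl⟩ := y
    exact hf y
  have hcard (z : Z) : (Nat.card {y' // π y' = z} : ℂ) ≠ 0 := by exact_mod_cast hπ z
  have hcardR (z : Z) : (Nat.card {y' // π y' = z} : ℝ) ≠ 0 := by exact_mod_cast hπ z
  have hsum (z : Z) : ∑' y : {y // π y = z}, f (e ⟨z, y⟩) = g z := by
    have := hfin z
    simp only [hfe, tsum_const, nsmul_eq_mul]
    rw [mul_div_cancel₀ _ (hcard z)]
  have hsumn (z : Z) : ∑' y : {y // π y = z}, ‖f (e ⟨z, y⟩)‖ = ‖g z‖ := by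
    have := hfin z
    simp only [hfe, tsum_const, nsmul_eq_mul, norm_div, Complex.norm_natCast]
    rw [mul_div_cancel₀ _ (hcardR z)]
  have h1 : Summable f ↔ Summable g := by
    rw [← e.summable_iff, ← summable_norm_iff, summable_sigma_of_nonneg (fun _ => norm_nonneg _),
      ← summable_norm_iff (f := g)]
    simp only [Function.comp_apply, hsumn]
    exact ⟨fun h => h.2, fun h => ⟨fun z => by have := hfin z; exact Summable.of_finite, h⟩⟩
  refine ⟨h1, ?_⟩
  by_cases hs : Summable f
  · have hs' := e.summable_iff.2 hs
    rw [← e.tsum_eq f]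
    change ∑' c, (f ∘ e) c = _
    rw [Summable.tsum_sigma' (fun z => by have := hfin z; exact Summable.of_finite) hs']
    exact tsum_congr hsum
  · rw [tsum_eq_zero_of_not_summable hs, tsum_eq_zero_of_not_summable (fun h => hs (h1.2 h))]

namespace ImagQuad

variable {F : Type*} [Field F] [NumberField F] (q : ImagQuad F) [Algebra.IsQuadraticExtension ℚ F]

theorem exists_int_of_isIntegral {a b : ℚ} (h : IsIntegral ℤ ((a : F) + b * q.δ)) :
    (∃ i : ℤ, 2 * a = i) ∧ ∃ i : ℤ, 2 * b = i := by
  obtain ⟨i, j, hij⟩ := (q.isIntegral_iff _).1 h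
  rw [ω] at hij
  split_ifs at hij
  · obtain ⟨rfl, rfl⟩ := q.coords_inj (a := a) (b := b) (a' := i + j / 2) (b' := j / 2) (by
      rw [hij]; push_cast; ring)
    exact ⟨⟨2 * i + j, by push_cast; ring⟩, j, by ring⟩
  · obtain ⟨rfl, rfl⟩ := q.coords_inj (a := a) (b := b) (a' := i) (b' := j) (by
      rw [hij]; push_cast; ring)
    exact ⟨⟨2 * i, by push_cast; ring⟩, 2 * j, by push_cast; ring⟩

theorem isIntegral_conj {z : F} (hz : IsIntegral ℤ z) : IsIntegral ℤ (conj F z) :=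
  hz.map ((conj F).toAlgHom.restrictScalars ℤ)

theorem exists_int_norm (q : ImagQuad F) {z : F} (hz : IsIntegral ℤ z) (h0 : z ≠ 0) :
    ∃ n : ℤ, n ≠ 0 ∧ (n : F) = z * conj F z := by
  obtain ⟨n, hn⟩ := IsIntegrallyClosed.isIntegral_iff.1 (Algebra.isIntegral_norm ℚ hz)
  have h := norm_eq z
  rw [← hn] at h
  refine ⟨n, ?_, by simpa using h⟩
  rintro rfl
  have := q.norm_pos h0
  rw [← hn] at this
  simp at this

/-- Elements of a fractional ideal have bounded denominators. -/
theorem exists_denom (I : FractionalIdeal (𝓞 F)⁰ F) : ∃ c : ℤ, c ≠ 0 ∧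
    ∀ a b : ℚ, (a : F) + b * q.δ ∈ I → (∃ i : ℤ, c * a = i) ∧ ∃ i : ℤ, c * b = i := by
  obtain ⟨r, hr, hI⟩ := I.isFractional
  have hr0 : (r : F) ≠ 0 := by
    simpa using nonZeroDivisors.ne_zero hr
  obtain ⟨n, hn0, hn⟩ := q.exists_int_norm r.isIntegral_coe hr0
  -- The norm n of a common denominator clears the ideal into the ring of integers, and 2 clears the
  -- half-integral coordinates there.
  refine ⟨2 * n, by simpa using hn0, fun a b hab => ?_⟩
  obtain ⟨r', hr'⟩ := hI _ hab
  have hint : IsIntegral ℤ (((n * a : ℚ) : F) + ((n * b : ℚ) : F) * q.δ) := by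
    have h1 : IsIntegral ℤ (conj F r * (r * ((a : F) + b * q.δ))) := by
      apply (isIntegral_conj r.isIntegral_coe).mul
      have : (r : F) * ((a : F) + b * q.δ) = r' := by
        rw [← Algebra.smul_def]; exact hr'.symm
      rw [this]
      exact r'.isIntegral_coe
    convert h1 using 1
    push_cast; rw [hn]; ring
  obtain ⟨⟨i, hi⟩, ⟨j, hj⟩⟩ := q.exists_int_of_isIntegral hint
  exact ⟨⟨i, by rw [← hi]; push_cast; ring⟩, ⟨j, by rw [← hj]; push_cast; ring⟩⟩

/-- A nonzero fractional ideal contains a nonzero integer. -/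
theorem exists_int_mem (q : ImagQuad F) (I : (FractionalIdeal (𝓞 F)⁰ F)ˣ) :
    ∃ m : ℤ, m ≠ 0 ∧ (m : F) ∈ (I : FractionalIdeal (𝓞 F)⁰ F) := by
  obtain ⟨r, hr0, hr⟩ := FractionalIdeal.exists_ne_zero_mem_isInteger I.ne_zero
  have hr0' : (r : F) ≠ 0 := by simpa using hr0
  obtain ⟨n, hn0, hn⟩ := q.exists_int_norm r.isIntegral_coe hr0'
  refine ⟨n, hn0, ?_⟩
  rw [hn, mul_comm]
  exact isIntegral_mul_mem (isIntegral_conj r.isIntegral_coe) hr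

/-- A conjugation-stable subgroup of finite index in a fractional ideal is a multiple of a shape
lattice. -/
theorem exists_shape_of_relIndex {I : (FractionalIdeal (𝓞 F)⁰ F)ˣ} {K : AddSubgroup F}
    (hKI : K ≤ lattice I) (h0 : K.relIndex (lattice I) ≠ 0) (hK : ∀ z ∈ K, conj F z ∈ K) :
    ∃ (e : ℚ) (he : e ≠ 0) (w : Shape), K = scale (ratUnit F e he) (q.shapeLat w) := by
  obtain ⟨c, hc, hb⟩ := q.exists_denom (I : FractionalIdeal (𝓞 F)⁰ F)
  obtain ⟨m, hm, hmI⟩ := q.exists_int_mem I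
  have key {z : F} (hz : z ∈ lattice I) : (K.relIndex (lattice I) : F) * z ∈ K := by
    have h1 := (K.addSubgroupOf (lattice I)).nsmul_index_mem ⟨z, hz⟩
    rw [AddSubgroup.mem_addSubgroupOf] at h1
    unfold AddSubgroup.relIndex
    simpa using h1
  -- The index of K in I annihilates I/K, so that index times an integer of I, and times δ as well,
  -- lies in K.
  refine q.exists_shape hK hc (m := K.relIndex (lattice I) * m)
    (mul_ne_zero (by exact_mod_cast h0) hm) (fun a b hab => hb a b (hKI hab)) ?_ ?_
  · have := key hmI
    push_cast; exact this
  · have := key (q.δ_mul_mem hmI)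
    push_cast
    convert this using 1
    ring

/-- Finitely many elements of a fractional ideal have a given norm. -/
theorem finite_norm_eq (q : ImagQuad F) (I : FractionalIdeal (𝓞 F)⁰ F) (m : ℚ) :
    {z : F | z ∈ I ∧ Algebra.norm ℚ z = m}.Finite := by
  obtain ⟨c, hc, hb⟩ := q.exists_denom I
  have hcQ : (c : ℚ) ≠ 0 := by exact_mod_cast hc
  obtain ⟨M, hM⟩ := exists_nat_gt ((c : ℚ) ^ 2 * m)
  apply Set.Finite.subset (((Set.finite_Icc (-(M : ℤ)) M).prod (Set.finite_Icc (-(M : ℤ)) M)).image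
    (fun p : ℤ × ℤ => ((p.1 / c : ℚ) : F) + ((p.2 / c : ℚ) : F) * q.δ))
  rintro z ⟨hz, hN⟩
  obtain ⟨a, b, rfl⟩ := q.exists_coords z
  obtain ⟨⟨i, hi⟩, ⟨j, hj⟩⟩ := hb a b hz
  have hij : i ^ 2 - q.d * j ^ 2 < M := by
    rw [q.norm_coords] at hN
    have : (i ^ 2 - q.d * j ^ 2 : ℚ) < M := by rw [← hi, ← hj]; rw [← hN] at hM; linarith
    exact_mod_cast this
  have hneg := q.neg
  have hij' : i ^ 2 ≤ M ∧ j ^ 2 ≤ M := by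
    constructor <;> nlinarith [sq_nonneg i, sq_nonneg j, mul_nonneg (by omega : 0 ≤ -q.d - 1) (sq_nonneg j)]
  have habs (k : ℤ) (hk : k ^ 2 ≤ M) : -(M : ℤ) ≤ k ∧ k ≤ M := by
    rcases le_or_gt k 0 with h | h
    · exact ⟨by nlinarith, by nlinarith⟩
    · exact ⟨by nlinarith, by nlinarith⟩
  refine ⟨(i, j), ⟨habs i hij'.1, habs j hij'.2⟩, ?_⟩
  simp only
  rw [← hi, ← hj, mul_div_cancel_left₀ _ hcQ, mul_div_cancel_left₀ _ hcQ]

end ImagQuad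

end

/-! ### From reflections and invariant sublattices to shapes and indices. -/

section

section IndexSet

variable {F : Type*} [Field F] [NumberField F]

/-- The indices in `I` of the ideals `J ≤ I` in the class `g`. -/
def indexSet (I : (FractionalIdeal (𝓞 F)⁰ F)ˣ) (g : ClassGroup (𝓞 F)) : Set ℕ :=
  {n | ∃ J : (FractionalIdeal (𝓞 F)⁰ F)ˣ,
    lattice J ≤ lattice I ∧ (lattice J).relIndex (lattice I) = n ∧ idealClass J = g}

theorem sigma_ext {L : AddSubgroup F} {p p' : Σ ρ : reflections F, InvariantSublattice L ρ.1}
    (h1 : p.1.1 = p'.1.1) (h2 : p.2.1 = p'.2.1) : p = p' := by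
  obtain ⟨⟨ρ, hρ⟩, K, hK⟩ := p
  obtain ⟨⟨ρ', hρ'⟩, K', hK'⟩ := p'
  cases h1; cases h2; rfl

end IndexSet

namespace ImagQuad

variable {F : Type*} [Field F] [NumberField F] (q : ImagQuad F) [Algebra.IsQuadraticExtension ℚ F]

/-- As I is a module over the ring of integers, containing the two generators is the same as
containing the ideal they generate. -/
theorem scale_shapeLat_le_iff {I : (FractionalIdeal (𝓞 F)⁰ F)ˣ} {α : Fˣ} {w : Shape} :
    scale α (q.shapeLat w) ≤ lattice I ↔ lattice (scaleIdeal α (q.shapeIdeal w)) ≤ lattice I := by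
  rw [shapeLat, scale_lat, lat_le_iff, lattice_le_iff, val_scaleIdeal, val_shapeIdeal,
    spanSingleton_mul_pair, pair_le_iff]
  rfl

theorem relIndex_scale_shapeLat {I : (FractionalIdeal (𝓞 F)⁰ F)ˣ} {α : Fˣ} {w : Shape}
    (h : scale α (q.shapeLat w) ≤ lattice I) :
    (scale α (q.shapeLat w)).relIndex (lattice I) =
      (q.shapeLat w).relIndex (lattice (q.shapeIdeal w)) *
        (lattice (scaleIdeal α (q.shapeIdeal w))).relIndex (lattice I) := by
  rw [← relIndex_scale α (q.shapeLat w) (lattice (q.shapeIdeal w)), ← lattice_scaleIdeal, AddSubgroup.relIndex_mul_relIndex]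
  · rw [lattice_scaleIdeal, scale_le_iff]
    intro k hk
    exact ⟨k, q.shapeLat_le w hk, rfl⟩
  · exact q.scale_shapeLat_le_iff.1 h

/-- Pairs of a multiplier `α` and a shape `w` such that `α` times the lattice of shape `w` lies in
`I`. -/
def ScaledShape (I : (FractionalIdeal (𝓞 F)⁰ F)ˣ) : Type _ :=
  {p : Fˣ × Shape // scale p.1 (q.shapeLat p.2) ≤ lattice I}

/-- The reflection and the invariant sublattice determined by a scaled shape. -/
def toInvariant (I : (FractionalIdeal (𝓞 F)⁰ F)ˣ) (p : q.ScaledShape I) :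
    Σ ρ : reflections F, InvariantSublattice (lattice I) ρ.1 :=
  ⟨⟨reflOf p.1.1, q.reflOf_mem p.1.1⟩, scale p.1.1 (q.shapeLat p.1.2), p.2, by
    rw [q.relIndex_scale_shapeLat p.2]
    exact mul_ne_zero (q.relIndex_shape_ne_zero _)
      (relIndex_lattice_ne_zero (q.scale_shapeLat_le_iff.1 p.2)),
    (q.image_reflOf_scale_eq_iff _ _).2 fun _ => q.conj_mem_shapeLat _⟩

/-- Writing ρ as the reflection of α, the lattice α⁻¹K is stable under conjugation and of finite
index in the ideal α⁻¹I, so it is a rational multiple of a shape lattice; that rational factor is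
absorbed into α without changing ρ. -/
theorem toInvariant_surjective (I : (FractionalIdeal (𝓞 F)⁰ F)ˣ) :
    Function.Surjective (q.toInvariant I) := by
  rintro ⟨⟨ρ, hρ⟩, K, hKI, hK0, hKρ⟩
  obtain ⟨α, rfl⟩ := q.exists_reflOf hρ
  have hK : K = scale α (scale α⁻¹ K) := by
    rw [scale_scale, mul_inv_cancel]
    ext z; simp [mem_scale_iff]
  have hL : lattice I = scale α (lattice (scaleIdeal α⁻¹ I)) := by
    rw [lattice_scaleIdeal, scale_scale, mul_inv_cancel]
    ext z; simp [mem_scale_iff]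
  simp only at hKρ
  rw [hK] at hKρ
  have hconj := (q.image_reflOf_scale_eq_iff _ _).1 hKρ
  obtain ⟨e, he, w, hw⟩ := q.exists_shape_of_relIndex (I := scaleIdeal α⁻¹ I) (K := scale α⁻¹ K)
    (by
      rw [lattice_scaleIdeal, scale_le_iff]
      exact fun k hk => ⟨k, hKI hk, rfl⟩)
    (by rw [lattice_scaleIdeal, relIndex_scale]; exact hK0) hconj
  have hKw : K = scale (α * ratUnit F e he) (q.shapeLat w) := by
    rw [← scale_scale, ← hw, ← hK]
  refine ⟨⟨(α * ratUnit F e he, w), hKw ▸ hKI⟩, sigma_ext ?_ hKw.symm⟩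
  exact (q.reflOf_eq_iff.2 ⟨e, he, mul_comm _ _⟩).symm

/-- The negative of a scaled shape. -/
def negScaled {I : (FractionalIdeal (𝓞 F)⁰ F)ˣ} (p : q.ScaledShape I) : q.ScaledShape I :=
  ⟨(-p.1.1, p.1.2), by
    have := p.2
    rw [scale_le_iff] at this ⊢
    intro k hk
    rw [Units.val_neg, neg_mul]
    exact neg_mem (this k hk)⟩

/-- Equal reflections make the multipliers differ by a rational e, and equal lattices then force e =
±1 and equal shapes. -/
theorem toInvariant_eq_iff {I : (FractionalIdeal (𝓞 F)⁰ F)ˣ} (p p' : q.ScaledShape I) :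
    q.toInvariant I p' = q.toInvariant I p ↔ p' = p ∨ p' = q.negScaled p := by
  constructor
  · intro h
    have h1 : reflOf p'.1.1 = reflOf p.1.1 := congrArg (fun x => x.1.1) h
    have h2 : scale p'.1.1 (q.shapeLat p'.1.2) = scale p.1.1 (q.shapeLat p.1.2) :=
      congrArg (fun x => x.2.1) h
    obtain ⟨e, he, he'⟩ := q.reflOf_eq_iff.1 h1
    have h3 : q.shapeLat p'.1.2 = scale (ratUnit F e he) (q.shapeLat p.1.2) := by
      have h4 : scale (p'.1.1)⁻¹ (scale p'.1.1 (q.shapeLat p'.1.2)) = q.shapeLat p'.1.2 := by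
        rw [scale_scale, inv_mul_cancel]; ext z; simp [mem_scale_iff]
      rw [← h4, h2, scale_scale, he', mul_comm, mul_inv_cancel_right]
    obtain ⟨h5, h6⟩ := q.shapeLat_eq_scale he h3
    rcases h5 with rfl | rfl
    · left
      refine Subtype.ext (Prod.ext (Units.ext ?_) h6.symm)
      rw [he']; simp
    · right
      refine Subtype.ext (Prod.ext (Units.ext ?_) h6.symm)
      simp only [negScaled, Units.val_neg]
      rw [he']; simp
  · rintro (rfl | rfl)
    · rfl
    · refine sigma_ext ?_ ?_
      · refine q.reflOf_eq_iff.2 ⟨-1, by norm_num, Units.ext ?_⟩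
        simp [negScaled]
      · change scale (-p.1.1) _ = scale p.1.1 _
        ext z
        rw [mem_scale_iff, mem_scale_iff, Units.val_neg, inv_neg, neg_mul, neg_mem_iff]
        rfl

theorem card_toInvariant_fiber {I : (FractionalIdeal (𝓞 F)⁰ F)ˣ}
    (x : Σ ρ : reflections F, InvariantSublattice (lattice I) ρ.1) :
    Nat.card {p // q.toInvariant I p = x} = 2 := by
  obtain ⟨p, rfl⟩ := q.toInvariant_surjective I x
  rw [Nat.card_eq_two_iff]
  refine ⟨⟨p, rfl⟩, ⟨q.negScaled p, (q.toInvariant_eq_iff _ _).2 (Or.inr rfl)⟩, ?_, ?_⟩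
  · intro h
    have h1 : (p.1.1 : F) = -p.1.1 := congrArg (fun x : {p' // _} => ((x.1.1.1 : Fˣ) : F)) h
    exact p.1.1.ne_zero (self_eq_neg.1 h1)
  · ext p'
    simp only [Set.mem_insert_iff, Set.mem_singleton_iff, Set.mem_univ, iff_true]
    rcases (q.toInvariant_eq_iff _ _).1 p'.2 with h | h
    · exact Or.inl (Subtype.ext h)
    · exact Or.inr (Subtype.ext h)

theorem image_rot_scale (α β : Fˣ) (K : AddSubgroup F) (h0 : (β : F) / α ≠ 0) :
    image (rot ((β : F) / α) h0) (scale α K) = scale β K := by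
  have hα := α.ne_zero
  ext z
  constructor
  · rintro ⟨_, ⟨k, hk, rfl⟩, rfl⟩
    refine ⟨k, hk, ?_⟩
    change (β : F) * k = β / α * (α * k)
    field_simp
  · rintro ⟨k, hk, rfl⟩
    refine ⟨_, ⟨k, hk, rfl⟩, ?_⟩
    change (β : F) / α * (α * k) = β * k
    field_simp

theorem image_refl_scale (q : ImagQuad F) (α β : Fˣ) {K : AddSubgroup F} (hK : ∀ z ∈ K, conj F z ∈ K)
    (h0 : (β : F) / conj F α ≠ 0) :
    image (refl ((β : F) / conj F α) h0) (scale α K) = scale β K := by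
  have hα : conj F (α : F) ≠ 0 := by simp
  have key (k : F) : (β : F) / conj F α * conj F (α * k) = β * conj F k := by
    rw [map_mul]; field_simp
  ext z
  constructor
  · rintro ⟨_, ⟨k, hk, rfl⟩, rfl⟩
    exact ⟨conj F k, hK k hk, (key k).symm⟩
  · rintro ⟨k, hk, rfl⟩
    refine ⟨_, ⟨conj F k, hK k hk, rfl⟩, (key _).trans ?_⟩
    rw [q.conj_conj]; rfl

/-- The multipliers `β` of the same norm as `α` with `β` times the lattice of shape `w` inside
`I`. -/
def Multiplier (I : (FractionalIdeal (𝓞 F)⁰ F)ˣ) (w : Shape) (α : Fˣ) : Type _ :=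
  {β : Fˣ // scale β (q.shapeLat w) ≤ lattice I ∧
    Algebra.norm ℚ (β : F) = Algebra.norm ℚ (α : F)}

theorem finite_multiplier (I : (FractionalIdeal (𝓞 F)⁰ F)ˣ) (w : Shape) (α : Fˣ) :
    Finite (q.Multiplier I w α) := by
  have hfin := q.finite_norm_eq (I : FractionalIdeal (𝓞 F)⁰ F)
    (Algebra.norm ℚ ((α : F) * w.1.1.1))
  have : Finite {z : F // z ∈ (I : FractionalIdeal (𝓞 F)⁰ F) ∧
    Algebra.norm ℚ z = Algebra.norm ℚ ((α : F) * w.1.1.1)} := hfin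
  -- A multiplier β is determined by βx, an element of I of prescribed norm, and there are only
  -- finitely many of those.
  refine Finite.of_injective (fun β : q.Multiplier I w α => (⟨(β.1 : F) * w.1.1.1,
    scale_le_iff.1 β.2.1 _ (left_mem_lat _ _), by rw [map_mul, map_mul, β.2.2]⟩ :
      {z : F // z ∈ (I : FractionalIdeal (𝓞 F)⁰ F) ∧
        Algebra.norm ℚ z = Algebra.norm ℚ ((α : F) * w.1.1.1)})) ?_
  intro β β' h
  have h1 : (β.1 : F) * w.1.1.1 = β'.1 * w.1.1.1 := congrArg Subtype.val h
  exact Subtype.ext (Units.ext (mul_right_cancel₀ (shape_gen_ne_zero w) h1))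

/-- Every isometry sends αΛ to some βΛ with N(β) = N(α), since Λ is stable under conjugation. Each β
arises from exactly one rotation, by β/α, and one reflection, with factor β/ᾱ. -/
theorem card_orthogonal (q : ImagQuad F) (I : (FractionalIdeal (𝓞 F)⁰ F)ˣ) (w : Shape) (α : Fˣ) :
    Nat.card {σ : F ≃ₗ[ℚ] F // σ ∈ orthogonalSet F ∧ image σ (scale α (q.shapeLat w)) ≤ lattice I} =
      2 * Nat.card (q.Multiplier I w α) := by
  have hα : conj F (α : F) ≠ 0 := by simp
  have hNα := Algebra.norm_ne_zero_iff (R := ℚ).2 α.ne_zero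
  have hn1 {β : Fˣ} (hβ : Algebra.norm ℚ (β : F) = Algebra.norm ℚ (α : F)) :
      Algebra.norm ℚ ((β : F) / α) = 1 := by
    apply mul_right_cancel₀ hNα
    rw [← map_mul, div_mul_cancel₀ _ α.ne_zero, hβ, one_mul]
  have hn2 {β : Fˣ} (hβ : Algebra.norm ℚ (β : F) = Algebra.norm ℚ (α : F)) :
      Algebra.norm ℚ ((β : F) / conj F α) = 1 := by
    apply mul_right_cancel₀ hNα
    nth_rewrite 1 [← q.norm_conj α]
    rw [← map_mul, div_mul_cancel₀ _ hα, hβ, one_mul]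
  have h1 (β : Fˣ) : (β : F) / α ≠ 0 := div_ne_zero β.ne_zero α.ne_zero
  have h2 (β : Fˣ) : (β : F) / conj F α ≠ 0 := div_ne_zero β.ne_zero hα
  rw [show 2 * Nat.card (q.Multiplier I w α) = Nat.card (Bool × q.Multiplier I w α) by
    rw [Nat.card_prod]; simp]
  symm
  let f : Bool × q.Multiplier I w α →
      {σ : F ≃ₗ[ℚ] F // σ ∈ orthogonalSet F ∧ image σ (scale α (q.shapeLat w)) ≤ lattice I} :=
    fun p => if p.1 then ⟨rot _ (h1 p.2.1), rot_mem (hn1 p.2.2.2) _, by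
        rw [image_rot_scale]; exact p.2.2.1⟩
      else ⟨refl _ (h2 p.2.1), q.refl_mem (hn2 p.2.2.2) _, by
        rw [q.image_refl_scale _ _ (fun _ => q.conj_mem_shapeLat w)]; exact p.2.2.1⟩
  have ft (p : q.Multiplier I w α) : (f (true, p)).1 = rot _ (h1 p.1) := rfl
  have ff (p : q.Multiplier I w α) : (f (false, p)).1 = refl _ (h2 p.1) := rfl
  have hne {u u' : F} (h0 : u ≠ 0) (h0' : u' ≠ 0) : rot u h0 ≠ refl u' h0' := by
    intro h
    have e1 := LinearEquiv.congr_fun h 1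
    have e2 := LinearEquiv.congr_fun h q.δ
    simp only [rot_apply, refl_apply, map_one, mul_one, q.conj_δ] at e1 e2
    subst e1
    have := mul_left_cancel₀ h0 e2
    exact q.δ_ne_zero (self_eq_neg.1 this)
  apply Nat.card_congr (Equiv.ofBijective f ⟨?_, ?_⟩)
  · rintro ⟨b, p⟩ ⟨b', p'⟩ h
    have h' := congrArg Subtype.val h
    cases b <;> cases b'
    · rw [ff, ff] at h'
      have := LinearEquiv.congr_fun h' 1
      simp only [refl_apply, map_one, mul_one] at this
      rw [Prod.mk.injEq]
      exact ⟨rfl, Subtype.ext (Units.ext ((div_left_inj' hα).1 this))⟩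
    · rw [ff, ft] at h'
      exact absurd h'.symm (hne _ _)
    · rw [ff, ft] at h'
      exact absurd h' (hne _ _)
    · rw [ft, ft] at h'
      have := LinearEquiv.congr_fun h' 1
      simp only [rot_apply, mul_one] at this
      rw [Prod.mk.injEq]
      exact ⟨rfl, Subtype.ext (Units.ext ((div_left_inj' α.ne_zero).1 this))⟩
  · rintro ⟨σ, hσ, hle⟩
    obtain ⟨u, h0, hu, rfl | rfl⟩ := q.eq_rot_or_refl hσ
    · obtain ⟨β, hβ, hN⟩ : ∃ β : Fˣ, (β : F) / α = u ∧
          Algebra.norm ℚ (β : F) = Algebra.norm ℚ (α : F) :=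
        ⟨Units.mk0 u h0 * α, by simp, by simp [hu]⟩
      subst hβ
      exact ⟨(true, ⟨β, by rw [← image_rot_scale α β _ (h1 β)]; exact hle, hN⟩), Subtype.ext (ft _)⟩
    · obtain ⟨β, hβ, hN⟩ : ∃ β : Fˣ, (β : F) / conj F α = u ∧
          Algebra.norm ℚ (β : F) = Algebra.norm ℚ (α : F) :=
        ⟨Units.mk0 (u * conj F α) (mul_ne_zero h0 hα), by
          rw [Units.val_mk0, mul_div_cancel_right₀ _ hα], by
          rw [Units.val_mk0, map_mul, hu, one_mul, q.norm_conj]⟩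
      subst hβ
      exact ⟨(false, ⟨β, by
        rw [← q.image_refl_scale α β (fun _ => q.conj_mem_shapeLat w) (h2 β)]; exact hle, hN⟩),
        Subtype.ext (ff _)⟩

/-- The shape of a scaled shape and the index of the ideal it generates. -/
def toShapeIndex (I : (FractionalIdeal (𝓞 F)⁰ F)ˣ) (p : q.ScaledShape I) :
    {z : Shape × ℕ // z.2 ∈ indexSet I (idealClass (q.shapeIdeal z.1))} :=
  ⟨(p.1.2, (lattice (scaleIdeal p.1.1 (q.shapeIdeal p.1.2))).relIndex (lattice I)),
    _, q.scale_shapeLat_le_iff.1 p.2, rfl, idealClass_scaleIdeal _ _⟩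

/-- For a fixed shape, equal index means equal norm of the multiplier, so the fibre is the set that
counts isometries. Its size cancels the denominator of the summand. -/
theorem card_toShapeIndex_fiber {I : (FractionalIdeal (𝓞 F)⁰ F)ˣ} (p : q.ScaledShape I) :
    Nat.card {p' // q.toShapeIndex I p' = q.toShapeIndex I p} =
      Nat.card (q.Multiplier I p.1.2 p.1.1) := by
  have hiff (β : Fˣ) (hβ : scale β (q.shapeLat p.1.2) ≤ lattice I) :=
    q.relIndex_scaleIdeal_eq_iff (q.scale_shapeLat_le_iff.1 hβ) (q.scale_shapeLat_le_iff.1 p.2)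
  refine (Nat.card_congr (Equiv.ofBijective (fun β : q.Multiplier I p.1.2 p.1.1 =>
    (⟨⟨(β.1, p.1.2), β.2.1⟩, Subtype.ext (Prod.ext rfl ((hiff _ β.2.1).2 β.2.2))⟩ :
      {p' // q.toShapeIndex I p' = q.toShapeIndex I p})) ⟨?_, ?_⟩)).symm
  · intro β β' h
    exact Subtype.ext (congrArg (fun x : {p' // _} => (x.1.1.1 : Fˣ)) h)
  · rintro ⟨⟨⟨β, w⟩, hβ⟩, h⟩
    have hw : w = p.1.2 := congrArg (fun x => x.1.1) h
    subst hw
    have h2 := congrArg (fun x => x.1.2) h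
    exact ⟨⟨β, hβ, (hiff _ hβ).1 h2⟩, rfl⟩

theorem toShapeIndex_surjective (I : (FractionalIdeal (𝓞 F)⁰ F)ˣ) :
    Function.Surjective (q.toShapeIndex I) := by
  rintro ⟨⟨w, n⟩, J, hJ, hn, hcl⟩
  obtain ⟨α, rfl⟩ := idealClass_eq_iff.1 hcl
  exact ⟨⟨(α, w), q.scale_shapeLat_le_iff.2 hJ⟩, Subtype.ext (Prod.ext rfl hn)⟩

/-- The double series of reflections as a series over shapes and indices. -/
theorem refl_summable_iff_and_tsum_eq (I : (FractionalIdeal (𝓞 F)⁰ F)ˣ) (s : ℂ) :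
    (ReflSummable (lattice I) s ↔
      Summable fun z : {z : Shape × ℕ // z.2 ∈ indexSet I (idealClass (q.shapeIdeal z.1))} =>
        (((q.shapeLat z.1.1).relIndex (lattice (q.shapeIdeal z.1.1)) * z.1.2 : ℕ) : ℂ) ^ (-s) / 4) ∧
    ∑' p : Σ ρ : reflections F, InvariantSublattice (lattice I) ρ.1, zTerm (lattice I) s p.2.1 =
      ∑' z : {z : Shape × ℕ // z.2 ∈ indexSet I (idealClass (q.shapeIdeal z.1))},
        (((q.shapeLat z.1.1).relIndex (lattice (q.shapeIdeal z.1.1)) * z.1.2 : ℕ) : ℂ) ^ (-s) / 4 := by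
  -- The 2 here is the sign of the multiplier; together with the 2 from rotations and reflections it
  -- produces the final factor 1/4.
  have h1 := summable_iff_and_tsum_eq_of_fibers (q.toInvariant I)
    (fun x => by rw [q.card_toInvariant_fiber]; norm_num)
    (f := fun p => zTerm (lattice I) s (q.toInvariant I p).2.1 / 2)
    (g := fun x => zTerm (lattice I) s x.2.1)
    (fun p => by rw [q.card_toInvariant_fiber]; norm_num)
  have h2 := summable_iff_and_tsum_eq_of_fibers (q.toShapeIndex I)
    (fun z => by
      obtain ⟨p, rfl⟩ := q.toShapeIndex_surjective I z
      rw [q.card_toShapeIndex_fiber]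
      have := q.finite_multiplier I p.1.2 p.1.1
      have : Nonempty (q.Multiplier I p.1.2 p.1.1) := ⟨⟨p.1.1, p.2, rfl⟩⟩
      exact Nat.card_pos.ne')
    (f := fun p => zTerm (lattice I) s (q.toInvariant I p).2.1 / 2)
    (g := fun z => (((q.shapeLat z.1.1).relIndex (lattice (q.shapeIdeal z.1.1)) * z.1.2 : ℕ) : ℂ) ^
      (-s) / 4)
    (fun p => by
      rw [q.card_toShapeIndex_fiber]
      change zTerm (lattice I) s (scale p.1.1 (q.shapeLat p.1.2)) / 2 = _
      rw [zTerm, q.card_orthogonal, q.relIndex_scale_shapeLat p.2]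
      change _ = (((q.shapeLat p.1.2).relIndex (lattice (q.shapeIdeal p.1.2)) *
        (lattice (scaleIdeal p.1.1 (q.shapeIdeal p.1.2))).relIndex (lattice I) : ℕ) : ℂ) ^ (-s) / 4 / _
      push_cast
      rw [div_div, div_div]
      congr 1
      ring)
  exact ⟨h1.1.symm.trans h2.1, h1.2.symm.trans h2.2⟩

end ImagQuad

end

section

/-! ### Sums over coprime pairs -/

/-- Coprime pairs of positive integers, the first prime to `A` and the second prime to `B`. -/
def coprimeSet (A B : ℕ) : Set (ℕ × ℕ) :=
  {p | 0 < p.1 ∧ 0 < p.2 ∧ p.1.Coprime p.2 ∧ p.1.Coprime A ∧ p.2.Coprime B}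

section

variable (χ : ℕ →*₀ ℂ)

/-- The sum of `χ(a) χ(b)` over `coprimeSet A B`. -/
def coprimeSum (A B : ℕ) : ℂ := ∑' p : coprimeSet A B, χ p.1.1 * χ p.1.2

theorem coprimeSum_comm (A B : ℕ) : coprimeSum χ A B = coprimeSum χ B A := by
  let e : coprimeSet A B ≃ coprimeSet B A :=
    { toFun := fun p => ⟨p.1.swap, p.2.2.1, p.2.1, p.2.2.2.1.symm, p.2.2.2.2.2, p.2.2.2.2.1⟩
      invFun := fun p => ⟨p.1.swap, p.2.2.1, p.2.1, p.2.2.2.1.symm, p.2.2.2.2.2, p.2.2.2.2.1⟩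
      left_inv := fun _ => rfl
      right_inv := fun _ => rfl }
  rw [coprimeSum, coprimeSum, ← e.tsum_eq]
  exact tsum_congr fun p => mul_comm _ _

variable {χ} (hχ : Summable fun n => ‖χ n‖)
include hχ

theorem summable_pairs : Summable fun p : ℕ × ℕ => χ p.1 * χ p.2 :=
  summable_mul_of_summable_norm hχ hχ

/-- The powers of n give a convergent geometric subseries. -/
theorem norm_lt_one {n : ℕ} (hn : 2 ≤ n) : ‖χ n‖ < 1 := by
  have h1 : Summable fun k : ℕ => ‖χ (n ^ k)‖ := hχ.comp_injective (Nat.pow_right_injective hn)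
  simp only [map_pow] at h1
  exact summable_geometric_iff_norm_lt_one.1 (summable_norm_iff.1 h1)

/-- The pairs are sorted by whether p divides the first entry; if it does, coprimality transfers the
condition at p to the second entry. -/
theorem coprimeSum_split_left {p A B : ℕ} (hp : p.Prime) (hA : ¬ p ∣ A) :
    coprimeSum χ A B = coprimeSum χ (p * A) B + χ p * coprimeSum χ A (p * B) := by
  have hs := summable_pairs hχ
  have hpA : p.Coprime A := (Nat.Prime.coprime_iff_not_dvd hp).2 hA
  let f : ℕ × ℕ → ℕ × ℕ := fun x => (p * x.1, x.2)
  have hf : Function.Injective f := by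
    rintro ⟨a, b⟩ ⟨a', b'⟩ h
    simp only [f, Prod.mk.injEq] at h
    exact Prod.ext (Nat.eq_of_mul_eq_mul_left hp.pos h.1) h.2
  have hdisj : Disjoint (coprimeSet (p * A) B) (f '' coprimeSet A (p * B)) := by
    rw [Set.disjoint_left]
    rintro _ ⟨-, -, -, h, -⟩ ⟨⟨a, b⟩, -, rfl⟩
    have h1 := (Nat.Coprime.coprime_mul_right_right h).coprime_mul_right
    exact hp.one_lt.ne' ((Nat.coprime_self p).1 h1)
  have hunion : coprimeSet A B = coprimeSet (p * A) B ∪ f '' coprimeSet A (p * B) := by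
    ext ⟨a, b⟩
    constructor
    · rintro ⟨ha, hb, hab, haA, hbB⟩
      by_cases h : p ∣ a
      · right
        obtain ⟨a, rfl⟩ := h
        refine ⟨(a, b), ⟨Nat.pos_of_mul_pos_left ha, hb, hab.coprime_mul_left,
          haA.coprime_mul_left, ?_⟩, rfl⟩
        exact Nat.Coprime.mul_right hab.coprime_mul_right.symm hbB
      · left
        exact ⟨ha, hb, hab, Nat.Coprime.mul_right ((Nat.Prime.coprime_iff_not_dvd hp).2 h).symm haA, hbB⟩
    · rintro (⟨ha, hb, hab, haA, hbB⟩ | ⟨⟨a, b⟩, ⟨ha, hb, hab, haA, hbB⟩, h⟩)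
      · exact ⟨ha, hb, hab, haA.coprime_mul_left_right, hbB⟩
      · rw [← h]
        exact ⟨Nat.mul_pos hp.pos ha, hb, Nat.Coprime.mul_left hbB.coprime_mul_right_right.symm hab,
          Nat.Coprime.mul_left hpA haA, hbB.coprime_mul_left_right⟩
  rw [coprimeSum, hunion, Summable.tsum_union_disjoint hdisj (hs.subtype _) (hs.subtype _),
    tsum_image (fun x : ℕ × ℕ => χ x.1 * χ x.2) hf.injOn, coprimeSum, coprimeSum, ← tsum_mul_left]
  congr 1
  refine tsum_congr fun x => ?_
  simp only [f, map_mul]; ring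

/-- Once the first entry is prime to p, the second may be divided by p without changing any
condition, so the sum reproduces itself. -/
theorem coprimeSum_split_right {p A B : ℕ} (hp : p.Prime) (hB : ¬ p ∣ B) :
    coprimeSum χ (p * A) B = coprimeSum χ (p * A) (p * B) + χ p * coprimeSum χ (p * A) B := by
  have hs := summable_pairs hχ
  have hpB : p.Coprime B := (Nat.Prime.coprime_iff_not_dvd hp).2 hB
  let f : ℕ × ℕ → ℕ × ℕ := fun x => (x.1, p * x.2)
  have hf : Function.Injective f := by
    rintro ⟨a, b⟩ ⟨a', b'⟩ h
    simp only [f, Prod.mk.injEq] at h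
    exact Prod.ext h.1 (Nat.eq_of_mul_eq_mul_left hp.pos h.2)
  have hdisj : Disjoint (coprimeSet (p * A) (p * B)) (f '' coprimeSet (p * A) B) := by
    rw [Set.disjoint_left]
    rintro _ ⟨-, -, -, -, h⟩ ⟨⟨a, b⟩, -, rfl⟩
    have h1 := (Nat.Coprime.coprime_mul_right_right h).coprime_mul_right
    exact hp.one_lt.ne' ((Nat.coprime_self p).1 h1)
  have hunion : coprimeSet (p * A) B = coprimeSet (p * A) (p * B) ∪ f '' coprimeSet (p * A) B := by
    ext ⟨a, b⟩
    constructor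
    · rintro ⟨ha, hb, hab, haA, hbB⟩
      by_cases h : p ∣ b
      · right
        obtain ⟨b, rfl⟩ := h
        exact ⟨(a, b), ⟨ha, Nat.pos_of_mul_pos_left hb, hab.coprime_mul_left_right,
          haA, hbB.coprime_mul_left⟩, rfl⟩
      · left
        exact ⟨ha, hb, hab, haA, Nat.Coprime.mul_right ((Nat.Prime.coprime_iff_not_dvd hp).2 h).symm hbB⟩
    · rintro (⟨ha, hb, hab, haA, hbB⟩ | ⟨⟨a, b⟩, ⟨ha, hb, hab, haA, hbB⟩, h⟩)
      · exact ⟨ha, hb, hab, haA, hbB.coprime_mul_left_right⟩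
      · rw [← h]
        exact ⟨ha, Nat.mul_pos hp.pos hb, Nat.Coprime.mul_right haA.coprime_mul_right_right hab,
          haA, Nat.Coprime.mul_left hpB hbB⟩
  conv_lhs => rw [coprimeSum, hunion]
  rw [Summable.tsum_union_disjoint hdisj (hs.subtype _) (hs.subtype _),
    tsum_image (fun x : ℕ × ℕ => χ x.1 * χ x.2) hf.injOn, coprimeSum, coprimeSum, ← tsum_mul_left]
  congr 1
  refine tsum_congr fun x => ?_
  simp only [f, map_mul]; ring

theorem coprimeSum_both {p A B : ℕ} (hp : p.Prime) (hB : ¬ p ∣ B) :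
    coprimeSum χ (p * A) (p * B) = (1 - χ p) * coprimeSum χ (p * A) B := by
  linear_combination -coprimeSum_split_right hχ (A := A) hp hB

/-- By `coprimeSum_both` and symmetry the sums for (pA, B) and (A, pB) agree, after cancelling 1 -
χ(p) ≠ 0; the splitting of the first entry then collapses. In particular it does not matter on which
side p is excluded. -/
theorem coprimeSum_eq_mul {p A B : ℕ} (hp : p.Prime) (hA : ¬ p ∣ A) (hB : ¬ p ∣ B) :
    coprimeSum χ A B = (1 + χ p) * coprimeSum χ (p * A) B := by
  have h1 := coprimeSum_both hχ (A := A) hp hB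
  have h2 := coprimeSum_both hχ (A := B) hp hA
  rw [coprimeSum_comm, h1, coprimeSum_comm χ (p * B)] at h2
  have hne : 1 - χ p ≠ 0 := by
    intro h
    have := norm_lt_one hχ hp.two_le
    rw [← sub_eq_zero.1 h] at this
    simp at this
  have h3 := mul_left_cancel₀ hne h2
  rw [coprimeSum_split_left hχ (B := B) hp hA, ← h3]
  ring

theorem one_add_ne_zero {n : ℕ} (hn : 2 ≤ n) : 1 + χ n ≠ 0 := by
  intro h
  have := norm_lt_one hχ hn
  rw [← neg_eq_of_add_eq_zero_right h] at this
  simp at this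

theorem coprimeSum_odd {A B : ℕ} (hA : Odd A) (hB : Odd B) :
    (1 + χ 2) * coprimeSum χ (2 * A) (2 * B) = (1 - χ 2) * coprimeSum χ A B := by
  rw [coprimeSum_eq_mul hχ Nat.prime_two hA.not_two_dvd_nat hB.not_two_dvd_nat,
    coprimeSum_both hχ Nat.prime_two hB.not_two_dvd_nat]
  ring

/-- The primes are removed one at a time, first from A and then, by symmetry, from B. The value
depends on the product AB alone, which makes the sum for t | d independent of t. -/
theorem coprimeSum_mul_prod {A : ℕ} : ∀ {B : ℕ}, Squarefree (A * B) →
    coprimeSum χ A B * ∏ p ∈ (A * B).primeFactors, (1 + χ p) = coprimeSum χ 1 1 := by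
  have step (B : ℕ) : ∀ A : ℕ, Squarefree (A * B) →
      coprimeSum χ A B * ∏ p ∈ (A * B).primeFactors, (1 + χ p) =
        coprimeSum χ 1 B * ∏ p ∈ B.primeFactors, (1 + χ p) := by
    intro A
    induction A using induction_on_primes with
    | zero => intro h; simp at h
    | one => intro _; rw [one_mul]
    | prime_mul p A hp ih =>
      intro h
      rw [mul_assoc] at h
      have hnd : ¬ p ∣ A * B := fun hd => by
        have := h p (mul_dvd_mul_left p hd)
        exact hp.one_lt.ne' (Nat.isUnit_iff.1 this)
      have hAB := h.of_mul_right
      rw [← ih hAB, mul_assoc p, Nat.primeFactors_mul hp.ne_zero hAB.ne_zero, hp.primeFactors,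
        Finset.singleton_union, Finset.prod_insert (fun hm => hnd (Nat.dvd_of_mem_primeFactors hm)),
        coprimeSum_eq_mul hχ (A := A) hp (fun hd => hnd (dvd_mul_of_dvd_left hd B))
          (fun hd => hnd (dvd_mul_of_dvd_right hd A))]
      ring
  intro B h
  rw [step B A h, coprimeSum_comm]
  have := step 1 B (by rw [mul_one]; exact h.of_mul_right)
  simpa using this

/-- Each pair of positive integers is uniquely its gcd times a coprime pair; for χ(n) = n^{-s} this
gives ζ(s)²/ζ(2s). -/
theorem coprimeSum_one_one : coprimeSum χ 1 1 * ∑' n, χ (n ^ 2) = (∑' n, χ n) ^ 2 := by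
  have hs := summable_pairs hχ
  have hsq : Summable fun n => ‖χ (n ^ 2)‖ :=
    hχ.comp_injective (Nat.pow_left_injective two_ne_zero)
  have hs1 : Summable fun p : coprimeSet 1 1 => ‖χ p.1.1 * χ p.1.2‖ := hs.norm.subtype _
  rw [pow_two, tsum_mul_tsum_of_summable_norm hχ hχ, coprimeSum, mul_comm,
    tsum_mul_tsum_of_summable_norm hsq hs1]
  let f : {n : ℕ // 0 < n} × coprimeSet 1 1 → ℕ × ℕ := fun x => (x.1 * x.2.1.1, x.1 * x.2.1.2)
  let i : {n : ℕ // 0 < n} × coprimeSet 1 1 → ℕ × coprimeSet 1 1 := fun x => (x.1.1, x.2)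
  have hi : Function.Injective i := fun x y h =>
    Prod.ext (Subtype.ext (Prod.ext_iff.1 h).1) (Prod.ext_iff.1 h).2
  have hf : Function.Injective f := by
    rintro ⟨⟨g, hg⟩, ⟨⟨a, b⟩, ha, hb, hab, _⟩⟩ ⟨⟨g', hg'⟩, ⟨⟨a', b'⟩, ha', hb', hab', _⟩⟩ h
    simp only [f, Prod.mk.injEq] at h
    have h1 : g = g' := by
      have e1 : (g * a).gcd (g * b) = g := by rw [Nat.gcd_mul_left, hab.gcd_eq_one, mul_one]
      have e2 : (g' * a').gcd (g' * b') = g' := by rw [Nat.gcd_mul_left, hab'.gcd_eq_one, mul_one]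
      rw [← e1, ← e2, h.1, h.2]
    subst h1
    have h2 := Nat.eq_of_mul_eq_mul_left hg h.1
    have h3 := Nat.eq_of_mul_eq_mul_left hg h.2
    subst h2 h3
    rfl
  rw [← hf.tsum_eq (f := fun p : ℕ × ℕ => χ p.1 * χ p.2),
    ← hi.tsum_eq (f := fun x : ℕ × coprimeSet 1 1 => χ (x.1 ^ 2) * (χ x.2.1.1 * χ x.2.1.2))]
  · refine tsum_congr fun x => ?_
    simp only [f, i, map_mul, map_pow]; ring
  · rintro ⟨n, p⟩ hn
    have hn0 : n ≠ 0 := by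
      rintro rfl
      simp at hn
    exact ⟨(⟨n, Nat.pos_of_ne_zero hn0⟩, p), rfl⟩
  · rintro ⟨a, b⟩ hab
    have ha : 0 < a := Nat.pos_of_ne_zero (by rintro rfl; simp at hab)
    have hb : 0 < b := Nat.pos_of_ne_zero (by rintro rfl; simp at hab)
    have hg := Nat.gcd_pos_of_pos_left b ha
    refine ⟨(⟨a.gcd b, hg⟩, ⟨(a / a.gcd b, b / a.gcd b), ?_, ?_, ?_, ?_, ?_⟩), ?_⟩
    · exact Nat.div_pos (Nat.le_of_dvd ha (Nat.gcd_dvd_left a b)) hg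
    · exact Nat.div_pos (Nat.le_of_dvd hb (Nat.gcd_dvd_right a b)) hg
    · exact Nat.coprime_div_gcd_div_gcd hg
    · exact Nat.coprime_one_right _
    · exact Nat.coprime_one_right _
    · exact Prod.ext (Nat.mul_div_cancel' (Nat.gcd_dvd_left a b))
        (Nat.mul_div_cancel' (Nat.gcd_dvd_right a b))

end

end

section

/-! ### Coprime pairs sorted by the gcd of the first entry with `D` -/

/-- The coprime pair `(t a, y)`. -/
def ofGcd {D : ℕ} (z : Σ t : D.divisors, coprimeSet (D / t) t) : CoprimePair :=
  ⟨(z.1 * z.2.1.1, z.2.1.2), Nat.mul_pos (Nat.pos_of_mem_divisors z.1.2) z.2.2.1, z.2.2.2.1,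
    by
      obtain ⟨t, ⟨⟨a, y⟩, ha, hy, hay, hA, hB⟩⟩ := z
      exact Nat.Coprime.mul_left (Nat.Coprime.symm hB) hay⟩

theorem gcd_ofGcd {D : ℕ} (z : Σ t : D.divisors, coprimeSet (D / t) t) :
    (ofGcd z).1.1.gcd D = z.1 := by
  obtain ⟨⟨t, ht⟩, ⟨⟨a, y⟩, ha, hy, hay, hA, hB⟩⟩ := z
  obtain ⟨k, rfl⟩ := Nat.dvd_of_mem_divisors ht
  have ht0 := Nat.pos_of_mem_divisors ht
  rw [Nat.mul_div_cancel_left _ ht0] at hA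
  change (t * a).gcd (t * k) = t
  rw [Nat.gcd_mul_left, hA.gcd_eq_one, mul_one]

theorem ofGcd_bijective {D : ℕ} (hD : 0 < D) : Function.Bijective (ofGcd (D := D)) := by
  constructor
  · intro z z' h
    have h1 : z.1 = z'.1 := Subtype.ext (by rw [← gcd_ofGcd z, ← gcd_ofGcd z', h])
    obtain ⟨t, ⟨⟨a, y⟩, hp⟩⟩ := z
    obtain ⟨t', ⟨⟨a', y'⟩, hp'⟩⟩ := z'
    simp only at h1
    subst h1
    have h2 : t.1 * a = t.1 * a' := congrArg (fun p : CoprimePair => p.1.1) h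
    have h3 : y = y' := congrArg (fun p : CoprimePair => p.1.2) h
    have h4 := Nat.eq_of_mul_eq_mul_left (Nat.pos_of_mem_divisors t.2) h2
    subst h3 h4
    rfl
  · rintro ⟨⟨x, y⟩, hx, hy, hxy⟩
    have hg : 0 < x.gcd D := Nat.gcd_pos_of_pos_left D hx
    have hdvd : x.gcd D ∣ x := Nat.gcd_dvd_left x D
    refine ⟨⟨⟨x.gcd D, Nat.mem_divisors.2 ⟨Nat.gcd_dvd_right x D, hD.ne'⟩⟩,
      ⟨(x / x.gcd D, y), Nat.div_pos (Nat.le_of_dvd hx hdvd) hg, hy, ?_, ?_, ?_⟩⟩, ?_⟩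
    · exact Nat.Coprime.coprime_dvd_left (Nat.div_dvd_of_dvd hdvd) hxy
    · exact Nat.coprime_div_gcd_div_gcd hg
    · exact (Nat.Coprime.coprime_dvd_left hdvd hxy).symm
    · exact Subtype.ext (Prod.ext (Nat.mul_div_cancel' hdvd) rfl)

/-- The equivalence given by `ofGcd`. -/
def gcdEquiv {D : ℕ} (hD : 0 < D) : (Σ t : D.divisors, coprimeSet (D / t) t) ≃ CoprimePair :=
  Equiv.ofBijective _ (ofGcd_bijective hD)

section

variable {χ : ℕ →*₀ ℂ} (hχ : Summable fun n => ‖χ n‖)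
include hχ

theorem summable_coprimePair {D : ℕ} (hD : 0 < D) :
    Summable fun p : CoprimePair => ‖χ (p.1.1 / p.1.1.gcd D) * χ p.1.2‖ := by
  rw [← (gcdEquiv hD).summable_iff]
  refine (summable_sigma_of_nonneg fun _ => norm_nonneg _).2 ⟨fun t => ?_, Summable.of_finite⟩
  have h : Summable fun p : coprimeSet (D / t) t => ‖χ p.1.1 * χ p.1.2‖ :=
    (summable_pairs hχ).norm.subtype _
  refine h.congr fun p => ?_
  change _ = ‖χ ((ofGcd ⟨t, p⟩).1.1 / (ofGcd ⟨t, p⟩).1.1.gcd D) * χ p.1.2‖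
  rw [gcd_ofGcd]
  change _ = ‖χ (t * p.1.1 / t) * χ p.1.2‖
  rw [Nat.mul_div_cancel_left _ (Nat.pos_of_mem_divisors t.2)]

theorem summable_indicator (S : Set ℕ) : Summable fun n => ‖S.indicator χ n‖ := by
  have : (fun n => ‖S.indicator χ n‖) = S.indicator (fun n => ‖χ n‖) := by
    ext n; rw [norm_indicator_eq_indicator_norm]
  rw [this]
  exact hχ.indicator S

end

/-- The Dirichlet series of `indexSet I g`. -/
def indexSeries {F : Type*} [Field F] [NumberField F] (χ : ℕ →*₀ ℂ)
    (I : (FractionalIdeal (𝓞 F)⁰ F)ˣ) (g : ClassGroup (𝓞 F)) : ℂ :=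
  ∑' n, (indexSet I g).indicator χ n

/-! ### The sum over shapes as a sum over the divisors of d. -/

namespace ImagQuad

variable {F : Type*} [Field F] [NumberField F] (q : ImagQuad F) [Algebra.IsQuadraticExtension ℚ F]

/-- The index of a rectangular shape up to `x y / gcd(x, d)`. -/
def κ : ℕ := if q.d % 4 = 1 then 2 else 1

section

variable {χ : ℕ →*₀ ℂ} (hχ : Summable fun n => ‖χ n‖)
include hχ

theorem indexFactor_pos (w : Shape) : 0 < q.indexFactor w := by
  rw [indexFactor]; split_ifs <;> simp

theorem summable_shape : Summable fun w : Shape =>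
    ‖χ ((q.shapeLat w).relIndex (lattice (q.shapeIdeal w)))‖ := by
  have h1 := (summable_coprimePair hχ q.D_pos).mul_of_nonneg
    (g := fun _ : Bool => (1 : ℝ)) Summable.of_finite (fun _ => _root_.norm_nonneg _)
    (fun _ => zero_le_one)
  refine h1.of_nonneg_of_le (fun _ => _root_.norm_nonneg _) fun w => ?_
  rw [q.relIndex_shape, map_mul, map_mul, norm_mul, mul_one]
  -- The factor 1, 2 or 4 in the index has |χ| ≤ 1, so the sum over coprime pairs dominates.
  refine mul_le_of_le_one_left (_root_.norm_nonneg _) ?_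
  rcases (Nat.succ_le_of_lt (q.indexFactor_pos hχ w)).eq_or_lt with h | h
  · rw [← h]; simp
  · exact (norm_lt_one hχ h).le

theorem hasSum_shape_index (I : (FractionalIdeal (𝓞 F)⁰ F)ˣ) :
    HasSum (fun z : {z : Shape × ℕ // z.2 ∈ indexSet I (idealClass (q.shapeIdeal z.1))} =>
        χ ((q.shapeLat z.1.1).relIndex (lattice (q.shapeIdeal z.1.1)) * z.1.2))
      (∑' w : Shape, χ ((q.shapeLat w).relIndex (lattice (q.shapeIdeal w))) *
        indexSeries χ I (idealClass (q.shapeIdeal w))) := by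
  let S : Set (Shape × ℕ) := {z | z.2 ∈ indexSet I (idealClass (q.shapeIdeal z.1))}
  let f : Shape × ℕ → ℂ := fun z =>
    χ ((q.shapeLat z.1).relIndex (lattice (q.shapeIdeal z.1))) *
      (indexSet I (idealClass (q.shapeIdeal z.1))).indicator χ z.2
  have hfS : S.indicator (fun z => χ ((q.shapeLat z.1).relIndex (lattice (q.shapeIdeal z.1)) * z.2)) = f := by
    ext z
    by_cases hz : z ∈ S
    · have hz' : z.2 ∈ indexSet I (idealClass (q.shapeIdeal z.1)) := hz
      rw [Set.indicator_of_mem hz]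
      simp only [f]
      rw [Set.indicator_of_mem hz', map_mul]
    · have hz' : z.2 ∉ indexSet I (idealClass (q.shapeIdeal z.1)) := hz
      rw [Set.indicator_of_notMem hz]
      simp only [f]
      rw [Set.indicator_of_notMem hz', mul_zero]
  have hf : Summable f := by
    have h1 := (q.summable_shape hχ).mul_of_nonneg hχ (fun _ => _root_.norm_nonneg _) (fun _ => _root_.norm_nonneg _)
    refine Summable.of_norm_bounded h1 fun z => ?_
    rw [norm_mul]
    refine mul_le_mul_of_nonneg_left ?_ (_root_.norm_nonneg _)
    exact norm_indicator_le_norm_self _ _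
  have h2 : HasSum f (∑' w : Shape, χ ((q.shapeLat w).relIndex (lattice (q.shapeIdeal w))) *
        indexSeries χ I (idealClass (q.shapeIdeal w))) := by
    have := hf.hasSum
    rw [hf.tsum_prod] at this
    simpa only [f, tsum_mul_left, indexSeries] using this
  rw [← hfS] at h2
  exact (hasSum_subtype_iff_indicator (s := S)).2 h2

theorem norm_indexSeries_le (I : (FractionalIdeal (𝓞 F)⁰ F)ˣ) (g : ClassGroup (𝓞 F)) :
    ‖indexSeries χ I g‖ ≤ ∑' n, ‖χ n‖ := by
  refine (norm_tsum_le_tsum_norm (summable_indicator hχ _)).trans ?_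
  exact Summable.tsum_le_tsum (fun n => norm_indicator_le_norm_self _ _) (summable_indicator hχ _) hχ

/-- Since t is odd, oddness of ta and y amounts to adding 2 to both coprimality conditions. -/
theorem tsum_oddPart {t : ℕ} (ht : t ∈ q.D.divisors) (h : q.d % 4 ≠ 2) :
    ∑' p : coprimeSet (q.D / t) t,
      (if q.d % 4 ≠ 2 ∧ Odd (t * p.1.1) ∧ Odd p.1.2 then χ p.1.1 * χ p.1.2 else 0) =
      coprimeSum χ (2 * (q.D / t)) (2 * t) := by
  have hto := q.odd_of_dvd_D h (Nat.dvd_of_mem_divisors ht)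
  rw [coprimeSum, tsum_subtype (coprimeSet (2 * (q.D / t)) (2 * t)) (fun p => χ p.1 * χ p.2),
    tsum_subtype (coprimeSet (q.D / t) t) (fun p => if q.d % 4 ≠ 2 ∧ Odd (t * p.1) ∧ Odd p.2 then
      χ p.1 * χ p.2 else 0)]
  refine tsum_congr fun p => ?_
  have hiff : p ∈ coprimeSet (2 * (q.D / t)) (2 * t) ↔ p ∈ coprimeSet (q.D / t) t ∧
      (q.d % 4 ≠ 2 ∧ Odd (t * p.1) ∧ Odd p.2) := by
    simp only [coprimeSet, Set.mem_ofPred_eq, Nat.coprime_mul_iff_right, Nat.odd_mul, hto,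
      Nat.coprime_two_right]
    tauto
  by_cases h1 : p ∈ coprimeSet (2 * (q.D / t)) (2 * t)
  · rw [Set.indicator_of_mem h1, Set.indicator_of_mem (hiff.1 h1).1, if_pos (hiff.1 h1).2]
  · classical
    rw [Set.indicator_of_notMem h1, Set.indicator_apply]
    split_ifs with h2 h3
    · exact absurd (hiff.2 ⟨h2, h3⟩) h1
    · rfl
    · rfl

/-- The first summand treats every shape as generic, with factor κ for rectangular and 2κ for
rhombic shapes. The second corrects the odd rhombic shapes, whose factor is 1 and whose class is
shifted by `half` when d ≡ 3 (mod 4). -/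
theorem tsum_shape (I : (FractionalIdeal (𝓞 F)⁰ F)ˣ) :
    ∑' w : Shape, χ ((q.shapeLat w).relIndex (lattice (q.shapeIdeal w))) *
        indexSeries χ I (idealClass (q.shapeIdeal w)) =
      ∑ t ∈ q.D.divisors, ((χ q.κ + χ (2 * q.κ)) * indexSeries χ I (idealClass (q.γ t)) *
          coprimeSum χ (q.D / t) t +
        ((if q.d % 4 = 3 then indexSeries χ I (idealClass q.half * idealClass (q.γ t)) else
            indexSeries χ I (idealClass (q.γ t))) -
          χ (2 * q.κ) * indexSeries χ I (idealClass (q.γ t))) *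
          (if q.d % 4 = 2 then 0 else coprimeSum χ (2 * (q.D / t)) (2 * t))) := by
  set term : Shape → ℂ := fun w => χ ((q.shapeLat w).relIndex (lattice (q.shapeIdeal w))) *
    indexSeries χ I (idealClass (q.shapeIdeal w)) with hterm
  have hs : Summable term := by
    refine Summable.of_norm_bounded ((q.summable_shape hχ).mul_right (∑' n, ‖χ n‖)) fun w => ?_
    rw [hterm, norm_mul]
    exact mul_le_mul_of_nonneg_left (norm_indexSeries_le hχ I _) (_root_.norm_nonneg _)
  have hval (t : q.D.divisors) (p : coprimeSet (q.D / t) t) :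
      ∑' b, term (ofGcd ⟨t, p⟩, b) =
        (χ q.κ + χ (2 * q.κ)) * indexSeries χ I (idealClass (q.γ t)) * (χ p.1.1 * χ p.1.2) +
        ((if q.d % 4 = 3 then indexSeries χ I (idealClass q.half * idealClass (q.γ t)) else
            indexSeries χ I (idealClass (q.γ t))) -
          χ (2 * q.κ) * indexSeries χ I (idealClass (q.γ t))) *
          (if q.d % 4 ≠ 2 ∧ Odd (t * p.1.1) ∧ Odd p.1.2 then χ p.1.1 * χ p.1.2 else 0) := by
    have hg := gcd_ofGcd ⟨t, p⟩
    have hx : (ofGcd ⟨t, p⟩).1.1 = t * p.1.1 := rfl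
    have hy : (ofGcd ⟨t, p⟩).1.2 = p.1.2 := rfl
    have hdiv : (ofGcd ⟨t, p⟩).1.1 / t.1 = p.1.1 := by
      rw [hx, Nat.mul_div_cancel_left _ (Nat.pos_of_mem_divisors t.2)]
    rw [tsum_fintype, Fintype.sum_bool]
    simp only [hterm, q.relIndex_shape, q.idealClass_shapeIdeal, hg, hdiv, hy, indexFactor,
      map_mul, κ, Bool.false_eq_true, if_false, false_and, true_and, if_true]
    rw [hx]
    by_cases hodd : q.d % 4 ≠ 2 ∧ Odd (t.1 * p.1.1) ∧ Odd p.1.2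
    · rw [if_pos hodd, if_pos hodd]
      by_cases h3 : q.d % 4 = 3
      · rw [if_pos ⟨h3, hodd.2⟩, if_pos h3, map_one]; ring
      · rw [if_neg (fun h => h3 h.1), if_neg h3, map_one]; ring
    · have hc : ¬(q.d % 4 = 3 ∧ Odd (t.1 * p.1.1) ∧ Odd p.1.2) := fun h => hodd ⟨by omega, h.2⟩
      rw [if_neg hodd, if_neg hodd, if_neg hc, map_mul]; ring
  have hpairs (t : q.D.divisors) : Summable fun p : coprimeSet (q.D / t) t => χ p.1.1 * χ p.1.2 :=
    (summable_pairs hχ).subtype _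
  have hodds (t : q.D.divisors) : Summable fun p : coprimeSet (q.D / t) t =>
      if q.d % 4 ≠ 2 ∧ Odd (t.1 * p.1.1) ∧ Odd p.1.2 then χ p.1.1 * χ p.1.2 else 0 := by
    refine Summable.of_norm_bounded (hpairs t).norm fun p => ?_
    split_ifs
    · exact le_rfl
    · rw [norm_zero]; exact _root_.norm_nonneg _
  have hs1 : Summable fun p : CoprimePair => ∑' b, term (p, b) := hs.prod
  have hs2 := (gcdEquiv q.D_pos).summable_iff.2 hs1
  rw [hs.tsum_prod, ← (gcdEquiv q.D_pos).tsum_eq]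
  change ∑' z, ((fun p : CoprimePair => ∑' b, term (p, b)) ∘ gcdEquiv q.D_pos) z = _
  rw [hs2.tsum_sigma, tsum_fintype, ← Finset.sum_coe_sort q.D.divisors]
  refine Finset.sum_congr rfl fun t _ => ?_
  have : ∀ p : coprimeSet (q.D / t) t, ((fun p : CoprimePair => ∑' b, term (p, b)) ∘
    gcdEquiv q.D_pos) ⟨t, p⟩ = _ := hval t
  simp only [this]
  rw [Summable.tsum_add ((hpairs t).mul_left _) ((hodds t).mul_left _), tsum_mul_left, tsum_mul_left]
  congr 2
  split_ifs with h2
  · simp [h2]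
  · exact q.tsum_oddPart hχ t.2 h2

end

end ImagQuad

end

section

/-- A prime dividing only one of two squarefree numbers would divide their product exactly once. -/
theorem Nat.eq_of_squarefree_of_isSquare_mul {a b : ℕ} (ha : Squarefree a) (hb : Squarefree b)
    (h : IsSquare (a * b)) : a = b := by
  have key {a b : ℕ} (ha : Squarefree a) (h : IsSquare (a * b)) {p : ℕ} (hp : p.Prime)
      (hpa : p ∣ a) : p ∣ b := by
    obtain ⟨c, hc⟩ := h
    have h1 : p ∣ c := by
      have : p ∣ c * c := hc ▸ hpa.mul_right b
      exact (hp.dvd_mul.1 this).elim id id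
    by_contra hpb
    have h2 : p * p ∣ a * b := hc ▸ mul_dvd_mul h1 h1
    have h3 : (p * p).Coprime b := by
      have := (hp.coprime_iff_not_dvd).2 hpb
      exact this.mul_left this
    have := ha p (h3.dvd_of_dvd_mul_right h2)
    exact hp.one_lt.ne' (Nat.isUnit_iff.1 this)
  rw [← Nat.prod_primeFactors_of_squarefree ha, ← Nat.prod_primeFactors_of_squarefree hb]
  congr 1
  ext p
  rw [Nat.mem_primeFactors_of_ne_zero ha.ne_zero, Nat.mem_primeFactors_of_ne_zero hb.ne_zero]
  exact ⟨fun h' => ⟨h'.1, key ha h h'.1 h'.2⟩, fun h' => ⟨h'.1, key hb (mul_comm a b ▸ h) h'.1 h'.2⟩⟩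

namespace ImagQuad

variable {F : Type*} [Field F] [NumberField F] (q : ImagQuad F) [Algebra.IsQuadraticExtension ℚ F]

theorem squarefree_D : Squarefree q.D := Int.squarefree_natAbs.2 q.sqf

theorem D_ne_one : q.D ≠ 1 := by
  have h1 := q.neg; have h2 := q.ne_neg_one; rw [D]; omega

theorem coprime_cofactor {t k : ℕ} (h : q.D = t * k) : t.Coprime k :=
  Nat.coprime_of_squarefree_mul (h ▸ q.squarefree_D)

/-! ### Products of the ideals `γ t` and `half` -/

theorem mem_spanSingleton_of_isIntegral {a r z : F} (hr : IsIntegral ℤ r) (h : z = r * a) :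
    z ∈ FractionalIdeal.spanSingleton (𝓞 F)⁰ a :=
  h ▸ isIntegral_mul_mem hr (FractionalIdeal.mem_spanSingleton_self _ _)

/-- The square contains t² and δ² = -tk, and t is coprime to k because d is squarefree, so Bézout
gives t itself. -/
theorem γ_mul_self {t : ℕ} (ht : t ∣ q.D) :
    ((q.γ t * q.γ t : (FractionalIdeal (𝓞 F)⁰ F)ˣ) : FractionalIdeal (𝓞 F)⁰ F) =
      FractionalIdeal.spanSingleton _ (t : F) := by
  obtain ⟨k, hk⟩ := ht
  have hd : q.δ * q.δ = -(t * k : F) := by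
    rw [q.δ_mul_δ, q.d_eq_F, hk]; push_cast; ring
  rw [Units.val_mul, val_γ]
  apply le_antisymm
  · refine pair_mul_pair_le.2 ⟨?_, ?_, ?_, ?_⟩
    · exact mem_spanSingleton_of_isIntegral (isIntegral_intCast t) (by push_cast; ring)
    · exact mem_spanSingleton_of_isIntegral q.isIntegral_δ (by ring)
    · exact mem_spanSingleton_of_isIntegral q.isIntegral_δ (by ring)
    · exact mem_spanSingleton_of_isIntegral (isIntegral_intCast (-k)) (by push_cast; rw [hd]; ring)
  · obtain ⟨h1, -, -, h4⟩ := pair_mul_pair_le.1 (le_refl (pair (t : F) q.δ * pair (t : F) q.δ))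
    rw [FractionalIdeal.spanSingleton_le_iff_mem]
    have hb := Nat.gcd_eq_gcd_ab t k
    rw [(q.coprime_cofactor hk).gcd_eq_one] at hb
    have h2 : (1 : F) = t * (t.gcdA k : ℤ) + k * (t.gcdB k : ℤ) := by
      exact_mod_cast congrArg (Int.cast (R := F)) hb
    refine int_comb_mem h1 h4 (t.gcdA k) (-t.gcdB k) ?_
    push_cast; rw [hd]; linear_combination (t : F) * h2

theorem γ_mul_γ {t r : ℕ} (htr : t.Coprime r) (h : t * r ∣ q.D) :
    q.γ t * q.γ r = q.γ (t * r) := by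
  obtain ⟨k, hk⟩ := h
  have hd : q.δ * q.δ = -(t * r * k : F) := by
    rw [q.δ_mul_δ, q.d_eq_F, hk]; push_cast; ring
  apply Units.ext
  rw [Units.val_mul, val_γ, val_γ, val_γ]
  have ht := left_mem_pair ((t * r : ℕ) : F) q.δ
  have hδ := right_mem_pair ((t * r : ℕ) : F) q.δ
  apply le_antisymm
  · refine pair_mul_pair_le.2 ⟨?_, ?_, ?_, ?_⟩
    · simpa using ht
    · exact int_comb_mem hδ hδ t 0 (by push_cast; ring)
    · exact int_comb_mem hδ hδ r 0 (by push_cast; ring)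
    · exact int_comb_mem ht ht (-k) 0 (by push_cast; rw [hd]; ring)
  · obtain ⟨h1, h3, h4, -⟩ := pair_mul_pair_le.1 (le_refl (pair (t : F) q.δ * pair (r : F) q.δ))
    refine pair_le_iff.2 ⟨by simpa using h1, ?_⟩
    have hb := Nat.gcd_eq_gcd_ab t r
    rw [htr.gcd_eq_one] at hb
    have h2 : (1 : F) = t * (t.gcdA r : ℤ) + r * (t.gcdB r : ℤ) := by
      exact_mod_cast congrArg (Int.cast (R := F)) hb
    refine int_comb_mem h3 h4 (t.gcdA r) (t.gcdB r) ?_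
    linear_combination q.δ * h2

/-- With d = 4m - 1, the square of (1 + δ)/2 is (2m + δ) times 1/2, and 1/2 is recovered as (1 +
δ)/2 minus that square plus m. -/
theorem half_mul_half (h : q.d % 4 = 3) :
    ((q.half * q.half : (FractionalIdeal (𝓞 F)⁰ F)ˣ) : FractionalIdeal (𝓞 F)⁰ F) =
      FractionalIdeal.spanSingleton _ (1 / 2 : F) := by
  obtain ⟨m, hm⟩ : ∃ m : ℤ, q.d = 4 * m - 1 := ⟨(q.d + 1) / 4, by omega⟩
  have hmF : (q.d : F) = 4 * m - 1 := by rw [hm]; push_cast; ring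
  rw [Units.val_mul]
  change pair 1 ((1 + q.δ) / 2) * pair 1 ((1 + q.δ) / 2) = _
  have h1δ : IsIntegral ℤ (1 + q.δ) := isIntegral_one.add q.isIntegral_δ
  apply le_antisymm
  · refine pair_mul_pair_le.2 ⟨?_, ?_, ?_, ?_⟩
    · exact mem_spanSingleton_of_isIntegral (isIntegral_intCast 2) (by push_cast; ring)
    · exact mem_spanSingleton_of_isIntegral h1δ (by ring)
    · exact mem_spanSingleton_of_isIntegral h1δ (by ring)
    · refine mem_spanSingleton_of_isIntegral ((isIntegral_intCast (2 * m)).add q.isIntegral_δ) ?_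
      push_cast; linear_combination (1 / 4 : F) * q.sq + (1 / 4 : F) * hmF
  · obtain ⟨h1, h2, -, h3⟩ := pair_mul_pair_le.1
      (le_refl (pair 1 ((1 + q.δ) / 2) * pair 1 ((1 + q.δ) / 2)))
    rw [FractionalIdeal.spanSingleton_le_iff_mem]
    refine int_comb_mem (int_comb_mem h2 h3 1 (-1) rfl) h1 1 m ?_
    push_cast; linear_combination (1 / 4 : F) * q.sq + (1 / 4 : F) * hmF

theorem idealClass_mul (X Y : (FractionalIdeal (𝓞 F)⁰ F)ˣ) :
    idealClass (X * Y) = idealClass X * idealClass Y := map_mul _ _ _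

theorem idealClass_mul_self_eq_one {X : (FractionalIdeal (𝓞 F)⁰ F)ˣ} {a : F} (ha : a ≠ 0)
    (h : ((X * X : (FractionalIdeal (𝓞 F)⁰ F)ˣ) : FractionalIdeal (𝓞 F)⁰ F) =
      FractionalIdeal.spanSingleton _ a) : idealClass X * idealClass X = 1 := by
  rw [← idealClass_mul]
  have h1 : idealClass (1 : (FractionalIdeal (𝓞 F)⁰ F)ˣ) = 1 := map_one _
  rw [← h1, idealClass_eq_iff]
  exact ⟨Units.mk0 a ha, Units.ext (by rw [h, val_scaleIdeal, Units.val_one, mul_one]; rfl)⟩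

theorem γ_one : q.γ 1 = 1 := by
  apply Units.ext
  rw [val_γ, Units.val_one, Nat.cast_one]
  apply le_antisymm
  · refine pair_le_iff.2 ⟨FractionalIdeal.one_mem_one _, ?_⟩
    have := q.δ_mul_mem (FractionalIdeal.one_mem_one (P := F) (𝓞 F)⁰)
    rwa [mul_one] at this
  · rw [FractionalIdeal.one_le]; exact left_mem_pair _ _

end ImagQuad

end

section

namespace ImagQuad

variable {F : Type*} [Field F] [NumberField F] (q : ImagQuad F) [Algebra.IsQuadraticExtension ℚ F]

/-! ### Equality of the classes of square roots of rational ideals -/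

/-- The square is rational only if one of the two coordinates of α vanishes. -/
theorem sq_eq_rat {α : F} {r : ℚ} (h : α ^ 2 = (r : F)) :
    ∃ e : ℚ, r = e ^ 2 ∨ r = q.d * e ^ 2 := by
  obtain ⟨a, b, rfl⟩ := q.exists_coords α
  have h1 : ((a ^ 2 + q.d * b ^ 2 : ℚ) : F) + ((2 * a * b : ℚ) : F) * q.δ = (r : F) + ((0 : ℚ) : F) * q.δ := by
    rw [Rat.cast_zero, zero_mul, add_zero, ← h]; push_cast
    linear_combination -(b : F) ^ 2 * q.sq
  obtain ⟨h2, h3⟩ := q.coords_inj h1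
  rcases mul_eq_zero.1 h3 with h3 | h3
  · obtain rfl : a = 0 := by linarith
    exact ⟨b, Or.inr (by rw [← h2]; ring)⟩
  · subst h3
    exact ⟨a, Or.inl (by rw [← h2]; ring)⟩

/-- If X = αY then α²b and a generate the same ideal, so α² = ±a/b because the units are ±1. A
rational square in F is e² or de², and positivity of a and b fixes the sign. -/
theorem isSquare_of_idealClass_eq {X Y : (FractionalIdeal (𝓞 F)⁰ F)ˣ} {a b : ℚ} (ha : 0 < a)
    (hb : 0 < b)
    (hX : ((X * X : (FractionalIdeal (𝓞 F)⁰ F)ˣ) : FractionalIdeal (𝓞 F)⁰ F) =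
      FractionalIdeal.spanSingleton _ (a : F))
    (hY : ((Y * Y : (FractionalIdeal (𝓞 F)⁰ F)ˣ) : FractionalIdeal (𝓞 F)⁰ F) =
      FractionalIdeal.spanSingleton _ (b : F))
    (h : idealClass X = idealClass Y) : IsSquare (a * b) ∨ IsSquare (a * b * q.D) := by
  obtain ⟨α, rfl⟩ := idealClass_eq_iff.1 h
  have haF : (a : F) ≠ 0 := by exact_mod_cast ha.ne'
  have hbF : (b : F) ≠ 0 := by exact_mod_cast hb.ne'
  have h1 : FractionalIdeal.spanSingleton (𝓞 F)⁰ (a : F) =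
      FractionalIdeal.spanSingleton (𝓞 F)⁰ ((α : F) ^ 2 * b) := by
    rw [← hX, Units.val_mul, val_scaleIdeal, mul_mul_mul_comm,
      FractionalIdeal.spanSingleton_mul_spanSingleton, ← Units.val_mul Y Y, hY,
      FractionalIdeal.spanSingleton_mul_spanSingleton, pow_two]
  have hnorm : Algebra.norm ℚ ((α : F) ^ 2 * b / a) = 1 := by
    have h2 := congrArg FractionalIdeal.absNorm h1
    rw [FractionalIdeal.absNorm_span_singleton, FractionalIdeal.absNorm_span_singleton,
      abs_of_nonneg (q.norm_nonneg _), abs_of_nonneg (q.norm_nonneg _)] at h2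
    have h3 := Algebra.norm_ne_zero_iff (R := ℚ).2 haF
    have h4 : Algebra.norm ℚ ((α : F) ^ 2 * b / a) * Algebra.norm ℚ (a : F) =
        Algebra.norm ℚ (a : F) := by
      rw [← map_mul, div_mul_cancel₀ _ haF, h2]
    exact mul_right_cancel₀ h3 (h4.trans (one_mul _).symm)
  have hint : IsIntegral ℤ ((α : F) ^ 2 * b / a) := by
    have h2 : (α : F) ^ 2 * b ∈ FractionalIdeal.spanSingleton (𝓞 F)⁰ (a : F) :=
      h1 ▸ FractionalIdeal.mem_spanSingleton_self _ _
    obtain ⟨z, hz⟩ := (FractionalIdeal.mem_spanSingleton _).1 h2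
    have : (α : F) ^ 2 * b / a = z := by
      rw [← hz, Algebra.smul_def, mul_div_cancel_right₀ _ haF]
    rw [this]
    exact z.isIntegral_coe
  obtain ⟨ε, hε, hα⟩ : ∃ ε : ℚ, (ε = 1 ∨ ε = -1) ∧ (α : F) ^ 2 = ((ε * (a / b) : ℚ) : F) := by
    rcases q.eq_one_or_neg_one hint hnorm with h | h
    · refine ⟨1, Or.inl rfl, ?_⟩
      rw [div_eq_iff haF] at h
      push_cast; rw [one_mul, eq_div_iff hbF, h, one_mul]
    · refine ⟨-1, Or.inr rfl, ?_⟩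
      rw [div_eq_iff haF] at h
      push_cast; rw [neg_one_mul, ← neg_div, eq_div_iff hbF, h]; ring
  have hab : 0 < a / b := div_pos ha hb
  have hb' := hb.ne'
  have hd : (q.d : ℚ) = -(q.D : ℚ) := by rw [q.d_eq]; push_cast; rfl
  have hD : (0 : ℚ) < q.D := by exact_mod_cast q.D_pos
  obtain ⟨e, he | he⟩ := q.sq_eq_rat hα
  · left
    have : a / b = e ^ 2 := by
      rcases hε with rfl | rfl
      · linarith
      · nlinarith [sq_nonneg e]
    refine ⟨b * e, ?_⟩
    rw [div_eq_iff hb'] at this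
    rw [this]; ring
  · right
    have : a / b = q.D * e ^ 2 := by
      rcases hε with rfl | rfl
      · rw [hd] at he; nlinarith [mul_nonneg hD.le (sq_nonneg e)]
      · rw [hd] at he; linarith
    refine ⟨b * e * q.D, ?_⟩
    rw [div_eq_iff hb'] at this
    rw [this]; ring

/-- Multiplication by δ/t interchanges t and δ with δ and -k. -/
theorem idealClass_γ_cofactor {t k : ℕ} (h : q.D = t * k) :
    idealClass (q.γ k) = idealClass (q.γ t) := by
  have ht : (t : F) ≠ 0 := by
    have := q.D_pos
    rw [h] at this
    exact_mod_cast (Nat.pos_of_mul_pos_right this).ne'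
  rw [idealClass_eq_iff]
  refine ⟨Units.mk0 (q.δ / t) (div_ne_zero q.δ_ne_zero ht), Units.ext ?_⟩
  have hd : q.δ * q.δ = -(t * k : F) := by
    rw [q.δ_mul_δ, q.d_eq_F, h]; push_cast; ring
  have h2 : q.δ / t * q.δ = -(k : F) := by
    rw [div_mul_eq_mul_div, hd]; field_simp
  rw [val_scaleIdeal, val_γ, val_γ, spanSingleton_mul_pair, Units.val_mk0,
    div_mul_cancel₀ _ ht, h2, pair_comm]
  apply le_antisymm <;> rw [pair_le_iff]
  · exact ⟨left_mem_pair _ _, int_comb_mem (right_mem_pair _ _) (right_mem_pair _ _) (-1) 0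
      (by push_cast; ring)⟩
  · exact ⟨left_mem_pair _ _, int_comb_mem (right_mem_pair _ _) (right_mem_pair _ _) (-1) 0
      (by push_cast; ring)⟩

theorem γ_mul_self_rat {t : ℕ} (ht : t ∣ q.D) :
    ((q.γ t * q.γ t : (FractionalIdeal (𝓞 F)⁰ F)ˣ) : FractionalIdeal (𝓞 F)⁰ F) =
      FractionalIdeal.spanSingleton _ ((t : ℚ) : F) := by
  rw [q.γ_mul_self ht, Rat.cast_natCast]

theorem idealClass_γ_eq_iff {t k t' : ℕ} (h : q.D = t * k) (ht' : t' ∣ q.D) :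
    idealClass (q.γ t') = idealClass (q.γ t) ↔ t' = t ∨ t' = k := by
  constructor
  · intro hc
    have ht : t ∣ q.D := ⟨k, h⟩
    have hk : k ∣ q.D := ⟨t, by rw [h, mul_comm]⟩
    have ht0 := Nat.pos_of_dvd_of_pos ht q.D_pos
    have ht'0 := Nat.pos_of_dvd_of_pos ht' q.D_pos
    have sqf {n : ℕ} (hn : n ∣ q.D) := q.squarefree_D.squarefree_of_dvd hn
    rcases q.isSquare_of_idealClass_eq (by exact_mod_cast ht'0) (by exact_mod_cast ht0)
      (q.γ_mul_self_rat ht') (q.γ_mul_self_rat ht) hc with hs | ⟨c, hc⟩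
    · left
      refine Nat.eq_of_squarefree_of_isSquare_mul (sqf ht') (sqf ht) ?_
      exact Rat.isSquare_natCast_iff.1 (by exact_mod_cast hs)
    · right
      refine Nat.eq_of_squarefree_of_isSquare_mul (sqf ht') (sqf hk) ?_
      refine Rat.isSquare_natCast_iff.1 ⟨c / t, ?_⟩
      have ht0Q : (t : ℚ) ≠ 0 := by exact_mod_cast ht0.ne'
      rw [h] at hc
      push_cast at hc ⊢
      field_simp
      linear_combination hc
  · rintro (rfl | rfl)
    · rfl
    · exact q.idealClass_γ_cofactor h

theorem not_isSquare_two_mul_odd {a b : ℕ} (ha : Odd a) (hb : Odd b) : ¬ IsSquare (2 * (a * b)) := by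
  rintro ⟨c, hc⟩
  have h1 : Even (c * c) := ⟨a * b, by rw [← hc]; ring⟩
  obtain ⟨e, rfl⟩ : Even c := by simpa [Nat.even_mul] using h1
  have h2 : Odd (a * b) := ha.mul hb
  rw [← Nat.not_even_iff_odd] at h2
  exact h2 ⟨e * e, by nlinarith⟩

theorem half_mul_γ_mul_self (h : q.d % 4 = 3) {t : ℕ} (ht : t ∣ q.D) :
    ((q.half * q.γ t * (q.half * q.γ t) : (FractionalIdeal (𝓞 F)⁰ F)ˣ) :
      FractionalIdeal (𝓞 F)⁰ F) = FractionalIdeal.spanSingleton _ ((t / 2 : ℚ) : F) := by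
  rw [mul_mul_mul_comm, Units.val_mul, q.half_mul_half h, q.γ_mul_self ht,
    FractionalIdeal.spanSingleton_mul_spanSingleton]
  push_cast; rw [one_div_mul_eq_div]

/-- Equal classes would make tt'/2, or |d| times it, a rational square; after removing squares this
is twice an odd number, which has odd 2-adic valuation. -/
theorem idealClass_half_mul_γ_ne (h : q.d % 4 = 3) {t t' : ℕ} (ht : t ∣ q.D) (ht' : t' ∣ q.D) :
    idealClass q.half * idealClass (q.γ t) ≠ idealClass (q.γ t') := by
  rw [← idealClass_mul]
  intro hc
  have ht0 : (0 : ℚ) < t := by exact_mod_cast Nat.pos_of_dvd_of_pos ht q.D_pos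
  have ht'0 : (0 : ℚ) < t' := by exact_mod_cast Nat.pos_of_dvd_of_pos ht' q.D_pos
  have odd {n : ℕ} (hn : n ∣ q.D) : Odd n := q.odd_of_dvd_D (by omega) hn
  rcases q.isSquare_of_idealClass_eq (half_pos ht0) ht'0
    (q.half_mul_γ_mul_self h ht) (q.γ_mul_self_rat ht') hc with ⟨c, hc⟩ | ⟨c, hc⟩
  · refine not_isSquare_two_mul_odd (odd ht) (odd ht') (Rat.isSquare_natCast_iff.1 ⟨2 * c, ?_⟩)
    push_cast; linear_combination 4 * hc
  · obtain ⟨k, hk⟩ := ht'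
    refine not_isSquare_two_mul_odd (odd ht) (odd (n := k) ⟨t', by rw [hk, mul_comm]⟩)
      (Rat.isSquare_natCast_iff.1 ⟨2 * c / t', ?_⟩)
    rw [hk] at hc
    push_cast at hc ⊢
    field_simp
    linear_combination 2 * hc

/-! ### The set of classes of the ideals `γ t` -/

open Classical in
/-- The classes of the ideals `γ t`, where `t` divides `d`. -/
def genus : Finset (ClassGroup (𝓞 F)) := q.D.divisors.image fun t => idealClass (q.γ t)

theorem mem_genus {g : ClassGroup (𝓞 F)} : g ∈ q.genus ↔ ∃ t, t ∣ q.D ∧ idealClass (q.γ t) = g := by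
  classical
  simp [genus, q.D_pos.ne']

theorem sum_divisors_eq (f : ClassGroup (𝓞 F) → ℂ) :
    ∑ t ∈ q.D.divisors, f (idealClass (q.γ t)) = 2 * ∑ g ∈ q.genus, f g := by
  classical
  rw [Finset.sum_comp f (fun t => idealClass (q.γ t)), Finset.mul_sum, genus]
  refine Finset.sum_congr rfl fun g hg => ?_
  obtain ⟨t, ht, rfl⟩ := Finset.mem_image.1 hg
  obtain ⟨k, hk⟩ := Nat.dvd_of_mem_divisors ht
  -- The two divisors in a fibre are distinct since |d| is squarefree and not 1, so each class is
  -- counted exactly twice.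
  have hne : t ≠ k := by
    rintro rfl
    have := q.squarefree_D t (hk ▸ dvd_rfl)
    rw [Nat.isUnit_iff] at this
    subst this
    exact q.D_ne_one (by simpa using hk)
  have : {a ∈ q.D.divisors | idealClass (q.γ a) = idealClass (q.γ t)} = {t, k} := by
    ext a
    rw [Finset.mem_filter, Finset.mem_insert, Finset.mem_singleton]
    constructor
    · rintro ⟨ha, h⟩
      exact (q.idealClass_γ_eq_iff hk (Nat.dvd_of_mem_divisors ha)).1 h
    · intro h
      have ha : a ∣ q.D := by
        rcases h with rfl | rfl
        · exact ⟨k, hk⟩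
        · exact ⟨t, by rw [hk, mul_comm]⟩
      exact ⟨Nat.mem_divisors.2 ⟨ha, q.D_pos.ne'⟩, (q.idealClass_γ_eq_iff hk ha).2 h⟩
  rw [this, Finset.card_pair hne, nsmul_eq_mul]; rfl

end ImagQuad

end

section

namespace ImagQuad

variable {F : Type*} [Field F] [NumberField F] (q : ImagQuad F) [Algebra.IsQuadraticExtension ℚ F]

/-! ### Conjugation-invariant classes -/

theorem conjIdeal_eq_self (q : ImagQuad F) {X : (FractionalIdeal (𝓞 F)⁰ F)ˣ} {u v : F}
    (hX : (X : FractionalIdeal (𝓞 F)⁰ F) = pair u v)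
    (hu : conj F u ∈ (X : FractionalIdeal (𝓞 F)⁰ F))
    (hv : conj F v ∈ (X : FractionalIdeal (𝓞 F)⁰ F)) : conjIdeal X = X := by
  have h1 : (X : FractionalIdeal (𝓞 F)⁰ F) ≤ conjIdeal X := by
    conv_lhs => rw [hX]
    exact pair_le_iff.2 ⟨(mem_conjIdeal X u).2 ⟨_, hu, q.conj_conj u⟩,
      (mem_conjIdeal X v).2 ⟨_, hv, q.conj_conj v⟩⟩
  apply Units.ext
  refine le_antisymm ?_ h1
  intro z hz
  obtain ⟨y, hy, rfl⟩ := (mem_conjIdeal X z).1 hz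
  obtain ⟨x, hx, rfl⟩ := (mem_conjIdeal X y).1 (h1 hy)
  rw [q.conj_conj]; exact hx

theorem mem_scaleIdeal {α : Fˣ} {J : (FractionalIdeal (𝓞 F)⁰ F)ˣ} {z : F} :
    z ∈ (scaleIdeal α J : FractionalIdeal (𝓞 F)⁰ F) ↔
      (α : F)⁻¹ * z ∈ (J : FractionalIdeal (𝓞 F)⁰ F) := by
  rw [← mem_lattice, lattice_scaleIdeal, mem_scale_iff]; rfl

theorem conjIdeal_scaleIdeal {α β : Fˣ} (h : (β : F) = conj F α)
    (J : (FractionalIdeal (𝓞 F)⁰ F)ˣ) : conjIdeal (scaleIdeal α J) = scaleIdeal β (conjIdeal J) := by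
  apply Units.ext
  ext z
  rw [mem_scaleIdeal, mem_conjIdeal, mem_conjIdeal, h]
  constructor
  · rintro ⟨y, hy, rfl⟩
    exact ⟨_, mem_scaleIdeal.1 hy, by rw [map_mul, map_inv₀]⟩
  · rintro ⟨y, hy, h⟩
    have hα : conj F (α : F) ≠ 0 := by simp
    refine ⟨α * y, mem_scaleIdeal.2 (by rwa [inv_mul_cancel_left₀ α.ne_zero]), ?_⟩
    rw [map_mul, h, mul_inv_cancel_left₀ hα]

theorem conjInvariantClass_of_eq {J X : (FractionalIdeal (𝓞 F)⁰ F)ˣ}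
    (hX : conjIdeal X = X) (h : idealClass J = idealClass X) : ConjInvariantClass J := by
  obtain ⟨α, rfl⟩ := idealClass_eq_iff.1 h
  have hα : conj F (α : F) ≠ 0 := by simp
  rw [ConjInvariantClass, conjIdeal_scaleIdeal (β := Units.mk0 _ hα) rfl, hX,
    idealClass_scaleIdeal, idealClass_scaleIdeal]

/-- A class fixed by conjugation contains an ideal fixed by conjugation. -/
theorem exists_conj_stable (q : ImagQuad F) {J : (FractionalIdeal (𝓞 F)⁰ F)ˣ}
    (hJ : ConjInvariantClass J) : ∃ β : Fˣ, ∀ z ∈ lattice (scaleIdeal β J),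
      conj F z ∈ lattice (scaleIdeal β J) := by
  obtain ⟨α, hα⟩ := idealClass_eq_iff.1 hJ
  have hα0 : conj F (α : F) ≠ 0 := by simp
  have hstep {z : F} (hz : z ∈ (J : FractionalIdeal (𝓞 F)⁰ F)) :
      α * conj F z ∈ (J : FractionalIdeal (𝓞 F)⁰ F) := by
    rw [hα, mem_scaleIdeal, inv_mul_cancel_left₀ α.ne_zero]
    exact (mem_conjIdeal J _).2 ⟨z, hz, rfl⟩
  have hN0 := Algebra.norm_ne_zero_iff (R := ℚ).2 α.ne_zero
  -- Applying conjugation to J = αJ̄ gives J̄ = ᾱJ; comparing ideal norms yields N(α)² = 1, and N(α)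
  -- is nonnegative. Hilbert 90 then writes α as β/β̄, and β⁻¹J is stable.
  have hN : Algebra.norm ℚ (α : F) = 1 := by
    have h1 : J = scaleIdeal α (conjIdeal J) := hα
    have h2 : conjIdeal (conjIdeal J) = J := by
      apply Units.ext
      ext z
      rw [mem_conjIdeal]
      constructor
      · rintro ⟨y, hy, rfl⟩
        obtain ⟨x, hx, rfl⟩ := (mem_conjIdeal J y).1 hy
        rwa [q.conj_conj]
      · intro hz
        exact ⟨conj F z, (mem_conjIdeal J _).2 ⟨z, hz, rfl⟩, q.conj_conj z⟩
    have h3 := congrArg conjIdeal h1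
    rw [conjIdeal_scaleIdeal (β := Units.mk0 _ hα0) rfl, h2] at h3
    have h4 := q.absNorm_scaleIdeal α (conjIdeal J)
    have h5 := q.absNorm_scaleIdeal (Units.mk0 _ hα0) J
    rw [← h1] at h4
    rw [← h3, Units.val_mk0, q.norm_conj] at h5
    have h6 := absNorm_pos J
    rw [h5] at h4
    have h7 : Algebra.norm ℚ (α : F) * Algebra.norm ℚ (α : F) = 1 := by
      refine mul_right_cancel₀ h6.ne' ?_
      rw [one_mul, mul_assoc]; exact h4.symm
    have h8 := q.norm_nonneg (α : F)
    nlinarith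
  obtain ⟨β, hβ⟩ := q.exists_reflOf (q.mem_reflections_iff.2 ⟨α, α.ne_zero, hN, rfl⟩)
  have hβ0 : conj F (β : F) ≠ 0 := by simp
  have h1 : (α : F) * conj F β = β := by
    have := LinearEquiv.congr_fun hβ 1
    rw [refl_apply, reflOf_apply, map_one, mul_one, mul_one] at this
    rw [this, div_mul_cancel₀ _ hβ0]
  refine ⟨β⁻¹, fun z hz => ?_⟩
  rw [mem_lattice, mem_scaleIdeal, Units.val_inv_eq_inv_val, inv_inv] at hz ⊢
  have := hstep hz
  rwa [map_mul, ← mul_assoc, h1] at this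

/-- A conjugation-stable ideal in the class is a scaled shape lattice, and being an ideal it
coincides with the ideal which that lattice generates. -/
theorem exists_shape_of_conjInvariant {J : (FractionalIdeal (𝓞 F)⁰ F)ˣ}
    (hJ : ConjInvariantClass J) : ∃ w, idealClass J = idealClass (q.shapeIdeal w) := by
  obtain ⟨β, hβ⟩ := q.exists_conj_stable hJ
  obtain ⟨e, he, w, hw⟩ := q.exists_shape_of_relIndex le_rfl (relIndex_lattice_ne_zero le_rfl) hβ
  refine ⟨w, ?_⟩
  rw [← idealClass_scaleIdeal β J, ← idealClass_scaleIdeal (ratUnit F e he) (q.shapeIdeal w)]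
  congr 1
  apply lattice_injective
  apply le_antisymm
  · rw [hw, lattice_scaleIdeal, scale_le_iff]
    exact fun k hk => ⟨k, q.shapeLat_le w hk, rfl⟩
  · rw [← q.scale_shapeLat_le_iff, hw]

theorem conjIdeal_γ (t : ℕ) : conjIdeal (q.γ t) = q.γ t := by
  apply q.conjIdeal_eq_self (q.val_γ t) <;> rw [val_γ]
  · rw [map_natCast]; exact left_mem_pair _ _
  · exact int_comb_mem (left_mem_pair _ _) (right_mem_pair _ _) 0 (-1) (by rw [q.conj_δ]; push_cast; ring)

theorem conjIdeal_half : conjIdeal q.half = q.half := by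
  refine q.conjIdeal_eq_self (u := 1) (v := (1 + q.δ) / 2) rfl ?_ ?_
  · rw [map_one]; exact left_mem_pair _ _
  · refine int_comb_mem (left_mem_pair _ _) (right_mem_pair _ _) 1 (-1) ?_
    simp only [map_div₀, map_add, map_one, map_ofNat, q.conj_δ]; push_cast; ring

theorem conjInvariantClass_iff (J : (FractionalIdeal (𝓞 F)⁰ F)ˣ) : ConjInvariantClass J ↔
    idealClass J ∈ q.genus ∨ (q.d % 4 = 3 ∧ ∃ g ∈ q.genus, idealClass q.half * g = idealClass J) := by
  constructor
  · intro hJ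
    obtain ⟨w, hw⟩ := q.exists_shape_of_conjInvariant hJ
    rw [q.idealClass_shapeIdeal] at hw
    have hg := q.mem_genus.2 ⟨_, Nat.gcd_dvd_right w.1.1.1 q.D, rfl⟩
    split_ifs at hw with h
    · exact Or.inr ⟨h.2.1, _, hg, hw.symm⟩
    · exact Or.inl (hw ▸ hg)
  · rintro (h | ⟨-, g, h, hJ⟩)
    · obtain ⟨t, -, ht⟩ := q.mem_genus.1 h
      exact conjInvariantClass_of_eq (q.conjIdeal_γ t) ht.symm
    · obtain ⟨t, -, rfl⟩ := q.mem_genus.1 h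
      rw [← idealClass_mul] at hJ
      refine conjInvariantClass_of_eq ?_ hJ.symm
      change Units.map _ _ = _
      rw [map_mul]
      exact congrArg₂ (· * ·) q.conjIdeal_half (q.conjIdeal_γ t)

/-! ### Ramified factors -/

theorem eq_of_le_of_mul_self_eq {X Y : (FractionalIdeal (𝓞 F)⁰ F)ˣ}
    (h : (X : FractionalIdeal (𝓞 F)⁰ F) ≤ Y) (hXY : X * X = Y * Y) : X = Y := by
  have h1 : (X * X : FractionalIdeal (𝓞 F)⁰ F) ≤ X * Y := mul_le_mul_right h _
  have h2 : (X * Y : FractionalIdeal (𝓞 F)⁰ F) ≤ Y * Y := mul_le_mul_left h _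
  have h3 : (X * X : FractionalIdeal (𝓞 F)⁰ F) = Y * Y := by
    rw [← Units.val_mul, hXY, Units.val_mul]
  have h4 : X * X = X * Y := Units.ext (le_antisymm h1 (by rw [Units.val_mul, Units.val_mul, h3]; exact h2))
  exact mul_left_cancel h4

/-- If P² = (r) with P prime, then r and x have squares in P², so X ⊆ P; as X² = P², the two agree.
Conversely X is integral of norm r, hence prime. -/
theorem ramifiedFactor_classes (q : ImagQuad F) {r : ℕ} (hr : r ∈ ramifiedPrimes F) {x : F}
    (hx : IsIntegral ℤ x) {X : (FractionalIdeal (𝓞 F)⁰ F)ˣ}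
    (hX : (X : FractionalIdeal (𝓞 F)⁰ F) = pair (r : F) x)
    (hXX : ((X * X : (FractionalIdeal (𝓞 F)⁰ F)ˣ) : FractionalIdeal (𝓞 F)⁰ F) =
      FractionalIdeal.spanSingleton _ (r : F)) (g : ClassGroup (𝓞 F)) :
    (∃ P, IsRamifiedFactor F r P ∧ ClassGroup.mk0 P = g) ↔ idealClass X = g := by
  have hprime : r.Prime := (q.mem_ramifiedPrimes_iff r).1 hr |>.1
  have hspan : ((Ideal.span {(r : 𝓞 F)} : Ideal (𝓞 F)) : FractionalIdeal (𝓞 F)⁰ F) =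
      FractionalIdeal.spanSingleton _ (r : F) := by
    rw [FractionalIdeal.coeIdeal_span_singleton]; simp
  constructor
  · rintro ⟨P, ⟨-, hP, hPP⟩, rfl⟩
    rw [← ClassGroup.mk_mk0 F, idealClass]
    congr 1
    have hsq : ((P : Ideal (𝓞 F)) : FractionalIdeal (𝓞 F)⁰ F) * ((P : Ideal (𝓞 F)) : FractionalIdeal (𝓞 F)⁰ F) =
        FractionalIdeal.spanSingleton _ (r : F) := by
      rw [← FractionalIdeal.coeIdeal_mul, ← pow_two, hPP, hspan]
    have hmem {z : 𝓞 F} (hz : (z : F) * z ∈ FractionalIdeal.spanSingleton (𝓞 F)⁰ (r : F)) :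
        (z : F) ∈ ((P : Ideal (𝓞 F)) : FractionalIdeal (𝓞 F)⁰ F) := by
      rw [← hspan, ← hPP, ← map_mul, FractionalIdeal.mem_coeIdeal] at hz
      obtain ⟨y, hy, hyz⟩ := hz
      have hy' : y = z * z := NumberField.RingOfIntegers.coe_injective hyz
      subst hy'
      have : z * z ∈ (P : Ideal (𝓞 F)) := Ideal.pow_le_self two_ne_zero hy
      exact FractionalIdeal.mem_coeIdeal_of_mem _ ((hP.mem_or_mem this).elim id id)
    apply eq_of_le_of_mul_self_eq
    · rw [hX, FractionalIdeal.coe_mk0, pair_le_iff]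
      constructor
      · have : ((r : 𝓞 F) : F) = (r : F) := by simp
        rw [← this]
        apply hmem
        rw [this]
        exact mem_spanSingleton_of_isIntegral (isIntegral_intCast r) (by push_cast; rfl)
      · refine hmem (z := ⟨x, hx⟩) ?_
        rw [← hXX, Units.val_mul, hX]
        exact FractionalIdeal.mul_mem_mul (right_mem_pair _ _) (right_mem_pair _ _)
    · exact Units.ext (by rw [hXX, Units.val_mul, FractionalIdeal.coe_mk0, hsq])
  · rintro rfl
    have hle : (X : FractionalIdeal (𝓞 F)⁰ F) ≤ 1 := by
      rw [hX, pair_le_iff]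
      constructor
      · have := isIntegral_mul_mem (isIntegral_intCast (F := F) r)
          (FractionalIdeal.one_mem_one (P := F) (𝓞 F)⁰)
        simpa using this
      · have := isIntegral_mul_mem hx (FractionalIdeal.one_mem_one (P := F) (𝓞 F)⁰)
        simpa using this
    obtain ⟨P, hP⟩ := FractionalIdeal.le_one_iff_exists_coeIdeal.1 hle
    have hPP : P ^ 2 = Ideal.span {(r : 𝓞 F)} := by
      apply FractionalIdeal.coeIdeal_injective (K := F)
      beta_reduce
      rw [hspan, ← hXX, pow_two, FractionalIdeal.coeIdeal_mul, hP, Units.val_mul]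
    have hP0 : P ≠ 0 := by
      rintro rfl
      exact X.ne_zero (by rw [← hP]; exact FractionalIdeal.coeIdeal_bot)
    have hnorm : Ideal.absNorm P = r := by
      have h1 := congrArg Ideal.absNorm hPP
      rw [map_pow, Ideal.absNorm_span_singleton, ← map_natCast (algebraMap ℤ (𝓞 F)) r,
        Algebra.norm_algebraMap, NumberField.RingOfIntegers.rank,
        Algebra.IsQuadraticExtension.finrank_eq_two, Int.natAbs_pow] at h1
      exact Nat.pow_left_injective two_ne_zero (by simpa using h1)
    refine ⟨⟨P, mem_nonZeroDivisors_of_ne_zero hP0⟩, ⟨hr, ?_, hPP⟩, ?_⟩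
    · refine Ideal.isPrime_of_irreducible_absNorm ?_
      rw [hnorm]; exact hprime
    · rw [← ClassGroup.mk_mk0 F, idealClass]
      congr 1
      exact Units.ext (by rw [FractionalIdeal.coe_mk0]; exact hP)

end ImagQuad

end

/-! ### The subgroups generated by the ramified factors. -/

section

theorem mem_closure_insert_of_mul_self {G : Type*} [CommGroup G] {h : G} (hh : h * h = 1)
    (S : Set G) (g : G) : g ∈ Subgroup.closure (insert h S) ↔
      g ∈ Subgroup.closure S ∨ ∃ k ∈ Subgroup.closure S, h * k = g := by
  rw [Set.insert_eq, Subgroup.closure_union, ← Subgroup.zpowers_eq_closure, Subgroup.mem_sup]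
  constructor
  · rintro ⟨y, hy, k, hk, rfl⟩
    obtain ⟨n, rfl⟩ := Subgroup.mem_zpowers_iff.1 hy
    obtain ⟨m, rfl | rfl⟩ := Int.even_or_odd' n
    · left
      rwa [zpow_mul, zpow_two, hh, one_zpow, one_mul]
    · right
      exact ⟨k, hk, by rw [zpow_add, zpow_mul, zpow_two, hh, one_zpow, one_mul, zpow_one]⟩
  · rintro (hg | ⟨k, hk, rfl⟩)
    · exact ⟨1, one_mem _, g, hg, one_mul g⟩
    · exact ⟨h, Subgroup.mem_zpowers h, k, hk, rfl⟩

namespace ImagQuad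

variable {F : Type*} [Field F] [NumberField F] (q : ImagQuad F) [Algebra.IsQuadraticExtension ℚ F]

/-- The classes of the ideals `γ r`, where `r` is a prime divisor of `d`. -/
def primeClasses : Set (ClassGroup (𝓞 F)) :=
  {g | ∃ r : ℕ, r.Prime ∧ r ∣ q.D ∧ idealClass (q.γ r) = g}

theorem idealClass_γ_mul_self {t : ℕ} (ht : t ∣ q.D) :
    idealClass (q.γ t) * idealClass (q.γ t) = 1 :=
  idealClass_mul_self_eq_one (by exact_mod_cast (Nat.pos_of_dvd_of_pos ht q.D_pos).ne')
    (q.γ_mul_self ht)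

theorem idealClass_γ_mul {t k : ℕ} (h : t * k ∣ q.D) :
    idealClass (q.γ t) * idealClass (q.γ k) = idealClass (q.γ (t * k)) := by
  rw [← idealClass_mul, q.γ_mul_γ (Nat.coprime_of_squarefree_mul
    (q.squarefree_D.squarefree_of_dvd h)) h]

theorem prime_mul_mem_genus {r : ℕ} (hr : r.Prime) (hrD : r ∣ q.D) {g : ClassGroup (𝓞 F)}
    (hg : g ∈ q.genus) : idealClass (q.γ r) * g ∈ q.genus := by
  obtain ⟨t, ht, rfl⟩ := q.mem_genus.1 hg
  rw [q.mem_genus]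
  by_cases h : r ∣ t
  · obtain ⟨k, rfl⟩ := h
    refine ⟨k, (Dvd.intro_left r rfl).trans ht, ?_⟩
    rw [← q.idealClass_γ_mul ht, ← mul_assoc, q.idealClass_γ_mul_self hrD, one_mul]
  · have h1 : r * t ∣ q.D := ((hr.coprime_iff_not_dvd).2 h).mul_dvd_of_dvd_of_dvd hrD ht
    exact ⟨r * t, h1, (q.idealClass_γ_mul h1).symm⟩

/-- Multiplying by γ_r either adjoins the prime r to t or cancels it, because γ_r² is principal; so
the classes of the γ_t already form a group. -/
theorem mem_closure_primeClasses {g : ClassGroup (𝓞 F)} :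
    g ∈ Subgroup.closure q.primeClasses ↔ g ∈ q.genus := by
  have hone : idealClass (q.γ 1) = 1 := by rw [γ_one]; exact map_one _
  constructor
  · intro hg
    induction hg using Subgroup.closure_induction_left with
    | one => exact q.mem_genus.2 ⟨1, one_dvd _, hone⟩
    | mul_left x hx y hy ih =>
      obtain ⟨r, hr, hrD, rfl⟩ := hx
      exact q.prime_mul_mem_genus hr hrD ih
    | inv_mul_cancel x hx y hy ih =>
      obtain ⟨r, hr, hrD, rfl⟩ := hx
      rw [inv_eq_of_mul_eq_one_left (q.idealClass_γ_mul_self hrD)]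
      exact q.prime_mul_mem_genus hr hrD ih
  · intro hg
    obtain ⟨t, ht, rfl⟩ := q.mem_genus.1 hg
    induction t using Nat.recOnMul with
    | zero => exact absurd (zero_dvd_iff.1 ht) q.D_pos.ne'
    | one => rw [hone]; exact one_mem _
    | prime p hp => exact Subgroup.subset_closure ⟨p, hp, ht, rfl⟩
    | mul a b ha hb =>
      rw [← q.idealClass_γ_mul ht]
      have h1 : a ∣ q.D := (Dvd.intro b rfl).trans ht
      have h2 : b ∣ q.D := (Dvd.intro_left a rfl).trans ht
      exact mul_mem (ha h1 (q.mem_genus.2 ⟨a, h1, rfl⟩)) (hb h2 (q.mem_genus.2 ⟨b, h2, rfl⟩))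

theorem idealClass_half_mul_self (h : q.d % 4 = 3) : idealClass q.half * idealClass q.half = 1 :=
  idealClass_mul_self_eq_one (by norm_num) (q.half_mul_half h)

theorem exists_ramifiedFactor_iff {r : ℕ} (hr : r.Prime) (hrD : r ∣ q.D) (g : ClassGroup (𝓞 F)) :
    (∃ P, IsRamifiedFactor F r P ∧ ClassGroup.mk0 P = g) ↔ idealClass (q.γ r) = g :=
  q.ramifiedFactor_classes ((q.mem_ramifiedPrimes_iff r).2 ⟨hr, Or.inl hrD⟩) q.isIntegral_δ
    (q.val_γ r) (q.γ_mul_self hrD) g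

/-- Twice the ideal (1, (1 + δ)/2) is (2, 1 + δ), the ramified factor above 2. -/
theorem exists_ramifiedFactor_two_iff (h : q.d % 4 = 3) (g : ClassGroup (𝓞 F)) :
    (∃ P, IsRamifiedFactor F 2 P ∧ ClassGroup.mk0 P = g) ↔ idealClass q.half = g := by
  rw [← idealClass_scaleIdeal (Units.mk0 2 two_ne_zero) q.half]
  refine q.ramifiedFactor_classes ((q.mem_ramifiedPrimes_iff 2).2 ⟨Nat.prime_two, Or.inr ⟨rfl, h⟩⟩)
    (isIntegral_one.add q.isIntegral_δ) ?_ ?_ g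
  · rw [val_scaleIdeal]
    change _ * pair 1 ((1 + q.δ) / 2) = _
    rw [spanSingleton_mul_pair, Units.val_mk0, mul_one, mul_div_cancel₀ _ two_ne_zero]; rfl
  · rw [Units.val_mul, val_scaleIdeal, mul_mul_mul_comm, ← Units.val_mul q.half q.half,
      q.half_mul_half h, FractionalIdeal.spanSingleton_mul_spanSingleton,
      FractionalIdeal.spanSingleton_mul_spanSingleton, Units.val_mk0]
    norm_num

theorem mem_ramSubgroup_iff_of_ne (h : q.d % 4 ≠ 3) {g : ClassGroup (𝓞 F)} :
    g ∈ ramSubgroup F ↔ g ∈ q.genus := by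
  rw [← q.mem_closure_primeClasses, ramSubgroup]
  have : {g | ∃ r γ, IsRamifiedFactor F r γ ∧ ClassGroup.mk0 γ = g} = q.primeClasses := by
    ext g
    constructor
    · rintro ⟨r, P, hP, rfl⟩
      obtain ⟨hr, hrD | hr2⟩ := (q.mem_ramifiedPrimes_iff r).1 hP.1
      · exact ⟨r, hr, hrD, (q.exists_ramifiedFactor_iff hr hrD _).1 ⟨P, hP, rfl⟩⟩
      · exact absurd hr2.2 h
    · rintro ⟨r, hr, hrD, hg⟩
      obtain ⟨P, hP⟩ := (q.exists_ramifiedFactor_iff hr hrD g).2 hg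
      exact ⟨r, P, hP⟩
  rw [this]

theorem mem_ramSubgroup_iff (h : q.d % 4 = 3) {g : ClassGroup (𝓞 F)} :
    g ∈ ramSubgroup F ↔ g ∈ q.genus ∨ ∃ k ∈ q.genus, idealClass q.half * k = g := by
  have : {g | ∃ r γ, IsRamifiedFactor F r γ ∧ ClassGroup.mk0 γ = g} =
      insert (idealClass q.half) q.primeClasses := by
    ext g
    constructor
    · rintro ⟨r, P, hP, rfl⟩
      obtain ⟨hr, hrD | ⟨rfl, -⟩⟩ := (q.mem_ramifiedPrimes_iff r).1 hP.1
      · exact Or.inr ⟨r, hr, hrD, (q.exists_ramifiedFactor_iff hr hrD _).1 ⟨P, hP, rfl⟩⟩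
      · exact Or.inl ((q.exists_ramifiedFactor_two_iff h _).1 ⟨P, hP, rfl⟩).symm
    · rintro (rfl | ⟨r, hr, hrD, hg⟩)
      · obtain ⟨P, hP⟩ := (q.exists_ramifiedFactor_two_iff h _).2 rfl
        exact ⟨2, P, hP⟩
      · obtain ⟨P, hP⟩ := (q.exists_ramifiedFactor_iff hr hrD g).2 hg
        exact ⟨r, P, hP⟩
  rw [ramSubgroup, this, mem_closure_insert_of_mul_self (q.idealClass_half_mul_self h)]
  simp only [q.mem_closure_primeClasses]

theorem mem_orthoSubgroup_iff (h : q.d % 4 = 3) {g : ClassGroup (𝓞 F)} :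
    g ∈ orthoSubgroup F ↔ g ∈ q.genus := by
  rw [← q.mem_closure_primeClasses, orthoSubgroup]
  have : {g | ∃ r γ, r ≠ 2 ∧ IsRamifiedFactor F r γ ∧ ClassGroup.mk0 γ = g} = q.primeClasses := by
    ext g
    constructor
    · rintro ⟨r, P, hr2, hP, rfl⟩
      obtain ⟨hr, hrD | hr2'⟩ := (q.mem_ramifiedPrimes_iff r).1 hP.1
      · exact ⟨r, hr, hrD, (q.exists_ramifiedFactor_iff hr hrD _).1 ⟨P, hP, rfl⟩⟩
      · exact absurd hr2'.1 hr2
    · rintro ⟨r, hr, hrD, hg⟩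
      obtain ⟨P, hP⟩ := (q.exists_ramifiedFactor_iff hr hrD g).2 hg
      refine ⟨r, P, ?_, hP⟩
      rintro rfl
      exact absurd (q.odd_of_dvd_D (by omega) hrD) (by decide)
  rw [this]

open Classical in
/-- The coset of `genus` that contains the class of `half`. -/
def halfGenus : Finset (ClassGroup (𝓞 F)) := q.genus.image fun g => idealClass q.half * g

theorem mem_halfGenus {g : ClassGroup (𝓞 F)} :
    g ∈ q.halfGenus ↔ ∃ k ∈ q.genus, idealClass q.half * k = g := by
  classical
  rw [halfGenus, Finset.mem_image]

theorem disjoint_genus_halfGenus (h : q.d % 4 = 3) : Disjoint q.genus q.halfGenus := by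
  rw [Finset.disjoint_left]
  intro g hg hg'
  obtain ⟨k, hk, rfl⟩ := q.mem_halfGenus.1 hg'
  obtain ⟨t, ht, rfl⟩ := q.mem_genus.1 hk
  obtain ⟨t', ht', h'⟩ := q.mem_genus.1 hg
  exact q.idealClass_half_mul_γ_ne h ht ht' h'.symm

theorem sum_divisors_half_eq (f : ClassGroup (𝓞 F) → ℂ) :
    ∑ t ∈ q.D.divisors, f (idealClass q.half * idealClass (q.γ t)) = 2 * ∑ g ∈ q.halfGenus, f g := by
  classical
  rw [q.sum_divisors_eq (fun g => f (idealClass q.half * g)), halfGenus, Finset.sum_image]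
  exact fun _ _ _ _ h => mul_left_cancel h

end ImagQuad

end

section

section

variable {F : Type*} [Field F] [NumberField F]

/-! ### The Dirichlet series of class numbers -/

theorem classCount_eq_sum (I : (FractionalIdeal (𝓞 F)⁰ F)ˣ)
    {P : (FractionalIdeal (𝓞 F)⁰ F)ˣ → Prop} {C : Finset (ClassGroup (𝓞 F))}
    (hP : ∀ J, P J ↔ idealClass J ∈ C) (n : ℕ) :
    (classCount I P n : ℂ) = ∑ g ∈ C, (indexSet I g).indicator 1 n := by
  classical
  have : {g : ClassGroup (𝓞 F) | ∃ J : (FractionalIdeal (𝓞 F)⁰ F)ˣ,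
      lattice J ≤ lattice I ∧ (lattice J).relIndex (lattice I) = n ∧ P J ∧ idealClass J = g} =
      ({g ∈ C | n ∈ indexSet I g} : Finset _) := by
    ext g
    rw [Finset.mem_coe, Finset.mem_filter]
    constructor
    · rintro ⟨J, h1, h2, h3, rfl⟩
      exact ⟨(hP J).1 h3, J, h1, h2, rfl⟩
    · rintro ⟨hg, J, h1, h2, rfl⟩
      exact ⟨J, h1, h2, (hP J).2 hg, rfl⟩
  rw [classCount, this, Set.ncard_coe_finset, Finset.card_filter]
  push_cast
  exact Finset.sum_congr rfl fun g _ => by simp [Set.indicator_apply]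

theorem classSeries_eq_sum (I : (FractionalIdeal (𝓞 F)⁰ F)ˣ)
    {P : (FractionalIdeal (𝓞 F)⁰ F)ˣ → Prop} {C : Finset (ClassGroup (𝓞 F))}
    (hP : ∀ J, P J ↔ idealClass J ∈ C) {s : ℂ} (hs : 1 < s.re) :
    classSeries I P s = ∑ g ∈ C,
      indexSeries (riemannZetaSummandHom (Complex.ne_zero_of_one_lt_re hs)) I g := by
  set χ := riemannZetaSummandHom (Complex.ne_zero_of_one_lt_re hs) with hχ
  have hsum : Summable fun n => ‖χ n‖ := summable_riemannZetaSummand hs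
  rw [classSeries, LSeries]
  simp only [indexSeries]
  rw [← Summable.tsum_finsetSum (fun g _ => (summable_indicator hsum _).of_norm)]
  refine tsum_congr fun n => ?_
  rcases eq_or_ne n 0 with rfl | hn
  · rw [LSeries.term_zero, Finset.sum_eq_zero]
    intro g _
    by_cases h : 0 ∈ indexSet I g
    · rw [Set.indicator_of_mem h, map_zero]
    · rw [Set.indicator_of_notMem h]
  · rw [LSeries.term_of_ne_zero hn, classCount_eq_sum I hP, div_eq_mul_inv, ← Complex.cpow_neg,
      Finset.sum_mul]
    refine Finset.sum_congr rfl fun g _ => ?_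
    by_cases h : n ∈ indexSet I g
    · rw [Set.indicator_of_mem h, Set.indicator_of_mem h, Pi.one_apply, one_mul]; rfl
    · rw [Set.indicator_of_notMem h, Set.indicator_of_notMem h, zero_mul]

/-- The coefficients are bounded by the class number. -/
theorem lSeriesSummable_classCount (I : (FractionalIdeal (𝓞 F)⁰ F)ˣ)
    (P : (FractionalIdeal (𝓞 F)⁰ F)ˣ → Prop) {s : ℂ} (hs : 1 < s.re) :
    LSeriesSummable (fun n => (classCount I P n : ℂ)) s := by
  refine LSeriesSummable_of_bounded_of_one_lt_re (m := Nat.card (ClassGroup (𝓞 F)))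
    (fun n _ => ?_) hs
  rw [Complex.norm_natCast]
  exact_mod_cast Set.ncard_le_card _

end

namespace ImagQuad

variable {F : Type*} [Field F] [NumberField F] (q : ImagQuad F) [Algebra.IsQuadraticExtension ℚ F]

/-! ### Evaluation of the reflection sum -/

/-- The value at `t` of the sum over the shapes with `gcd(x, d) = t`. -/
def divisorTerm (χ : ℕ →*₀ ℂ) (I : (FractionalIdeal (𝓞 F)⁰ F)ˣ) (t : ℕ) : ℂ :=
  (χ q.κ + χ (2 * q.κ)) * indexSeries χ I (idealClass (q.γ t)) * coprimeSum χ (q.D / t) t +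
    ((if q.d % 4 = 3 then indexSeries χ I (idealClass q.half * idealClass (q.γ t)) else
        indexSeries χ I (idealClass (q.γ t))) -
      χ (2 * q.κ) * indexSeries χ I (idealClass (q.γ t))) *
      (if q.d % 4 = 2 then 0 else coprimeSum χ (2 * (q.D / t)) (2 * t))

/-- Summability of the whole family comes first; only then may the iterated sum over ρ and K be
replaced by the sum over pairs. -/
theorem reflSummable_and_reflSum_eq (I : (FractionalIdeal (𝓞 F)⁰ F)ˣ) {s : ℂ} (hs : 1 < s.re) :
    ReflSummable (lattice I) s ∧ reflSum (lattice I) s =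
      (∑ t ∈ q.D.divisors,
        q.divisorTerm (riemannZetaSummandHom (Complex.ne_zero_of_one_lt_re hs)) I t) / 4 := by
  set χ := riemannZetaSummandHom (Complex.ne_zero_of_one_lt_re hs) with hχ
  have hsum : Summable fun n => ‖χ n‖ := summable_riemannZetaSummand hs
  have h1 := (q.hasSum_shape_index hsum I).div_const 4
  obtain ⟨h2, h3⟩ := q.refl_summable_iff_and_tsum_eq I s
  have h4 : ReflSummable (lattice I) s := h2.2 h1.summable
  refine ⟨h4, ?_⟩
  have h5 : reflSum (lattice I) s =
      ∑' p : Σ ρ : reflections F, InvariantSublattice (lattice I) ρ.1, zTerm (lattice I) s p.2.1 :=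
    (Summable.tsum_sigma h4).symm
  rw [h5, h3]
  refine h1.tsum_eq.trans ?_
  rw [q.tsum_shape hsum]; rfl

section

variable {χ : ℕ →*₀ ℂ} (hχ : Summable fun n => ‖χ n‖)
include hχ

theorem sum_divisorTerm (I : (FractionalIdeal (𝓞 F)⁰ F)ˣ) :
    (∑ t ∈ q.D.divisors, q.divisorTerm χ I t) * ∏ p ∈ q.D.primeFactors, (1 + χ p) =
      coprimeSum χ 1 1 *
      if q.d % 4 = 1 then 2 * ((1 - χ 2 + 2 * χ 2 ^ 2) * ∑ g ∈ q.genus, indexSeries χ I g)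
      else if q.d % 4 = 2 then 2 * ((1 + χ 2) * ∑ g ∈ q.genus, indexSeries χ I g)
      else 2 * (((1 + χ 2 + 2 * χ 2 ^ 2) * ∑ g ∈ q.genus, indexSeries χ I g +
        (1 - χ 2) * ∑ g ∈ q.halfGenus, indexSeries χ I g) / (1 + χ 2)) := by
  have h2 : 1 + χ 2 ≠ 0 := one_add_ne_zero hχ le_rfl
  have hsum := q.sum_divisors_eq (indexSeries χ I)
  have hsum' := q.sum_divisors_half_eq (indexSeries χ I)
  have hP {t : ℕ} (ht : t ∈ q.D.divisors) :
      coprimeSum χ (q.D / t) t * ∏ p ∈ q.D.primeFactors, (1 + χ p) = coprimeSum χ 1 1 := by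
    have h := Nat.div_mul_cancel (Nat.dvd_of_mem_divisors ht)
    have := coprimeSum_mul_prod hχ (A := q.D / t) (B := t) (h.symm ▸ q.squarefree_D)
    rwa [h] at this
  have hO (h : q.d % 4 ≠ 2) {t : ℕ} (ht : t ∈ q.D.divisors) :
      coprimeSum χ (2 * (q.D / t)) (2 * t) =
        (1 - χ 2) / (1 + χ 2) * coprimeSum χ (q.D / t) t := by
    have htD := Nat.dvd_of_mem_divisors ht
    rw [div_mul_eq_mul_div, eq_div_iff h2, mul_comm]
    exact coprimeSum_odd hχ (q.odd_of_dvd_D h (Nat.div_dvd_of_dvd htD)) (q.odd_of_dvd_D h htD)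
  rw [Finset.sum_mul]
  split_ifs with h1 h2'
  -- Here κ = 2, and with z = χ(2) the coefficient is z + z² + (1 - z²)(1 - z)/(1 + z) = 1 - z +
  -- 2z².
  · rw [mul_left_comm (2 : ℂ), ← hsum, Finset.mul_sum, Finset.mul_sum]
    refine Finset.sum_congr rfl fun t ht => ?_
    rw [divisorTerm, hO (by omega) ht, if_neg (by omega), if_neg (by omega), κ, if_pos h1, map_mul,
      ← hP ht]
    field_simp
    ring
  · rw [mul_left_comm (2 : ℂ), ← hsum, Finset.mul_sum, Finset.mul_sum]
    refine Finset.sum_congr rfl fun t ht => ?_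
    rw [divisorTerm, if_pos h2', if_neg (by omega), κ, if_neg h1, map_mul, map_one, ← hP ht]
    ring
  -- Here κ = 1, and the denominator 1 + χ(2) of the odd part survives; it supplies the factor at
  -- the ramified prime 2, which does not divide d.
  · have h3 : q.d % 4 = 3 := by have := q.d_mod_four; omega
    rw [mul_div_assoc', mul_add, mul_left_comm 2, mul_left_comm 2, ← hsum, ← hsum', Finset.mul_sum,
      Finset.mul_sum, ← Finset.sum_add_distrib, Finset.sum_div, Finset.mul_sum]
    refine Finset.sum_congr rfl fun t ht => ?_
    rw [divisorTerm, hO h2' ht, if_pos h3, if_neg h2', κ, if_neg h1, map_mul, map_one, ← hP ht]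
    field_simp
    ring

end

theorem ramProd_eq (s : ℂ) : ramProd F s =
    (if q.d % 4 = 3 then 1 + (2 : ℂ) ^ (-s) else 1) *
      ∏ p ∈ q.D.primeFactors, (1 + (p : ℂ) ^ (-s)) := by
  have hD := q.D_pos.ne'
  rw [ramProd]
  split_ifs with h
  · have : ramifiedPrimes F = insert 2 q.D.primeFactors := by
      ext r
      rw [q.mem_ramifiedPrimes_iff, Finset.mem_insert, Nat.mem_primeFactors_of_ne_zero hD]
      constructor
      · rintro ⟨hr, h' | h'⟩
        · exact Or.inr ⟨hr, h'⟩
        · exact Or.inl h'.1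
      · rintro (rfl | ⟨hr, h'⟩)
        · exact ⟨Nat.prime_two, Or.inr ⟨rfl, h⟩⟩
        · exact ⟨hr, Or.inl h'⟩
    rw [this, Finset.prod_insert, Nat.cast_ofNat]
    intro h2
    exact absurd (q.odd_of_dvd_D (by omega) (Nat.dvd_of_mem_primeFactors h2)) (by decide)
  · have : ramifiedPrimes F = q.D.primeFactors := by
      ext r
      rw [q.mem_ramifiedPrimes_iff, Nat.mem_primeFactors_of_ne_zero hD]
      simp [h, D]
    rw [this, one_mul]

theorem ramProd_ne_zero {s : ℂ} (hs : 1 < s.re) : ramProd F s ≠ 0 := by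
  refine Finset.prod_ne_zero_iff.2 fun r hr => ?_
  exact one_add_ne_zero (summable_riemannZetaSummand hs)
    (Nat.prime_of_mem_primeFactors hr).two_le

theorem coprimeSum_one_one_zeta {s : ℂ} (hs : 1 < s.re) :
    coprimeSum (riemannZetaSummandHom (Complex.ne_zero_of_one_lt_re hs)) 1 1 * riemannZeta (2 * s) =
      riemannZeta s ^ 2 := by
  have hs2 : 1 < (2 * s).re := by simp; linarith
  rw [← tsum_riemannZetaSummand hs, ← coprimeSum_one_one (summable_riemannZetaSummand hs),
    ← tsum_riemannZetaSummand hs2]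
  congr 1
  refine tsum_congr fun n => ?_
  rw [map_pow]
  change (n : ℂ) ^ (-(2 * s)) = ((n : ℂ) ^ (-s)) ^ 2
  rw [← Complex.cpow_nat_mul]
  congr 1
  push_cast; ring

/-- The reflection sum in terms of the classes in `genus` and `halfGenus`. -/
theorem reflSum_eq (I : (FractionalIdeal (𝓞 F)⁰ F)ˣ) {s : ℂ} (hs : 1 < s.re) {V W : ℂ}
    (hV : ∑ g ∈ q.genus, indexSeries (riemannZetaSummandHom (Complex.ne_zero_of_one_lt_re hs)) I g = V)
    (hW : ∑ g ∈ q.halfGenus,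
      indexSeries (riemannZetaSummandHom (Complex.ne_zero_of_one_lt_re hs)) I g = W) :
    reflSum (lattice I) s = riemannZeta s ^ 2 / (2 * riemannZeta (2 * s) * ramProd F s) *
      if q.d % 4 = 1 then (1 - (2 : ℂ) ^ (-s) + 2 * ((2 : ℂ) ^ (-s)) ^ 2) * V
      else if q.d % 4 = 2 then (1 + (2 : ℂ) ^ (-s)) * V
      else (1 + (2 : ℂ) ^ (-s) + 2 * ((2 : ℂ) ^ (-s)) ^ 2) * V + (1 - (2 : ℂ) ^ (-s)) * W := by
  have hs2 : 1 < (2 * s).re := by simp; linarith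
  have hζ := riemannZeta_ne_zero_of_one_lt_re hs2
  have hR := ramProd_ne_zero (F := F) hs
  have hsum := summable_riemannZetaSummand hs
  have h2 := one_add_ne_zero hsum (le_refl 2)
  have h := q.sum_divisorTerm hsum I
  rw [hV, hW] at h
  have hχ2 : riemannZetaSummandHom (Complex.ne_zero_of_one_lt_re hs) 2 = (2 : ℂ) ^ (-s) := by
    change ((2 : ℕ) : ℂ) ^ (-s) = _
    rw [Nat.cast_ofNat]
  have hχ (p : ℕ) : riemannZetaSummandHom (Complex.ne_zero_of_one_lt_re hs) p = (p : ℂ) ^ (-s) := rfl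
  rw [hχ2] at h h2
  simp only [hχ] at h
  rw [(q.reflSummable_and_reflSum_eq I hs).2, ← coprimeSum_one_one_zeta hs]
  have hRe := q.ramProd_eq s
  set S := ∑ t ∈ q.D.divisors, q.divisorTerm (riemannZetaSummandHom (Complex.ne_zero_of_one_lt_re hs)) I t
  set R := ∏ p ∈ q.D.primeFactors, (1 + (p : ℂ) ^ (-s))
  rw [hRe] at hR ⊢
  have hR0 : R ≠ 0 := right_ne_zero_of_mul hR
  rw [← eq_div_iff hR0] at h
  rw [h]
  have hd := q.d_mod_four
  rcases hd with hd | hd | hd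
  · simp only [hd]
    norm_num
    field_simp
    ring
  · simp only [hd]
    norm_num
    field_simp
    ring
  · simp only [hd]
    norm_num
    field_simp
    ring

end ImagQuad

end

end LatticeZeta

end

/-! ### The three congruence classes of d. -/

theorem mainTheorem3 {F : Type*} [Field F] [NumberField F] [Algebra.IsQuadraticExtension ℚ F]
    (d : ℤ) (hd_neg : d < 0) (hd_sqf : Squarefree d) (hd1 : d ≠ -1) (hd3 : d ≠ -3)
    (δ : F) (hδ : δ ^ 2 = (d : F))
    (I : (FractionalIdeal (𝓞 F)⁰ F)ˣ)
    (s : ℂ) (hs : 1 < s.re) :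
    LatticeZeta.ReflSummable (LatticeZeta.lattice I) s ∧
    (∀ P : (FractionalIdeal (𝓞 F)⁰ F)ˣ → Prop,
      LSeriesSummable (fun n => (LatticeZeta.classCount I P n : ℂ)) s) ∧
    (d ≡ 1 [ZMOD 4] →
      LatticeZeta.reflSum (LatticeZeta.lattice I) s =
        (1 - (2 : ℂ) ^ (-s) + 2 * (2 : ℂ) ^ (-(2 * s))) * riemannZeta s ^ 2 /
            (2 * riemannZeta (2 * s) * LatticeZeta.ramProd F s) *
          LatticeZeta.classSeries I LatticeZeta.ConjInvariantClass s) ∧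
    (d ≡ 2 [ZMOD 4] →
      LatticeZeta.reflSum (LatticeZeta.lattice I) s =
        (1 - (2 : ℂ) ^ (-s) + 2 * (2 : ℂ) ^ (-(2 * s))) * riemannZeta s ^ 2 /
            (2 * riemannZeta (2 * s) * LatticeZeta.ramProd F s) *
          LatticeZeta.classSeries I LatticeZeta.ConjInvariantClass s +
        ((2 : ℂ) ^ (-s) - (2 : ℂ) ^ (-(2 * s))) * riemannZeta s ^ 2 /
            (riemannZeta (2 * s) * LatticeZeta.ramProd F s) *
          LatticeZeta.classSeries I
            (fun J => LatticeZeta.idealClass J ∈ LatticeZeta.ramSubgroup F) s) ∧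
    (d ≡ 3 [ZMOD 4] →
      LatticeZeta.reflSum (LatticeZeta.lattice I) s =
        (1 - (2 : ℂ) ^ (-s) + 2 * (2 : ℂ) ^ (-(2 * s))) * riemannZeta s ^ 2 /
            (2 * riemannZeta (2 * s) * LatticeZeta.ramProd F s) *
          LatticeZeta.classSeries I LatticeZeta.ConjInvariantClass s +
        (2 : ℂ) ^ (-s) * riemannZeta s ^ 2 /
            (riemannZeta (2 * s) * LatticeZeta.ramProd F s) *
          LatticeZeta.classSeries I
            (fun J => LatticeZeta.idealClass J ∈ LatticeZeta.orthoSubgroup F) s -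
        (2 : ℂ) ^ (-(2 * s)) * riemannZeta s ^ 2 /
            (riemannZeta (2 * s) * LatticeZeta.ramProd F s) *
          LatticeZeta.classSeries I
            (fun J => LatticeZeta.idealClass J ∈ LatticeZeta.ramSubgroup F ∧
              LatticeZeta.idealClass J ∉ LatticeZeta.orthoSubgroup F) s) := by
  let q : LatticeZeta.ImagQuad F := ⟨d, δ, hd_neg, hd_sqf, hd1, hd3, hδ⟩
  have hd : q.d = d := rfl
  have h2s : (2 : ℂ) ^ (-(2 * s)) = ((2 : ℂ) ^ (-s)) ^ 2 := by
    rw [← Complex.cpow_nat_mul]; congr 1; push_cast; ring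
  have hcoset (h : q.d % 4 = 3) (J : (FractionalIdeal (𝓞 F)⁰ F)ˣ) :
      LatticeZeta.ConjInvariantClass J ↔
        LatticeZeta.idealClass J ∈ q.genus.disjUnion q.halfGenus (q.disjoint_genus_halfGenus h) := by
    rw [q.conjInvariantClass_iff, Finset.mem_disjUnion, q.mem_halfGenus]
    simp only [h, true_and]
  have hgenus (h : q.d % 4 ≠ 3) (J : (FractionalIdeal (𝓞 F)⁰ F)ˣ) :
      LatticeZeta.ConjInvariantClass J ↔ LatticeZeta.idealClass J ∈ q.genus := by
    rw [q.conjInvariantClass_iff]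
    simp only [h, false_and, or_false]
  have hζ := riemannZeta_ne_zero_of_one_lt_re (s := 2 * s) (by simp; linarith)
  have hR := LatticeZeta.ImagQuad.ramProd_ne_zero (F := F) hs
  refine ⟨(q.reflSummable_and_reflSum_eq I hs).1,
    fun P => LatticeZeta.lSeriesSummable_classCount I P hs, fun h => ?_, fun h => ?_, fun h => ?_⟩
  · have h4 : q.d % 4 = 1 := h
    rw [q.reflSum_eq I hs rfl rfl, if_pos h4,
      LatticeZeta.classSeries_eq_sum I (hgenus (by omega)) hs, h2s]
    ring
  · have h4 : q.d % 4 = 2 := h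
    rw [q.reflSum_eq I hs rfl rfl, if_neg (by omega), if_pos h4,
      LatticeZeta.classSeries_eq_sum I (hgenus (by omega)) hs,
      LatticeZeta.classSeries_eq_sum I (fun J => q.mem_ramSubgroup_iff_of_ne (by omega)) hs, h2s]
    -- Both series run over the same classes, and with z = 2^{-s} one has 1 + z = (1 - z + 2z²) +
    -- 2(z - z²).
    field_simp
    ring
  · have h4 : q.d % 4 = 3 := h
    have hdiff (J : (FractionalIdeal (𝓞 F)⁰ F)ˣ) :
        (LatticeZeta.idealClass J ∈ LatticeZeta.ramSubgroup F ∧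
          LatticeZeta.idealClass J ∉ LatticeZeta.orthoSubgroup F) ↔
        LatticeZeta.idealClass J ∈ q.halfGenus := by
      rw [q.mem_ramSubgroup_iff h4, q.mem_orthoSubgroup_iff h4, ← q.mem_halfGenus]
      have : LatticeZeta.idealClass J ∈ q.halfGenus → LatticeZeta.idealClass J ∉ q.genus :=
        fun hJ => Finset.disjoint_right.1 (q.disjoint_genus_halfGenus h4) hJ
      tauto
    rw [q.reflSum_eq I hs rfl rfl, if_neg (by omega), if_neg (by omega),
      LatticeZeta.classSeries_eq_sum I (hcoset h4) hs,
      LatticeZeta.classSeries_eq_sum I (fun J => q.mem_orthoSubgroup_iff h4) hs,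
      LatticeZeta.classSeries_eq_sum I hdiff hs, h2s, Finset.sum_disjUnion]
    -- The coefficients match coset by coset: 1 + z + 2z² = (1 - z + 2z²) + 2z on `genus`, and 1 - z
    -- = (1 - z + 2z²) - 2z² on `halfGenus`, where z = 2^{-s}.
    field_simp
    ring
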